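/- A graph $G=(V,E)$ is a (possibly infinite) set $V$ with $E\subseteq[V]^2$, and $|G|$ denotes its one-complex: the quotient of the disjoint sum of the discrete space $V$ and of one copy $[0,1]_e$ of the unit interval for every edge $e=\{v,w\}$, obtained by identifying $0\in[0,1]_e$ with $v$ and $1\in[0,1]_e$ with $w$. An arc in a space is a subspace homeomorphic to $[0,1]$. For $n\in\mathbb N$, a graph $G$ is $n$-ac if for any choice of at most $n$ points of $|G|$ there is an arc in $|G|$ containing them. Consider six finite graphs, drawn in the plane: the arc (a closed segment), the circle, the lollipop (a circle and a segment meeting in one point, which is an end of the segment), the $\theta$-curve (a circle with a diameter), the figure-eight (two circles meeting in one point), and the dumbbell (two disjoint circles joined by a segment that meets each of them exactly in one of its ends). The endpoints are the two ends of the arc and the free end of the lollipop; the other four graphs have none. Theorem. Let $G$ be a non-degenerate graph, that is, $|G|$ has more than one point. The following are equivalent: (a) $G$ is $7$-ac; (b) $G$ is $n$-ac for every $n\in\mathbb N$; (c) $|G|$ is homeomorphic to one of the six finite graphs above, possibly with some of its endpoints removed. Moreover, every space listed in (c) is homeomorphic to $|H|$ for some graph $H$, and up to homeomorphism there are exactly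 nine such spaces: the six finite graphs, the arc without one endpoint, the arc without both endpoints, and the lollipop without its endpoint. -/

import Mathlib

namespace SimpleGraph

universe u

variable {V : Type u} (G : SimpleGraph V)

/-- The disjoint sum of the set of vertices and of one copy of `[0,1]` for every edge. -/
def PreOneComplex : Type u := V ⊕ (Σ _ : G.edgeSet, unitInterval)

/-- The topology of the disjoint sum, where the set of vertices is discrete. -/
instance : TopologicalSpace G.PreOneComplex :=
  letI : TopologicalSpace V := ⊥
  inferInstanceAs (TopologicalSpace (V ⊕ (Σ _ : G.edgeSet, unitInterval)))

/-- For an edge `e = {v, w}` (written as an ordered pair in a fixed way) the point `0` of the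
interval of `e` is glued to `v` and the point `1` is glued to `w`. -/
inductive OneComplexGlue : G.PreOneComplex → G.PreOneComplex → Prop
  | source (e : G.edgeSet) :
      OneComplexGlue (Sum.inr ⟨e, (0 : unitInterval)⟩) (Sum.inl (Quot.out e.1).1)
  | target (e : G.edgeSet) :
      OneComplexGlue (Sum.inr ⟨e, (1 : unitInterval)⟩) (Sum.inl (Quot.out e.1).2)

/-- The one-complex `|G|` of a graph `G`: the quotient by the equivalence relation generated by
the gluing. -/
def OneComplex : Type u := Quot G.OneComplexGlue

/-- The one-complex carries the quotient topology. -/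
instance : TopologicalSpace G.OneComplex :=
  inferInstanceAs (TopologicalSpace (Quot G.OneComplexGlue))

end SimpleGraph

namespace ArcConnected

/-- An arc in a space: a subset homeomorphic to the closed unit interval. -/
def IsArc {X : Type*} [TopologicalSpace X] (A : Set X) : Prop :=
  Nonempty (unitInterval ≃ₜ A)

/-- A space is `n`-arc connected if any at most `n` of its points lie on a common arc. -/
def IsNAC (n : ℕ) (X : Type*) [TopologicalSpace X] : Prop :=
  ∀ S : Finset X, S.card ≤ n → ∃ A : Set X, IsArc A ∧ (S : Set X) ⊆ A

/-- A space is `ω`-arc connected if it is `n`-arc connected for all `n`. -/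
def IsOmegaAC (X : Type*) [TopologicalSpace X] : Prop :=
  ∀ n : ℕ, IsNAC n X

/-- Names of the six finite graphs. -/
inductive FiniteModel : Type
  | arc
  | circle
  | lollipop
  | theta
  | figureEight
  | dumbbell

/-- The six finite graphs, drawn in the plane. -/
def FiniteModel.carrier : FiniteModel → Set ℂ
  | .arc => segment ℝ 0 1
  | .circle => Metric.sphere 0 1
  | .lollipop => Metric.sphere 0 1 ∪ segment ℝ 1 2
  | .theta => Metric.sphere 0 1 ∪ segment ℝ (-1) 1
  | .figureEight => Metric.sphere (-1) 1 ∪ Metric.sphere 1 1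
  | .dumbbell => Metric.sphere (-2) 1 ∪ segment ℝ (-1) 1 ∪ Metric.sphere 2 1

/-- The endpoints (vertices of degree one) of the six finite graphs. -/
def FiniteModel.endpoints : FiniteModel → Set ℂ
  | .arc => {0, 1}
  | .circle => ∅
  | .lollipop => {2}
  | .theta => ∅
  | .figureEight => ∅
  | .dumbbell => ∅

/-- `Y` is one of the six finite graphs with some (possibly none, possibly all) of its endpoints
removed. -/
def IsModelSpace (Y : Set ℂ) : Prop :=
  ∃ M : FiniteModel, ∃ S : Set ℂ, S ⊆ M.endpoints ∧ Y = M.carrier \ S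

end ArcConnected

/-! The hard implication is from 7-ac to the list of shapes. Apply 7-ac to the midpoints of at most
seven edges and keep the part of the arc between the extreme midpoints. It traces a trail through
all these edges (`exists_track_of_isNAC`). No inner vertex of this track is repeated, but an end
vertex may be met again, because the arc stops halfway along the first and the last edge.

Counting steps at a vertex bounds degrees. Three track edges at a vertex force it to be an inner
vertex and also an end (`IsTrack.three_le`), four force both ends to be there (`IsTrack.four_le`),
and five are impossible. Since a track has only two ends, branch vertices compete for them. A vertex
of degree four excludes any other branch vertex (4 + 3 edges) and gives the figure-eight. If all
degrees are at most three, two branch vertices give the theta-curve or the dumbbell (3 + 3 edges).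
Three branch vertices are impossible: in a suitable configuration, 3 + 3 + 1 edges would need three
ends (`HasTracks.not_three_branches`). With one branch vertex, a loop continues into a finite or
infinite tail; with none, the graph is a path, a ray, a line or a cycle. `HasTracks.classification`
collects these cases.

In each case the whole graph is run through once by a sequence of vertices indexed by an integer
interval I, so |G| is the quotient of I by a few identifications of integers (`GluedTour`,
`IsTour.isQuotientMap`). After a monotone change of parameter this is one of nine standard quotients
(`HasShape`), and the plane models are the same quotients.

Conversely, each of the nine quotients is ω-ac: some interval meets every class exactly once, so a
compact piece of it carries any finite set injectively (`IsGlued.isOmegaAC`). The nine spaces are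
told apart by compactness, cut points and nonseparating pairs (`ShapeProperty`), and explicit vertex
sequences realize each of them as a graph. -/

namespace SimpleGraph.OneComplex

/-! ### The one-complex: barycentric coordinates, separation, open edges. -/

open Topology

variable {V : Type*} {G : SimpleGraph V}

/-- The point of the one-complex given by a vertex. -/
def vert (G : SimpleGraph V) (v : V) : G.OneComplex := Quot.mk _ (Sum.inl v)

/-- The point at time `t` on the edge `e`. -/
def edgePt (e : G.edgeSet) (t : unitInterval) : G.OneComplex := Quot.mk _ (Sum.inr ⟨e, t⟩)

lemma out_mk (e : G.edgeSet) : s((Quot.out e.1).1, (Quot.out e.1).2) = e.1 :=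
  Quot.out_eq e.1

lemma out_adj (e : G.edgeSet) : G.Adj (Quot.out e.1).1 (Quot.out e.1).2 := by
  have := e.2
  rw [← out_mk e] at this
  exact this

lemma edgePt_zero (e : G.edgeSet) : edgePt e 0 = vert G (Quot.out e.1).1 :=
  Quot.sound (OneComplexGlue.source e)

lemma edgePt_one (e : G.edgeSet) : edgePt e 1 = vert G (Quot.out e.1).2 :=
  Quot.sound (OneComplexGlue.target e)

lemma cases_pt (x : G.OneComplex) : (∃ v, x = vert G v) ∨ ∃ e t, x = edgePt e t := by
  induction x using Quot.ind with
  | mk a =>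
    rcases a with v | ⟨e, t⟩
    · exact Or.inl ⟨v, rfl⟩
    · exact Or.inr ⟨e, t, rfl⟩

lemma continuous_edgePt (e : G.edgeSet) : Continuous (edgePt e) := by
  let _ : TopologicalSpace V := ⊥
  refine continuous_quot_mk.comp (X := unitInterval) (Y := G.PreOneComplex) ?_
  exact continuous_inr.comp
    (continuous_sigmaMk (σ := fun _ : G.edgeSet => unitInterval) (i := e))

/-- The vertices form a discrete summand, which imposes no condition, so only the edges have to be
tested. -/
lemma isOpen_iff {U : Set G.OneComplex} : IsOpen U ↔ ∀ e, IsOpen (edgePt e ⁻¹' U) := by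
  refine ⟨fun h e => h.preimage (continuous_edgePt e), fun h => ?_⟩
  let _ : TopologicalSpace V := ⊥
  have : DiscreteTopology V := ⟨rfl⟩
  change IsOpen ((Quot.mk G.OneComplexGlue) ⁻¹' U : Set (V ⊕ (Σ _ : G.edgeSet, unitInterval)))
  rw [isOpen_sum_iff]
  exact ⟨isOpen_discrete _, isOpen_sigma_iff.2 h⟩

lemma isClosed_iff {U : Set G.OneComplex} : IsClosed U ↔ ∀ e, IsClosed (edgePt e ⁻¹' U) := by
  simp only [← isOpen_compl_iff, isOpen_iff, Set.preimage_compl]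

lemma continuous_iff {Y : Type*} [TopologicalSpace Y] {f : G.OneComplex → Y} :
    Continuous f ↔ ∀ e, Continuous (f ∘ edgePt e) := by
  refine ⟨fun h e => h.comp (continuous_edgePt e), fun h => ?_⟩
  rw [continuous_def]
  intro U hU
  rw [isOpen_iff]
  intro e
  exact hU.preimage (h e)

/-- The affine extension to the one-complex of a function on the vertices. -/
noncomputable def affine (G : SimpleGraph V) (f : V → ℝ) : G.OneComplex → ℝ :=
  Quot.lift (Sum.elim f fun p => (1 - p.2.1) * f (Quot.out p.1.1).1 + p.2.1 * f (Quot.out p.1.1).2)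
    (by rintro _ _ (e | e) <;> simp)

@[simp] lemma affine_vert (f : V → ℝ) (v : V) : affine G f (vert G v) = f v := rfl

lemma affine_edgePt (f : V → ℝ) (e : G.edgeSet) (t : unitInterval) :
    affine G f (edgePt e t) = (1 - t.1) * f (Quot.out e.1).1 + t.1 * f (Quot.out e.1).2 := rfl

lemma continuous_affine (f : V → ℝ) : Continuous (affine G f) := by
  rw [continuous_iff]
  intro e
  have : affine G f ∘ edgePt e =
    fun t => (1 - t.1) * f (Quot.out e.1).1 + t.1 * f (Quot.out e.1).2 := rfl
  rw [this]
  fun_prop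

open Classical in
/-- The barycentric coordinate of a point at a vertex. -/
noncomputable def coord (v : V) : G.OneComplex → ℝ := affine G (Pi.single v 1)

lemma continuous_coord (v : V) : Continuous (coord (G := G) v) := continuous_affine _

open Classical in
lemma coord_vert (v w : V) : coord v (vert G w) = if w = v then 1 else 0 := by
  simp [coord, Pi.single_apply]

open Classical in
/-- The point at time `t` on the edge from `a` to `b`. -/
noncomputable def pt (G : SimpleGraph V) (a b : V) (t : unitInterval) : G.OneComplex :=
  if h : G.Adj a b then
    if (Quot.out s(a, b)).1 = a then edgePt ⟨s(a, b), h⟩ t else edgePt ⟨s(a, b), h⟩ (unitInterval.symm t)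
  -- This default value makes `pt_zero` hold without adjacency, hence `tracePath_int` for every
  -- sequence of vertices.
  else vert G a

lemma out_cases {a b : V} (h : G.Adj a b) :
    ((Quot.out s(a, b)).1 = a ∧ (Quot.out s(a, b)).2 = b) ∨
      ((Quot.out s(a, b)).1 = b ∧ (Quot.out s(a, b)).2 = a) := by
  have := out_mk (⟨s(a, b), h⟩ : G.edgeSet)
  exact Sym2.eq_iff.1 this

lemma pt_cases {a b : V} (h : G.Adj a b) :
    ((Quot.out s(a, b)).1 = a ∧ (Quot.out s(a, b)).2 = b ∧
      ∀ t, pt G a b t = edgePt ⟨s(a, b), h⟩ t) ∨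
    ((Quot.out s(a, b)).1 = b ∧ (Quot.out s(a, b)).2 = a ∧
      ∀ t, pt G a b t = edgePt ⟨s(a, b), h⟩ (unitInterval.symm t)) := by
  rcases out_cases h with ⟨h1, h2⟩ | ⟨h1, h2⟩
  · exact Or.inl ⟨h1, h2, fun t => by simp [pt, h, h1]⟩
  · exact Or.inr ⟨h1, h2, fun t => by simp [pt, h, h1, h.ne']⟩

lemma affine_pt (f : V → ℝ) {a b : V} (h : G.Adj a b) (t : unitInterval) :
    affine G f (pt G a b t) = (1 - t.1) * f a + t.1 * f b := by
  rcases pt_cases h with ⟨h1, h2, h3⟩ | ⟨h1, h2, h3⟩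
  · rw [h3, affine_edgePt, h1, h2]
  · rw [h3, affine_edgePt, h1, h2]
    simp only [unitInterval.coe_symm_eq]
    ring

lemma continuous_pt {a b : V} : Continuous (pt G a b) := by
  by_cases h : G.Adj a b
  · rcases pt_cases h with ⟨h1, h2, h3⟩ | ⟨h1, h2, h3⟩
    · rw [funext h3]
      exact continuous_edgePt _
    · rw [funext h3]
      exact (continuous_edgePt _).comp unitInterval.continuous_symm
  · have : pt G a b = fun _ => vert G a := by
      funext t
      simp [pt, h]
    rw [this]
    exact continuous_const

lemma pt_zero (a b : V) : pt G a b 0 = vert G a := by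
  by_cases h : G.Adj a b
  · rcases pt_cases h with ⟨h1, h2, h3⟩ | ⟨h1, h2, h3⟩
    · rw [h3, edgePt_zero, h1]
    · rw [h3, unitInterval.symm_zero, edgePt_one, h2]
  · simp [pt, h]

lemma pt_one {a b : V} (h : G.Adj a b) : pt G a b 1 = vert G b := by
  rcases pt_cases h with ⟨h1, h2, h3⟩ | ⟨h1, h2, h3⟩
  · rw [h3, edgePt_one, h2]
  · rw [h3, unitInterval.symm_one, edgePt_zero, h1]

lemma edgePt_eq_pt (e : G.edgeSet) (t : unitInterval) :
    edgePt e t = pt G (Quot.out e.1).1 (Quot.out e.1).2 t := by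
  have h := out_adj e
  have he : (⟨s((Quot.out e.1).1, (Quot.out e.1).2), h⟩ : G.edgeSet) = e := Subtype.ext (out_mk e)
  rcases pt_cases h with ⟨h1, h2, h3⟩ | ⟨h1, h2, h3⟩
  · rw [h3, he]
  · rw [out_mk e] at h1
    exact absurd h1 h.ne

/-- Every point is a vertex or an inner point of an edge. -/
lemma cases_inner (x : G.OneComplex) : (∃ v, x = vert G v) ∨
    ∃ a b, ∃ t : unitInterval, G.Adj a b ∧ 0 < t ∧ t < 1 ∧ x = pt G a b t := by
  rcases cases_pt x with h | ⟨e, t, rfl⟩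
  · exact Or.inl h
  · rcases eq_or_ne t 0 with rfl | h0
    · exact Or.inl ⟨_, edgePt_zero e⟩
    rcases eq_or_ne t 1 with rfl | h1
    · exact Or.inl ⟨_, edgePt_one e⟩
    exact Or.inr ⟨_, _, t, out_adj e, unitInterval.pos_iff_ne_zero.2 h0,
      unitInterval.lt_one_iff_ne_one.2 h1, edgePt_eq_pt e t⟩

open Classical in
lemma coord_pt (v : V) {a b : V} (h : G.Adj a b) (t : unitInterval) :
    coord v (pt G a b t) = (if a = v then 1 - t.1 else 0) + (if b = v then t.1 else 0) := by
  rw [coord, affine_pt _ h]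
  simp [Pi.single_apply]

open Classical in
lemma pt_symm {a b : V} (h : G.Adj a b) (t : unitInterval) :
    pt G b a t = pt G a b (unitInterval.symm t) := by
  have hs : s(b, a) = s(a, b) := Sym2.eq_swap
  rcases pt_cases h with ⟨h1, h2, h3⟩ | ⟨h1, h2, h3⟩ <;>
  rcases pt_cases h.symm with ⟨k1, k2, k3⟩ | ⟨k1, k2, k3⟩
  · rw [hs, h1] at k1
    exact absurd k1 h.ne
  · rw [h3, k3]
    congr 2
  · rw [h3, k3, unitInterval.symm_symm]
    congr 2
  · rw [hs, h1] at k1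
    exact absurd k1 h.ne'

/-- A vertex has coordinate 1 at itself. An inner point of an edge has exactly two positive
coordinates, both below 1, and they reveal the ends of the edge and the position on it. -/
lemma coord_ext {x y : G.OneComplex} (h : ∀ v, coord v x = coord v y) : x = y := by
  classical
  rcases cases_inner x with ⟨v, rfl⟩ | ⟨a, b, t, hab, h0, h1, rfl⟩ <;>
  rcases cases_inner y with ⟨w, rfl⟩ | ⟨c, d, u, hcd, k0, k1, rfl⟩
  · have := h v
    simp only [coord_vert, if_true] at this
    split_ifs at this with hw
    · rw [hw]
    · norm_num at this
  · have := h v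
    have k0' : 0 < u.1 := k0
    have k1' : u.1 < 1 := k1
    simp only [coord_vert, if_true, coord_pt _ hcd] at this
    split_ifs at this with h2 h3 h3
    · exact absurd (h2.trans h3.symm) hcd.ne
    all_goals linarith
  · have := h w
    have k0' : 0 < t.1 := h0
    have k1' : t.1 < 1 := h1
    simp only [coord_vert, if_true, coord_pt _ hab] at this
    split_ifs at this with h2 h3 h3
    · exact absurd (h2.trans h3.symm) hab.ne
    all_goals linarith
  · have l0 : 0 < t.1 := h0
    have l1 : t.1 < 1 := h1
    have m0 : 0 < u.1 := k0
    have m1 : u.1 < 1 := k1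
    have ha := h a
    have hb := h b
    have hab' := hab.ne
    have hcd' := hcd.ne
    simp only [coord_pt _ hab, coord_pt _ hcd, if_true, if_neg hab', if_neg hab'.symm] at ha hb
    by_cases hca : c = a
    · subst hca
      simp only [if_true, if_neg hcd'.symm, if_neg hab'] at ha hb
      split_ifs at hb with h2
      · subst h2
        have : t = u := Subtype.ext (by linarith)
        rw [this]
      · linarith
    · by_cases hda : d = a
      · subst hda
        simp only [if_true, if_neg hca, if_neg hab'] at ha hb
        split_ifs at hb with h2
        · subst h2
          rw [pt_symm hab]
          congr 1
          exact Subtype.ext (by simp; linarith)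
        · linarith
      · simp only [if_neg hca, if_neg hda] at ha
        linarith

/-- The coordinates are continuous and separate points, so no local finiteness of the graph is
needed. -/
instance : T2Space G.OneComplex := by
  refine ⟨fun x y hxy => ?_⟩
  obtain ⟨v, hv⟩ : ∃ v, coord v x ≠ coord v y := by
    by_contra! h
    exact hxy (coord_ext h)
  obtain ⟨u, w, hu, hw, hxu, hyw, hd⟩ := t2_separation hv
  exact ⟨coord v ⁻¹' u, coord v ⁻¹' w, hu.preimage (continuous_coord v),
    hw.preimage (continuous_coord v), hxu, hyw, hd.preimage _⟩

lemma vert_injective : Function.Injective (vert G) := by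
  classical
  intro v w h
  have := congrArg (coord v) h
  simp only [coord_vert, if_true] at this
  by_contra hne
  simp [Ne.symm hne] at this

lemma vert_ne_pt {a b v : V} (h : G.Adj a b) {t : unitInterval} (h0 : 0 < t) (h1 : t < 1) :
    vert G v ≠ pt G a b t := by
  classical
  intro hv
  have := congrArg (coord v) hv
  have k0' : 0 < t.1 := h0
  have k1' : t.1 < 1 := h1
  simp only [coord_vert, if_true, coord_pt _ h] at this
  split_ifs at this with h2 h3 h3
  · exact absurd (h2.trans h3.symm) h.ne
  all_goals linarith

/-- An inner point of an edge determines the edge. -/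
lemma pt_eq_pt {a b c d : V} (hab : G.Adj a b) (hcd : G.Adj c d) {t u : unitInterval}
    (h0 : 0 < t) (h1 : t < 1) (h : pt G a b t = pt G c d u) :
    (a = c ∧ b = d ∧ t = u) ∨ (a = d ∧ b = c ∧ u = unitInterval.symm t) := by
  classical
  have l0 : 0 < t.1 := h0
  have l1 : t.1 < 1 := h1
  have m0 : 0 ≤ u.1 := u.2.1
  have m1 : u.1 ≤ 1 := u.2.2
  have ha := congrArg (coord a) h
  have hb := congrArg (coord b) h
  have hab' := hab.ne
  have hcd' := hcd.ne
  simp only [coord_pt _ hab, coord_pt _ hcd, if_true, if_neg hab', if_neg hab'.symm] at ha hb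
  by_cases hca : c = a
  · subst hca
    simp only [if_true, if_neg hcd'.symm, if_neg hab'] at ha hb
    split_ifs at hb with h2
    · exact Or.inl ⟨rfl, h2.symm, Subtype.ext (by linarith)⟩
    · linarith
  · by_cases hda : d = a
    · subst hda
      simp only [if_true, if_neg hca, if_neg hab'] at ha hb
      split_ifs at hb with h2
      · exact Or.inr ⟨rfl, h2.symm, Subtype.ext (by simp; linarith)⟩
      · linarith
    · simp only [if_neg hca, if_neg hda] at ha
      linarith

/-- A set of vertices is closed. -/
lemma isClosed_vert_image (S : Set V) : IsClosed (vert G '' S) := by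
  rw [isClosed_iff]
  intro e
  refine Set.Finite.isClosed (Set.Finite.subset (Set.toFinite {0, 1}) ?_)
  rintro t ⟨v, -, hv⟩
  by_contra ht
  simp only [Set.mem_insert_iff, Set.mem_singleton_iff, not_or] at ht
  rw [edgePt_eq_pt] at hv
  exact vert_ne_pt (out_adj e) (unitInterval.pos_iff_ne_zero.2 ht.1)
    (unitInterval.lt_one_iff_ne_one.2 ht.2) hv

/-- The inner points of an edge. -/
def openEdge (e : G.edgeSet) : Set G.OneComplex := edgePt e '' Set.Ioo 0 1

lemma edgePt_mem_openEdge {e f : G.edgeSet} {t : unitInterval} :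
    edgePt f t ∈ openEdge e ↔ f = e ∧ t ∈ Set.Ioo 0 1 := by
  constructor
  · rintro ⟨u, hu, h⟩
    rw [edgePt_eq_pt, edgePt_eq_pt] at h
    have := pt_eq_pt (out_adj e) (out_adj f) hu.1 hu.2 h
    rcases this with ⟨h1, h2, h3⟩ | ⟨h1, h2, h3⟩
    · have : f = e := Subtype.ext (by rw [← out_mk e, ← out_mk f, h1, h2])
      exact ⟨this, h3 ▸ hu⟩
    · have : f = e := Subtype.ext (by rw [← out_mk e, ← out_mk f, h1, h2, Sym2.eq_swap])
      subst this
      exact absurd h1 (out_adj f).ne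
  · rintro ⟨rfl, h⟩
    exact ⟨t, h, rfl⟩

lemma vert_notMem_openEdge {e : G.edgeSet} {v : V} : vert G v ∉ openEdge e := by
  rintro ⟨u, hu, h⟩
  rw [edgePt_eq_pt] at h
  exact vert_ne_pt (out_adj e) hu.1 hu.2 h.symm

lemma isOpen_openEdge (e : G.edgeSet) : IsOpen (openEdge e) := by
  rw [isOpen_iff]
  intro f
  by_cases h : f = e
  · subst h
    convert isOpen_Ioo (a := (0 : unitInterval)) (b := 1) using 1
    ext t
    simp [edgePt_mem_openEdge]
  · convert isOpen_empty
    ext t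
    simp [edgePt_mem_openEdge, h]

lemma exists_mem_openEdge {x : G.OneComplex} (hx : x ∉ Set.range (vert G)) :
    ∃ e, x ∈ openEdge e := by
  rcases cases_pt x with ⟨v, rfl⟩ | ⟨e, t, rfl⟩
  · exact absurd ⟨v, rfl⟩ hx
  · refine ⟨e, t, ⟨unitInterval.pos_iff_ne_zero.2 ?_, unitInterval.lt_one_iff_ne_one.2 ?_⟩, rfl⟩
    · rintro rfl
      exact hx ⟨_, (edgePt_zero e).symm⟩
    · rintro rfl
      exact hx ⟨_, (edgePt_one e).symm⟩

lemma openEdge_eq_of_mem {e f : G.edgeSet} {x : G.OneComplex} (h : x ∈ openEdge e)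
    (k : x ∈ openEdge f) : e = f := by
  obtain ⟨t, ht, rfl⟩ := h
  exact (edgePt_mem_openEdge.1 k).1

/-- A connected set without vertices lies in an edge. -/
lemma subset_openEdge {C : Set G.OneComplex} (hC : IsPreconnected C)
    (hV : ∀ v, vert G v ∉ C) {e : G.edgeSet} {x : G.OneComplex} (hx : x ∈ C)
    (hxe : x ∈ openEdge e) : C ⊆ openEdge e := by
  have hopen : IsOpen (⋃ f ∈ {f | f ≠ e}, openEdge f) :=
    isOpen_biUnion fun f _ => isOpen_openEdge f
  refine hC.subset_left_of_subset_union (isOpen_openEdge e) hopen ?_ ?_ ⟨x, hx, hxe⟩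
  · rw [Set.disjoint_left]
    intro y hy hy2
    simp only [Set.mem_iUnion] at hy2
    obtain ⟨f, hf, hyf⟩ := hy2
    exact hf (openEdge_eq_of_mem hyf hy)
  · intro y hy
    obtain ⟨f, hf⟩ := exists_mem_openEdge (x := y) (by rintro ⟨v, rfl⟩; exact hV v hy)
    by_cases h : f = e
    · exact Or.inl (h ▸ hf)
    · exact Or.inr (Set.mem_biUnion (show f ∈ {f | f ≠ e} from h) hf)

/-- The closed edge. -/
lemma isClosed_range_edgePt (e : G.edgeSet) : IsClosed (Set.range (edgePt e)) :=
  (isCompact_range (continuous_edgePt e)).isClosed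

lemma vert_mem_range_edgePt {e : G.edgeSet} {v : V} (h : vert G v ∈ Set.range (edgePt e)) :
    v ∈ e.1 := by
  obtain ⟨t, ht⟩ := h
  rw [edgePt_eq_pt] at ht
  rw [← out_mk e]
  rcases eq_or_ne t 0 with rfl | h0
  · rw [pt_zero] at ht
    simp [← vert_injective ht]
  rcases eq_or_ne t 1 with rfl | h1
  · rw [pt_one (out_adj e)] at ht
    simp [← vert_injective ht]
  exact absurd ht.symm (vert_ne_pt (out_adj e) (unitInterval.pos_iff_ne_zero.2 h0)
    (unitInterval.lt_one_iff_ne_one.2 h1))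

end SimpleGraph.OneComplex

/-! ### Tours: the one-complex as a quotient of a real interval. -/

namespace SimpleGraph

open Topology OneComplex

variable {V : Type*} {G : SimpleGraph V}

/-- An enumeration of the vertices of `G` by the integers in `I` so that the steps of length one
in `I` enumerate the edges of `G` without repetitions. -/
structure IsTour (G : SimpleGraph V) (I : Set ℝ) (w : ℤ → V) : Prop where
  -- Together with `ordConn`, the next two fields say that I is an interval whose finite ends are
  -- integers belonging to I.
  floor_mem : ∀ x ∈ I, (⌊x⌋ : ℝ) ∈ I
  ceil_mem : ∀ x ∈ I, (⌈x⌉ : ℝ) ∈ I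
  ordConn : I.OrdConnected
  adj : ∀ n : ℤ, (n : ℝ) ∈ I → (n : ℝ) + 1 ∈ I → G.Adj (w n) (w (n + 1))
  edge_surj : ∀ a b, G.Adj a b →
    ∃ n : ℤ, (n : ℝ) ∈ I ∧ (n : ℝ) + 1 ∈ I ∧ s(a, b) = s(w n, w (n + 1))
  edge_inj : ∀ m n : ℤ, (m : ℝ) ∈ I → (m : ℝ) + 1 ∈ I → (n : ℝ) ∈ I → (n : ℝ) + 1 ∈ I →
    s(w m, w (m + 1)) = s(w n, w (n + 1)) → m = n
  vert_surj : ∀ v, ∃ n : ℤ, (n : ℝ) ∈ I ∧ w n = v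

/-- The piecewise affine path in the one-complex through the vertices `w n`. -/
noncomputable def tracePath (G : SimpleGraph V) (w : ℤ → V) (x : ℝ) : G.OneComplex :=
  pt G (w ⌊x⌋) (w (⌊x⌋ + 1)) ⟨Int.fract x, Int.fract_nonneg x, (Int.fract_lt_one x).le⟩

lemma tracePath_int (w : ℤ → V) (n : ℤ) : tracePath G w n = vert G (w n) := by
  rw [← pt_zero (G := G) (w n) (w (n + 1)), tracePath]
  simp only [Int.floor_intCast, Int.fract_intCast]
  rfl

/-- At x = n + 1 the floor has already passed to the next edge, but both edges yield the vertex w (n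
+ 1) there. Having the formula on the closed interval is what allows continuity to be checked on a
closed cover. -/
lemma tracePath_eq_pt {w : ℤ → V} {n : ℤ} (h : G.Adj (w n) (w (n + 1))) {x : ℝ}
    (hx : x ∈ Set.Icc (n : ℝ) (n + 1)) :
    tracePath G w x = pt G (w n) (w (n + 1)) (Set.projIcc 0 1 zero_le_one (x - n)) := by
  rcases hx.2.eq_or_lt with h1 | h1
  · have : tracePath G w x = vert G (w (n + 1)) := by
      rw [← tracePath_int, h1]
      push_cast
      rfl
    rw [this, ← pt_one h]
    congr 1
    rw [h1]
    simp
  · have hf : ⌊x⌋ = n := Int.floor_eq_iff.2 ⟨hx.1, h1⟩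
    rw [tracePath, hf]
    congr 1
    apply Subtype.ext
    change Int.fract x = _
    rw [Set.coe_projIcc]
    have h2 : Int.fract x = x - n := by rw [← hf]; rfl
    have := hx.1
    rw [h2, min_eq_right (by linarith), max_eq_right (by linarith)]

namespace IsTour

variable {I : Set ℝ} {w : ℤ → V}

lemma mem_of_nonint (T : IsTour G I w) {x : ℝ} (hx : x ∈ I) {n : ℤ} (h0 : (n : ℝ) < x)
    (h1 : x < n + 1) : (n : ℝ) ∈ I ∧ (n : ℝ) + 1 ∈ I := by
  have hf : ⌊x⌋ = n := Int.floor_eq_iff.2 ⟨h0.le, h1⟩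
  have hc : ⌈x⌉ = n + 1 := Int.ceil_eq_iff.2 ⟨by push_cast; linarith, by push_cast; linarith⟩
  have a := T.floor_mem x hx
  have b := T.ceil_mem x hx
  rw [hf] at a
  rw [hc] at b
  push_cast at b
  exact ⟨a, b⟩

lemma int_or (T : IsTour G I w) {x : ℝ} (hx : x ∈ I) : (∃ n : ℤ, x = n) ∨
    ∃ n : ℤ, ∃ t : unitInterval, (n : ℝ) ∈ I ∧ (n : ℝ) + 1 ∈ I ∧ 0 < t ∧ t < 1 ∧ x = n + t.1 ∧
      tracePath G w x = pt G (w n) (w (n + 1)) t := by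
  rcases (Int.floor_le x).eq_or_lt with h | h
  · exact Or.inl ⟨_, h.symm⟩
  · obtain ⟨h1, h2⟩ := T.mem_of_nonint hx h (Int.lt_floor_add_one x)
    refine Or.inr ⟨⌊x⌋, ⟨Int.fract x, Int.fract_nonneg x, (Int.fract_lt_one x).le⟩, h1, h2, ?_, ?_,
      (Int.floor_add_fract x).symm, rfl⟩
    · change 0 < Int.fract x
      rw [Int.fract]
      linarith
    · exact Int.fract_lt_one x

lemma continuous (T : IsTour G I w) : Continuous fun x : I => tracePath G w x := by
  have hlf : _root_.LocallyFinite fun n : ℤ => {x : I | (x : ℝ) ∈ Set.Icc (n : ℝ) (n + 1)} := by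
    intro x
    refine ⟨Subtype.val ⁻¹' Set.Ioo (x.1 - 1) (x.1 + 1),
      (isOpen_Ioo.preimage continuous_subtype_val).mem_nhds (by simp), ?_⟩
    refine (Set.finite_Icc (⌊x.1⌋ - 3) (⌊x.1⌋ + 3)).subset ?_
    rintro n ⟨y, hy1, hy2⟩
    simp only [Set.mem_preimage, Set.mem_Ioo, Set.mem_ofPred_eq, Set.mem_Icc] at hy1 hy2 ⊢
    have a := Int.floor_le x.1
    have b := Int.lt_floor_add_one x.1
    constructor
    · have : ((⌊x.1⌋ - 3 : ℤ) : ℝ) ≤ n := by push_cast; linarith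
      exact_mod_cast this
    · have : (n : ℝ) ≤ (⌊x.1⌋ + 3 : ℤ) := by push_cast; linarith
      exact_mod_cast this
  refine hlf.continuous ?_ (fun n => isClosed_Icc.preimage continuous_subtype_val) ?_
  · ext x
    simp only [Set.mem_iUnion, Set.mem_univ, iff_true]
    exact ⟨⌊x.1⌋, Int.floor_le _, (Int.lt_floor_add_one _).le⟩
  · intro n
    by_cases h : (n : ℝ) ∈ I ∧ (n : ℝ) + 1 ∈ I
    · refine ContinuousOn.congr (f := fun x : I =>
        pt G (w n) (w (n + 1)) (Set.projIcc 0 1 zero_le_one (x.1 - n))) ?_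
        (fun x hx => tracePath_eq_pt (T.adj n h.1 h.2) hx)
      exact (continuous_pt.comp (continuous_projIcc.comp
        (continuous_subtype_val.sub continuous_const))).continuousOn
    -- A unit interval not contained in I meets I in at most one of its ends: an inner point would
    -- bring both ends into I.
    · refine Set.Subsingleton.continuousOn ?_ _
      have key : ∀ x : I, (x : ℝ) ∈ Set.Icc (n : ℝ) (n + 1) → x.1 = n ∨ x.1 = n + 1 := by
        intro x hx
        by_contra! hne
        exact h (T.mem_of_nonint x.2 (lt_of_le_of_ne hx.1 hne.1.symm) (lt_of_le_of_ne hx.2 hne.2))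
      intro x hx y hy
      apply Subtype.ext
      rcases key x hx with h1 | h1 <;> rcases key y hy with h2 | h2
      · rw [h1, h2]
      · exact absurd ⟨h1 ▸ x.2, h2 ▸ y.2⟩ h
      · exact absurd ⟨h2 ▸ y.2, h1 ▸ x.2⟩ h
      · rw [h1, h2]

/-- An inner point determines its edge and its position there, and each edge is traversed only once,
so distinct times can agree only at integers. -/
lemma tracePath_eq_iff (T : IsTour G I w) {x y : ℝ} (hx : x ∈ I) (hy : y ∈ I) :
    tracePath G w x = tracePath G w y ↔ x = y ∨ ∃ m n : ℤ, x = m ∧ y = n ∧ w m = w n := by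
  constructor
  · intro h
    rcases T.int_or hx with ⟨m, rfl⟩ | ⟨m, t, m0, m1, t0, t1, hxt, ht⟩ <;>
    rcases T.int_or hy with ⟨n, rfl⟩ | ⟨n, u, n0, n1, u0, u1, hyu, hu⟩
    · rw [tracePath_int, tracePath_int] at h
      exact Or.inr ⟨m, n, rfl, rfl, vert_injective h⟩
    · rw [tracePath_int, hu] at h
      exact absurd h (vert_ne_pt (T.adj n n0 n1) u0 u1)
    · rw [tracePath_int, ht] at h
      exact absurd h.symm (vert_ne_pt (T.adj m m0 m1) t0 t1)
    · rw [ht, hu] at h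
      rcases pt_eq_pt (T.adj m m0 m1) (T.adj n n0 n1) t0 t1 h with ⟨h1, h2, h3⟩ | ⟨h1, h2, h3⟩
      · have := T.edge_inj m n m0 m1 n0 n1 (by rw [h1, h2])
        subst this
        left
        rw [hxt, hyu, h3]
      · have := T.edge_inj m n m0 m1 n0 n1 (by rw [h1, h2, Sym2.eq_swap])
        subst this
        exact absurd h1 (T.adj m m0 m1).ne
  · rintro (rfl | ⟨m, n, rfl, rfl, h⟩)
    · rfl
    · rw [tracePath_int, tracePath_int, h]

/-- Each edge lifts to the tour by a translation, preceded by a reflection when the tour runs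
through it backwards. The lift turns closedness on an edge into closedness on I in `isQuotientMap`.
-/
lemma edge_param (T : IsTour G I w) (e : G.edgeSet) :
    ∃ φ : unitInterval → I, Continuous φ ∧ ∀ t, edgePt e t = tracePath G w (φ t) := by
  obtain ⟨n, n0, n1, he⟩ := T.edge_surj _ _ (out_adj e)
  have hmem : ∀ t : unitInterval, (n : ℝ) + t.1 ∈ I := fun t =>
    T.ordConn.out n0 n1 ⟨by linarith [t.2.1], by linarith [t.2.2]⟩
  have hval : ∀ t : unitInterval,
      tracePath G w (n + t.1) = pt G (w n) (w (n + 1)) t := by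
    intro t
    rw [tracePath_eq_pt (T.adj n n0 n1) ⟨by linarith [t.2.1], by linarith [t.2.2]⟩]
    congr 1
    rw [add_sub_cancel_left, Set.projIcc_val]
  rcases Sym2.eq_iff.1 he with ⟨h1, h2⟩ | ⟨h1, h2⟩
  · refine ⟨fun t => ⟨_, hmem t⟩, by fun_prop, fun t => ?_⟩
    rw [edgePt_eq_pt, h1, h2, hval]
  · refine ⟨fun t => ⟨_, hmem (unitInterval.symm t)⟩, by fun_prop, fun t => ?_⟩
    rw [edgePt_eq_pt, h1, h2, hval, pt_symm (T.adj n n0 n1)]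

lemma isQuotientMap (T : IsTour G I w) : IsQuotientMap fun x : I => tracePath G w x := by
  rw [isQuotientMap_iff_isClosed]
  refine ⟨fun x => ?_, fun U => ⟨fun h => h.preimage T.continuous, fun h => ?_⟩⟩
  · rcases cases_pt x with ⟨v, rfl⟩ | ⟨e, t, rfl⟩
    · obtain ⟨n, hn, rfl⟩ := T.vert_surj v
      exact ⟨⟨n, hn⟩, tracePath_int w n⟩
    · obtain ⟨φ, -, h⟩ := T.edge_param e
      exact ⟨φ t, (h t).symm⟩
  · rw [isClosed_iff]
    intro e
    obtain ⟨φ, hφ, hφ'⟩ := T.edge_param e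
    convert h.preimage hφ using 1
    ext t
    simp [hφ' t]

end IsTour

end SimpleGraph

/-- Two quotients of homeomorphic spaces by corresponding relations are homeomorphic. -/
lemma Topology.IsQuotientMap.nonempty_homeomorph {A B X Y : Type*} [TopologicalSpace A]
    [TopologicalSpace B] [TopologicalSpace X] [TopologicalSpace Y] {f : A → X} {g : B → Y}
    (hf : IsQuotientMap f) (hg : IsQuotientMap g) (β : A ≃ₜ B)
    (h : ∀ x y, f x = f y ↔ g (β x) = g (β y)) : Nonempty (X ≃ₜ Y) := by
  let F : C(A, X) := ⟨f, hf.continuous⟩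
  let H : C(A, Y) := ⟨g ∘ β, hg.continuous.comp β.continuous⟩
  have hF : IsQuotientMap F := hf
  have hH : IsQuotientMap H := hg.comp β.isQuotientMap
  have hk : Setoid.ker F = Setoid.ker H := by
    ext x y
    exact h x y
  refine ⟨hF.homeomorph.symm.trans (Homeomorph.trans ?_ hH.homeomorph)⟩
  rw [hk]
  exact Homeomorph.refl _

/-- The elements of a finite set of reals in an interval, listed in increasing order between the
two ends. -/
lemma Finset.exists_increasing_list (a : ℝ) (T : Finset ℝ) :
    ∀ b, a < b → (∀ s ∈ T, a < s ∧ s < b) → ∃ (k : ℕ) (τ : ℕ → ℝ), τ 0 = a ∧ τ (k + 1) = b ∧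
      (∀ i ≤ k, τ i < τ (i + 1)) ∧ ∀ s, s ∈ T ↔ ∃ i, 1 ≤ i ∧ i ≤ k ∧ s = τ i := by
  induction T using Finset.induction_on_max with
  | empty =>
    intro b hab _
    refine ⟨0, fun i => if i = 0 then a else b, by simp, by simp, fun i hi => ?_, fun s => ?_⟩
    · obtain rfl : i = 0 := by omega
      simpa using hab
    · simp only [Finset.notMem_empty, false_iff, not_exists]
      omega
  | insert m T hm ih =>
    intro b hab hT
    obtain ⟨ham, hmb⟩ := hT m (Finset.mem_insert_self _ _)
    obtain ⟨k, τ, h0, h1, h2, h3⟩ := ih m ham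
      fun s hs => ⟨(hT s (Finset.mem_insert_of_mem hs)).1, hm s hs⟩
    refine ⟨k + 1, fun i => if i ≤ k + 1 then τ i else b, by simp [h0], by simp, fun i hi => ?_,
      fun s => ?_⟩
    · by_cases h : i ≤ k
      · simpa [show i ≤ k + 1 by omega, h] using h2 i h
      · obtain rfl : i = k + 1 := by omega
        simpa [h1] using hmb
    · rw [Finset.mem_insert, h3]
      constructor
      · rintro (rfl | ⟨i, hi, hik, rfl⟩)
        · exact ⟨k + 1, by omega, le_rfl, by simp [h1]⟩
        · exact ⟨i, hi, by omega, by simp [show i ≤ k + 1 by omega]⟩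
      · rintro ⟨i, hi, hik, rfl⟩
        by_cases h : i ≤ k
        · exact Or.inr ⟨i, hi, h, by simp [hik]⟩
        · obtain rfl : i = k + 1 := by omega
          simp [h1]

/-! ### From arcs in the one-complex to trails in the graph. -/

namespace SimpleGraph

open Topology OneComplex

variable {V : Type*} {G : SimpleGraph V}

/-- A trail which meets no vertex twice, except that its two ends may be met again. -/
structure IsTrack (G : SimpleGraph V) (N : ℕ) (w : ℕ → V) : Prop where
  adj : ∀ i < N, G.Adj (w i) (w (i + 1))
  inner : ∀ i j, 0 < i → i < j → j < N → w i ≠ w j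
  edge_ne : ∀ i j, i < j → j < N → s(w i, w (i + 1)) ≠ s(w j, w (j + 1))

namespace OneComplex

/-- The middle of an edge. -/
noncomputable def mid (e : G.edgeSet) : G.OneComplex := edgePt e ⟨1 / 2, by norm_num, by norm_num⟩

lemma mid_mem_openEdge (e : G.edgeSet) : mid e ∈ openEdge e :=
  edgePt_mem_openEdge.2 ⟨rfl, by
    change (0 : ℝ) < 1 / 2
    norm_num, by
    change (1 / 2 : ℝ) < 1
    norm_num⟩

lemma mid_ne_vert (e : G.edgeSet) (v : V) : mid e ≠ vert G v := fun h =>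
  vert_notMem_openEdge (h ▸ mid_mem_openEdge e)

lemma mid_injective : Function.Injective (mid (G := G)) := fun e f h =>
  openEdge_eq_of_mem (mid_mem_openEdge e) (h ▸ mid_mem_openEdge f)

lemma eq_of_mid_mem_range {e f : G.edgeSet} (h : mid e ∈ Set.range (edgePt f)) : f = e := by
  obtain ⟨t, ht⟩ := h
  have := mid_mem_openEdge e
  rw [← ht] at this
  exact (edgePt_mem_openEdge.1 this).1

lemma eq_mid_of_coord {e : G.edgeSet} {x : G.OneComplex} {v : V} (hv : v ∈ e.1)
    (hx : x ∈ Set.range (edgePt e)) (h : coord v x = 1 / 2) : x = mid e := by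
  classical
  obtain ⟨t, rfl⟩ := hx
  rw [edgePt_eq_pt, coord_pt _ (out_adj e)] at h
  rw [← out_mk e, Sym2.mem_iff] at hv
  have hne := (out_adj e).ne
  unfold mid
  congr 1
  apply Subtype.ext
  change t.1 = 1 / 2
  rcases hv with rfl | rfl
  · simp only [if_true, if_neg hne.symm] at h
    linarith
  · simp only [if_true, if_neg hne] at h
    linarith

/-- An injective path meets only finitely many vertices. -/
lemma finite_vert_times {h : ℝ → G.OneComplex} (hc : Continuous h) {a b : ℝ}
    (hi : Set.InjOn h (Set.Icc a b)) : {s ∈ Set.Icc a b | h s ∈ Set.range (vert G)}.Finite := by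
  set T := {s ∈ Set.Icc a b | h s ∈ Set.range (vert G)} with hT
  -- Every set of vertices is closed and h is injective, so every set of vertex times is closed. The
  -- vertex times are thus compact and discrete, hence finite.
  have hcl : ∀ S ⊆ T, IsClosed S := by
    intro S hS
    have : S = Set.Icc a b ∩ h ⁻¹' (vert G '' {v | ∃ s ∈ S, h s = vert G v}) := by
      ext s
      constructor
      · intro hs
        obtain ⟨h1, v, h2⟩ := hS hs
        exact ⟨h1, v, ⟨s, hs, h2.symm⟩, h2⟩
      · rintro ⟨h1, v, ⟨s', hs', h2⟩, h3⟩
        rw [hi h1 (hS hs').1 (h3.symm.trans h2.symm)]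
        exact hs'
    rw [this]
    exact isClosed_Icc.inter ((isClosed_vert_image _).preimage hc)
  have hK : IsCompact T := isCompact_Icc.of_isClosed_subset (hcl T subset_rfl) fun s hs => hs.1
  have hd : DiscreteTopology T := by
    rw [discreteTopology_iff_forall_isClosed]
    intro S
    have := (hcl (Subtype.val '' S) (by rintro _ ⟨x, -, rfl⟩; exact x.2)).preimage
      (continuous_subtype_val (p := (· ∈ T)))
    rwa [Set.preimage_image_eq _ Subtype.val_injective] at this
  exact hK.finite (isDiscrete_iff_discreteTopology.2 hd)

/-- An injective path between inner points of different edges runs through a trail. -/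
lemma exists_track_of_path {h : ℝ → G.OneComplex} (hc : Continuous h) {a b : ℝ} (hab : a < b)
    (hi : Set.InjOn h (Set.Icc a b)) {e₀ e₁ : G.edgeSet} (hne : e₀ ≠ e₁) (ha : h a = mid e₀)
    (hb : h b = mid e₁) : ∃ N w, G.IsTrack N w ∧
      ∀ s ∈ Set.Icc a b, ∀ e : G.edgeSet, h s = mid e → ∃ i < N, e.1 = s(w i, w (i + 1)) := by
  classical
  have hfin := finite_vert_times hc hi
  have hTmem : ∀ s, s ∈ hfin.toFinset ↔ s ∈ Set.Icc a b ∧ h s ∈ Set.range (vert G) := by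
    intro s
    simp
  obtain ⟨k, τ, τ0, τ1, τlt, τT⟩ := hfin.toFinset.exists_increasing_list a b hab (by
    intro s hs
    obtain ⟨⟨h1, h2⟩, v, hv⟩ := (hTmem s).1 hs
    refine ⟨lt_of_le_of_ne h1 ?_, lt_of_le_of_ne h2 ?_⟩
    · rintro rfl
      exact mid_ne_vert e₀ v (ha.symm.trans hv.symm)
    · rintro rfl
      exact mid_ne_vert e₁ v (hb.symm.trans hv.symm))
  have τmono : ∀ i j, i < j → j ≤ k + 1 → τ i < τ j := by
    intro i j hij
    induction j, hij using Nat.le_induction with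
    | base => exact fun h => τlt i (by omega)
    | succ j hj ih => exact fun h => (ih (by omega)).trans (τlt j (by omega))
  have τle : ∀ i j, i ≤ j → j ≤ k + 1 → τ i ≤ τ j := by
    intro i j hij hj
    rcases hij.eq_or_lt with rfl | h
    · exact le_rfl
    · exact (τmono i j h hj).le
  have τIcc : ∀ i ≤ k + 1, τ i ∈ Set.Icc a b := fun i hi =>
    ⟨τ0 ▸ τle 0 i (Nat.zero_le _) hi, τ1 ▸ τle i (k + 1) hi le_rfl⟩
  have segIcc : ∀ i ≤ k, Set.Icc (τ i) (τ (i + 1)) ⊆ Set.Icc a b := fun i hi =>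
    Set.Icc_subset_Icc (τIcc i (by omega)).1 (τIcc (i + 1) (by omega)).2
  -- Between consecutive vertex times the path meets no vertex, so it stays in one open edge; taking
  -- closures adds the two end times.
  have hseg : ∀ i, ∃ e : G.edgeSet, i ≤ k →
      h '' Set.Icc (τ i) (τ (i + 1)) ⊆ Set.range (edgePt e) := by
    intro i
    by_cases hik : i ≤ k
    · have hnv : ∀ v, vert G v ∉ h '' Set.Ioo (τ i) (τ (i + 1)) := by
        rintro v ⟨s, hs, hv⟩
        obtain ⟨j, hj1, hjk, rfl⟩ := (τT s).1
          ((hTmem s).2 ⟨segIcc i hik (Set.Ioo_subset_Icc_self hs), v, hv.symm⟩)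
        rcases lt_or_ge i j with hij | hij
        · exact absurd hs.2 (not_lt.2 (τle (i + 1) j hij (by omega)))
        · exact absurd hs.1 (not_lt.2 (τle j i hij (by omega)))
      obtain ⟨m, hm⟩ := Set.nonempty_Ioo.2 (τlt i hik)
      obtain ⟨e, he⟩ := exists_mem_openEdge (x := h m)
        (by rintro ⟨v, hv⟩; exact hnv v ⟨m, hm, hv.symm⟩)
      have hsub := subset_openEdge (isPreconnected_Ioo.image h hc.continuousOn) hnv
        (Set.mem_image_of_mem h hm) he
      refine ⟨e, fun _ => ?_⟩
      rw [← closure_Ioo (τlt i hik).ne]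
      refine (image_closure_subset_closure_image hc).trans
        (closure_minimal (hsub.trans ?_) (isClosed_range_edgePt e))
      rintro _ ⟨t, -, rfl⟩
      exact ⟨t, rfl⟩
    · exact ⟨e₀, fun h => absurd h hik⟩
  choose e he using hseg
  have hver : ∀ i, ∃ v, 1 ≤ i → i ≤ k → h (τ i) = vert G v := by
    intro i
    by_cases hik : 1 ≤ i ∧ i ≤ k
    · obtain ⟨-, v, hv⟩ := (hTmem _).1 ((τT (τ i)).2 ⟨i, hik.1, hik.2, rfl⟩)
      exact ⟨v, fun _ _ => hv.symm⟩
    · exact ⟨(Quot.out e₀.1).1, fun h1 h2 => absurd ⟨h1, h2⟩ hik⟩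
  choose v hv using hver
  have hmid : ∀ i ≤ k, ∀ s ∈ Set.Icc (τ i) (τ (i + 1)), ∀ f, h s = mid f → e i = f :=
    fun i hik s hs f hf => eq_of_mid_mem_range (hf ▸ he i hik ⟨s, hs, rfl⟩)
  have ea : e 0 = e₀ := hmid 0 (Nat.zero_le _) a
    ⟨τ0.le, τ0 ▸ (τlt 0 (Nat.zero_le _)).le⟩ _ ha
  have eb : e k = e₁ := hmid k le_rfl b ⟨τ1 ▸ (τlt k le_rfl).le, τ1.ge⟩ _ hb
  have hk : 1 ≤ k := by
    by_contra hk
    obtain rfl : k = 0 := by omega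
    exact hne (ea.symm.trans eb)
  have hvl : ∀ i, 1 ≤ i → i ≤ k → v i ∈ (e i).1 := fun i h1 h2 =>
    vert_mem_range_edgePt (hv i h1 h2 ▸ he i h2 ⟨τ i, ⟨le_rfl, (τlt i h2).le⟩, rfl⟩)
  have hvr : ∀ i, i < k → v (i + 1) ∈ (e i).1 := fun i h2 =>
    vert_mem_range_edgePt (hv (i + 1) (by omega) h2 ▸
      he i h2.le ⟨τ (i + 1), ⟨(τlt i h2.le).le, le_rfl⟩, rfl⟩)
  have hvne : ∀ i j, 1 ≤ i → i < j → j ≤ k → v i ≠ v j := by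
    intro i j hi1 hij hjk heq
    refine (τmono i j hij (by omega)).ne (hi (τIcc i (by omega)) (τIcc j (by omega)) ?_)
    rw [hv i hi1 (by omega), hv j (by omega) hjk, heq]
  have hein : ∀ i, 1 ≤ i → i < k → (e i).1 = s(v i, v (i + 1)) := fun i h1 h2 =>
    ((Sym2.mem_and_mem_iff (hvne i (i + 1) h1 (by omega) h2)).1 ⟨hvl i h1 h2.le, hvr i h2⟩)
  -- Every piece crosses the midpoint of its edge: on the inner pieces the coordinate at v i falls
  -- from 1 to 0 and takes the value 1/2.
  have hpass : ∀ i ≤ k, ∃ s ∈ Set.Icc (τ i) (τ (i + 1)), h s = mid (e i) := by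
    intro i hik
    rcases Nat.eq_zero_or_pos i with rfl | h1
    · exact ⟨a, ⟨τ0.le, τ0 ▸ (τlt 0 (Nat.zero_le _)).le⟩, ea ▸ ha⟩
    rcases hik.eq_or_lt with rfl | h2
    · exact ⟨b, ⟨τ1 ▸ (τlt i le_rfl).le, τ1.ge⟩, eb ▸ hb⟩
    have hcc : ContinuousOn (fun s => coord (v i) (h s)) (Set.Icc (τ i) (τ (i + 1))) :=
      ((continuous_coord _).comp hc).continuousOn
    have hiv := intermediate_value_Icc' (τlt i hik).le hcc
    obtain ⟨s, hs, hs'⟩ := hiv (show (1 / 2 : ℝ) ∈ _ by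
      simp only [hv i h1 hik, hv (i + 1) (by omega) h2, coord_vert, if_true,
        if_neg (hvne i (i + 1) h1 (by omega) h2).symm]
      norm_num)
    exact ⟨s, hs, eq_mid_of_coord (hvl i h1 hik) (he i hik ⟨s, hs, rfl⟩) hs'⟩
  -- If an edge were used by two pieces, injectivity would make the two passages through its
  -- midpoint simultaneous. That time would then be the common end τ j of the pieces, where the path
  -- is at a vertex.
  have hene : ∀ i j, i < j → j ≤ k → e i ≠ e j := by
    intro i j hij hjk heq
    obtain ⟨s, hs, hs'⟩ := hpass i (by omega)
    obtain ⟨t, ht, ht'⟩ := hpass j hjk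
    have hst : s = t := hi (segIcc i (by omega) hs) (segIcc j hjk ht) (by rw [hs', ht', heq])
    have h1 : τ (i + 1) ≤ τ j := τle _ _ hij (by omega)
    have h2 : s = τ j := le_antisymm (hs.2.trans h1) (hst ▸ ht.1)
    rw [h2, hv j (by omega) hjk] at hs'
    exact mid_ne_vert _ _ hs'.symm
  -- The path starts and stops at midpoints, so the far ends x and y of the extreme edges need not
  -- lie on it. They may coincide with each other or with inner vertices, which is why `IsTrack`
  -- leaves the two ends free.
  obtain ⟨x, hx⟩ : ∃ x, (e 0).1 = s(v 1, x) := hvr 0 hk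
  obtain ⟨y, hy⟩ : ∃ y, (e k).1 = s(v k, y) := hvl k hk le_rfl
  set w : ℕ → V := fun i => if i = 0 then x else if i ≤ k then v i else y with hw
  have hwv : ∀ i, 1 ≤ i → i ≤ k → w i = v i := fun i h1 h2 => by
    simp [hw, show i ≠ 0 by omega, h2]
  have hew : ∀ i ≤ k, (e i).1 = s(w i, w (i + 1)) := by
    intro i hik
    rcases Nat.eq_zero_or_pos i with rfl | h1
    · rw [hwv (0 + 1) (by omega) (by omega), hx, Sym2.eq_swap]
      simp [hw]
    rcases hik.eq_or_lt with rfl | h2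
    · rw [hwv i h1 le_rfl, hy]
      simp [hw]
    · rw [hwv i h1 hik, hwv (i + 1) (by omega) h2, hein i h1 h2]
  refine ⟨k + 1, w, ⟨fun i hik => ?_, fun i j h1 h2 h3 => ?_, fun i j h1 h2 => ?_⟩, ?_⟩
  · have := (e i).2
    rwa [hew i (by omega)] at this
  · rw [hwv i h1 (by omega), hwv j (by omega) (by omega)]
    exact hvne i j h1 h2 (by omega)
  · rw [← hew i (by omega), ← hew j (by omega)]
    exact fun h => hene i j h1 (by omega) (Subtype.ext h)
  · intro s hs f hf
    -- The least such i is the piece that contains the time s.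
    have hex : ∃ i, s ≤ τ (i + 1) := ⟨k, τ1 ▸ hs.2⟩
    have hle : Nat.find hex ≤ k := Nat.find_min' hex (τ1 ▸ hs.2)
    have h2 := Nat.find_spec hex
    refine ⟨Nat.find hex, by omega, ?_⟩
    rw [← hew _ hle, hmid _ hle s ⟨?_, h2⟩ f hf]
    rcases Nat.eq_zero_or_pos (Nat.find hex) with h0 | h0
    · rw [h0, τ0]
      exact hs.1
    · have := Nat.find_min hex (Nat.sub_lt h0 one_pos)
      rw [show Nat.find hex - 1 + 1 = Nat.find hex by omega] at this
      exact (not_le.1 this).le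

/-- Any two to `n` edges of an `n`-ac graph lie on a trail. -/
lemma exists_track_of_isNAC {n : ℕ} (hG : ArcConnected.IsNAC n G.OneComplex)
    (F : Finset (Sym2 V)) (hF : ↑F ⊆ G.edgeSet) (h2 : 2 ≤ F.card) (hn : F.card ≤ n) :
    ∃ N w, G.IsTrack N w ∧ ∀ e ∈ F, ∃ i < N, e = s(w i, w (i + 1)) := by
  classical
  set F' : Finset G.edgeSet := F.attach.image fun e => ⟨e.1, hF e.2⟩ with hF'
  have hmemF : ∀ e : G.edgeSet, e ∈ F' ↔ e.1 ∈ F := by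
    intro e
    constructor
    · intro h
      obtain ⟨f, -, rfl⟩ := Finset.mem_image.1 h
      exact f.2
    · intro h
      exact Finset.mem_image.2 ⟨⟨e.1, h⟩, Finset.mem_attach _ _, rfl⟩
  have hcard : F'.card = F.card := by
    rw [hF', Finset.card_image_of_injective, Finset.card_attach]
    intro x y hxy
    exact Subtype.ext (congrArg (fun e : G.edgeSet => e.1) hxy)
  obtain ⟨A, ⟨φ⟩, hA⟩ := hG (F'.image mid) (by
    rw [Finset.card_image_of_injective _ mid_injective, hcard]
    exact hn)
  set h : ℝ → G.OneComplex := fun x => (φ (Set.projIcc 0 1 zero_le_one x)).1 with hh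
  have hc : Continuous h := continuous_subtype_val.comp (φ.continuous.comp continuous_projIcc)
  have hi : Set.InjOn h (Set.Icc 0 1) := by
    intro x hx y hy hxy
    have := φ.injective (Subtype.ext hxy)
    rw [Set.projIcc_of_mem _ hx, Set.projIcc_of_mem _ hy] at this
    exact congrArg Subtype.val this
  have hσ : ∀ e : G.edgeSet, ∃ s, e ∈ F' → s ∈ Set.Icc (0 : ℝ) 1 ∧ h s = mid e := by
    intro e
    by_cases he : e ∈ F'
    · have : mid e ∈ A := hA (Finset.mem_coe.2 (Finset.mem_image_of_mem _ he))
      refine ⟨(φ.symm ⟨mid e, this⟩).1, fun _ => ⟨(φ.symm ⟨mid e, this⟩).2, ?_⟩⟩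
      rw [hh]
      simp
    · exact ⟨0, fun h => absurd h he⟩
  choose σ hσ using hσ
  have hne : F'.Nonempty := Finset.card_pos.1 (by omega)
  -- Cutting the arc at the earliest and the latest chosen midpoint makes the path end inside two
  -- edges, which differ because F has at least two elements.
  obtain ⟨e₀, he₀, hmin⟩ := F'.exists_min_image σ hne
  obtain ⟨e₁, he₁, hmax⟩ := F'.exists_max_image σ hne
  have hσinj : ∀ e ∈ F', ∀ f ∈ F', σ e = σ f → e = f := by
    intro e he f hf hef
    exact mid_injective (by rw [← (hσ e he).2, ← (hσ f hf).2, hef])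
  have hne01 : e₀ ≠ e₁ := by
    rintro rfl
    have : F' ⊆ {e₀} := by
      intro e he
      rw [Finset.mem_singleton]
      exact hσinj e he e₀ he₀ (le_antisymm (hmax e he) (hmin e he))
    have := Finset.card_le_card this
    rw [Finset.card_singleton] at this
    omega
  have hlt : σ e₀ < σ e₁ := lt_of_le_of_ne (hmin e₁ he₁)
    fun h => hne01 (hσinj _ he₀ _ he₁ h)
  have hsub : Set.Icc (σ e₀) (σ e₁) ⊆ Set.Icc 0 1 :=
    Set.Icc_subset_Icc (hσ e₀ he₀).1.1 (hσ e₁ he₁).1.2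
  obtain ⟨N, w, hw, hcov⟩ := exists_track_of_path hc hlt (hi.mono hsub) hne01 (hσ e₀ he₀).2
    (hσ e₁ he₁).2
  refine ⟨N, w, hw, fun e he => ?_⟩
  have he' : (⟨e, hF he⟩ : G.edgeSet) ∈ F' := (hmemF _).2 he
  exact hcov (σ ⟨e, hF he⟩) ⟨hmin _ he', hmax _ he'⟩ ⟨e, hF he⟩ (hσ _ he').2

lemma preconnectedSpace_of_isNAC {X : Type*} [TopologicalSpace X]
    (h : ArcConnected.IsNAC 2 X) : PreconnectedSpace X := by
  classical
  refine ⟨isPreconnected_of_forall_pair fun x _ y _ => ?_⟩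
  obtain ⟨A, ⟨φ⟩, hA⟩ := h {x, y} Finset.card_le_two
  refine ⟨A, Set.subset_univ _, hA (by simp), hA (by simp), ?_⟩
  have : A = Set.range fun t => (φ t).1 := by
    ext a
    constructor
    · intro ha
      exact ⟨φ.symm ⟨a, ha⟩, by simp⟩
    · rintro ⟨t, rfl⟩
      exact (φ t).2
  rw [this]
  exact isPreconnected_range (continuous_subtype_val.comp φ.continuous)

/-- The indicator function of a component is constant along each edge. Its affine extension is
therefore continuous with values 0 and 1 only, and on a connected space it cannot take both. -/
lemma preconnected_of_preconnectedSpace [PreconnectedSpace G.OneComplex] : G.Preconnected := by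
  classical
  intro u v
  set f : V → ℝ := fun x => if G.Reachable u x then 1 else 0 with hf
  have hval : ∀ x, affine G f x = 0 ∨ affine G f x = 1 := by
    intro x
    rcases cases_pt x with ⟨v, rfl⟩ | ⟨e, t, rfl⟩
    · rw [affine_vert, hf]
      by_cases h : G.Reachable u v <;> simp [h]
    · have : f (Quot.out e.1).2 = f (Quot.out e.1).1 := by
        have hr := (out_adj e).reachable
        have : G.Reachable u (Quot.out e.1).2 ↔ G.Reachable u (Quot.out e.1).1 :=
          ⟨fun h => h.trans hr.symm, fun h => h.trans hr⟩
        simp [hf, this]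
      rw [affine_edgePt, this]
      by_cases h : G.Reachable u (Quot.out e.1).1 <;> simp [hf, h]
  by_contra hr
  have hu : affine G f (vert G u) = 1 := by simp [hf]
  have hv : affine G f (vert G v) = 0 := by simp [hf, hr]
  obtain ⟨x, hx⟩ := mem_range_of_exists_le_of_exists_ge (continuous_affine (G := G) f)
    (c := 1 / 2) ⟨vert G v, by rw [hv]; norm_num⟩ ⟨vert G u, by rw [hu]; norm_num⟩
  rcases hval x with h | h <;> rw [h] at hx <;> norm_num at hx

lemma exists_adj [PreconnectedSpace G.OneComplex] [Nontrivial G.OneComplex] :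
    ∃ a b, G.Adj a b := by
  by_contra! h
  obtain ⟨x, y, hxy⟩ := exists_pair_ne G.OneComplex
  have hvert : ∀ x : G.OneComplex, ∃ v, x = vert G v := by
    intro x
    rcases cases_pt x with h1 | ⟨e, -⟩
    · exact h1
    · exact absurd (out_adj e) (h _ _)
  obtain ⟨u, rfl⟩ := hvert x
  obtain ⟨v, rfl⟩ := hvert y
  obtain ⟨p⟩ := preconnected_of_preconnectedSpace (G := G) u v
  cases p with
  | nil => exact hxy rfl
  | cons hadj _ => exact h _ _ hadj

end OneComplex

end SimpleGraph

/-! ### Counting the edges of a track at a vertex. -/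

namespace SimpleGraph

variable {V : Type*} {G : SimpleGraph V}

/-- Any two to `n` edges lie on a common track. -/
def HasTracks (G : SimpleGraph V) (n : ℕ) : Prop :=
  ∀ F : Finset (Sym2 V), ↑F ⊆ G.edgeSet → 2 ≤ F.card → F.card ≤ n →
    ∃ N w, G.IsTrack N w ∧ ∀ e ∈ F, ∃ i < N, e = s(w i, w (i + 1))

/-- The edge `ab` is a step of the sequence `w`. -/
def OnTrack (N : ℕ) (w : ℕ → V) (a b : V) : Prop := ∃ i < N, s(a, b) = s(w i, w (i + 1))

/-- A vertex of degree at least three. -/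
def IsBranch (G : SimpleGraph V) (v : V) : Prop :=
  ∃ S : Finset V, (∀ x ∈ S, G.Adj v x) ∧ S.card = 3

lemma OnTrack.symm {N : ℕ} {w : ℕ → V} {a b : V} (h : OnTrack N w a b) : OnTrack N w b a := by
  obtain ⟨i, hi, he⟩ := h
  exact ⟨i, hi, by rw [Sym2.eq_swap, he]⟩

lemma eq_or_eq_of_not_isBranch {v a b x : V} (h : ¬ G.IsBranch v) (ha : G.Adj v a)
    (hb : G.Adj v b) (hx : G.Adj v x) (hab : a ≠ b) : x = a ∨ x = b := by
  classical
  by_contra! hne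
  refine h ⟨{a, b, x}, ?_, Finset.card_eq_three.2 ⟨a, b, x, hab, hne.1.symm, hne.2.symm, rfl⟩⟩
  simp [ha, hb, hx]

namespace IsTrack

variable {N : ℕ} {w : ℕ → V}

lemma inner_inj (hw : G.IsTrack N w) {i j : ℕ} (hi : 0 < i) (hiN : i < N) (hj : 0 < j)
    (hjN : j < N) (h : w i = w j) : i = j := by
  rcases lt_trichotomy i j with hlt | heq | hlt
  · exact absurd h (hw.inner i j hi hlt hjN)
  · exact heq
  · exact absurd h.symm (hw.inner j i hj hlt hiN)

/-- An edge at v determines its other end, so choosing a step for each neighbour injects S into T.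
The degree bounds below follow by listing the steps that can touch v. -/
lemma card_le (_hw : G.IsTrack N w) {v : V} {S : Finset V} (hS : ∀ x ∈ S, OnTrack N w v x)
    {T : Finset ℕ} (hT : ∀ i < N, w i = v ∨ w (i + 1) = v → i ∈ T) : S.card ≤ T.card := by
  have : ∀ x, ∃ i, x ∈ S → i < N ∧ s(v, x) = s(w i, w (i + 1)) := by
    intro x
    by_cases hx : x ∈ S
    · obtain ⟨i, hi⟩ := hS x hx
      exact ⟨i, fun _ => hi⟩
    · exact ⟨0, fun h => absurd h hx⟩
  choose f hf using this
  refine Finset.card_le_card_of_injOn f (fun x hx => ?_) (fun x hx y hy hxy => ?_)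
  · obtain ⟨h1, h2⟩ := hf x hx
    refine hT _ h1 ?_
    have : v ∈ s(w (f x), w (f x + 1)) := h2 ▸ Sym2.mem_mk_left v x
    rcases Sym2.mem_iff.1 this with h | h
    · exact Or.inl h.symm
    · exact Or.inr h.symm
  · have h1 := (hf x hx).2
    rw [show f x = f y from hxy, ← (hf y hy).2] at h1
    exact Sym2.congr_right.1 h1

/-- A vertex met only at the ends touches only the steps 0 and N - 1. A vertex met only inside is
met at a single index m and touches only the steps m - 1 and m. Three edges need both kinds of
visit. -/
lemma three_le (hw : G.IsTrack N w) {v : V} {S : Finset V} (hS : ∀ x ∈ S, OnTrack N w v x)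
    (h3 : 3 ≤ S.card) : (∃ m, 0 < m ∧ m < N ∧ w m = v) ∧ (w 0 = v ∨ w N = v) := by
  have hin : ∃ m, 0 < m ∧ m < N ∧ w m = v := by
    by_contra! hno
    have := hw.card_le hS (T := {0, N - 1}) (by
      rintro i hi (h | h)
      · rcases Nat.eq_zero_or_pos i with rfl | h0
        · simp
        · exact absurd h (hno i h0 hi)
      · rcases eq_or_lt_of_le (show i + 1 ≤ N from hi) with h1 | h1
        · simp [← h1]
        · exact absurd h (hno (i + 1) (by omega) h1))
    have h2 : ({0, N - 1} : Finset ℕ).card ≤ 2 := Finset.card_le_two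
    omega
  refine ⟨hin, ?_⟩
  obtain ⟨m, hm0, hmN, rfl⟩ := hin
  by_contra! hno
  have := hw.card_le hS (T := {m - 1, m}) (by
    rintro i hi (h | h)
    · have : 0 < i := Nat.pos_of_ne_zero (by rintro rfl; exact hno.1 h)
      simp [hw.inner_inj this hi hm0 hmN h]
    · have : i + 1 < N := lt_of_le_of_ne hi (by rintro rfl; exact hno.2 h)
      simp [← hw.inner_inj (Nat.succ_pos i) this hm0 hmN h])
  have h2 : ({m - 1, m} : Finset ℕ).card ≤ 2 := Finset.card_le_two
  omega

/-- The single inner visit accounts for two edges and each end for at most one more, so four edges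
use up everything. -/
lemma four_le (hw : G.IsTrack N w) {v : V} {S : Finset V} (hS : ∀ x ∈ S, OnTrack N w v x)
    (h4 : 4 ≤ S.card) : (∃ m, 0 < m ∧ m < N ∧ w m = v) ∧ w 0 = v ∧ w N = v := by
  have hin := (hw.three_le hS (by omega)).1
  refine ⟨hin, ?_⟩
  obtain ⟨m, hm0, hmN, rfl⟩ := hin
  constructor
  · by_contra hno
    have := hw.card_le hS (T := {m - 1, m, N - 1}) (by
      rintro i hi (h | h)
      · have : 0 < i := Nat.pos_of_ne_zero (by rintro rfl; exact hno h)
        simp [hw.inner_inj this hi hm0 hmN h]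
      · rcases eq_or_lt_of_le (show i + 1 ≤ N from hi) with h1 | h1
        · simp [← h1]
        · simp [← hw.inner_inj (Nat.succ_pos i) h1 hm0 hmN h])
    have h2 : ({m - 1, m, N - 1} : Finset ℕ).card ≤ 3 := Finset.card_le_three
    omega
  · by_contra hno
    have := hw.card_le hS (T := {m - 1, m, 0}) (by
      rintro i hi (h | h)
      · rcases Nat.eq_zero_or_pos i with rfl | h0
        · simp
        · simp [hw.inner_inj h0 hi hm0 hmN h]
      · have : i + 1 < N := lt_of_le_of_ne hi (by rintro rfl; exact hno h)
        simp [← hw.inner_inj (Nat.succ_pos i) this hm0 hmN h])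
    have h2 : ({m - 1, m, 0} : Finset ℕ).card ≤ 3 := Finset.card_le_three
    omega

lemma card_le_four (hw : G.IsTrack N w) {v : V} {S : Finset V}
    (hS : ∀ x ∈ S, OnTrack N w v x) : S.card ≤ 4 := by
  by_contra! h
  obtain ⟨m, hm0, hmN, rfl⟩ := (hw.four_le hS (by omega)).1
  have := hw.card_le hS (T := {m - 1, m, 0, N - 1}) (by
    rintro i hi (h | h)
    · rcases Nat.eq_zero_or_pos i with rfl | h0
      · simp
      · simp [hw.inner_inj h0 hi hm0 hmN h]
    · rcases eq_or_lt_of_le (show i + 1 ≤ N from hi) with h1 | h1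
      · simp [← h1]
      · simp [← hw.inner_inj (Nat.succ_pos i) h1 hm0 hmN h])
  have h2 : ({m - 1, m, 0, N - 1} : Finset ℕ).card ≤ 4 := Finset.card_le_four
  omega

lemma onTrack_left {i : ℕ} (h0 : 0 < i) (hi : i < N) : OnTrack N w (w i) (w (i - 1)) :=
  ⟨i - 1, by omega, by rw [Sym2.eq_swap, Nat.sub_add_cancel h0]⟩

lemma onTrack_right {i : ℕ} (hi : i < N) : OnTrack N w (w i) (w (i + 1)) := ⟨i, hi, rfl⟩

lemma adj_of_onTrack (hw : G.IsTrack N w) {a b : V} (h : OnTrack N w a b) : G.Adj a b := by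
  obtain ⟨i, hi, he⟩ := h
  have := hw.adj i hi
  rw [← mem_edgeSet, ← he] at this
  exact this

lemma left_ne_right (hw : G.IsTrack N w) {i : ℕ} (h0 : 0 < i) (hi : i < N) :
    w (i - 1) ≠ w (i + 1) := by
  intro h
  refine hw.edge_ne (i - 1) i (by omega) hi ?_
  rw [Nat.sub_add_cancel h0, h, Sym2.eq_swap]

/-- An inner vertex already has two distinct neighbours along the track. Hence only a branch vertex
can have an edge off the track, and this is how tracks are shown to cover the whole graph. -/
lemma isBranch_of_not_onTrack (hw : G.IsTrack N w) {i : ℕ} (h0 : 0 < i) (hi : i < N) {x : V}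
    (hx : G.Adj (w i) x) (hn : ¬ OnTrack N w (w i) x) : G.IsBranch (w i) := by
  by_contra hb
  rcases eq_or_eq_of_not_isBranch hb (hw.adj_of_onTrack (onTrack_left h0 hi))
    (hw.adj_of_onTrack (onTrack_right hi)) hx (hw.left_ne_right h0 hi) with rfl | rfl
  · exact hn (onTrack_left h0 hi)
  · exact hn (onTrack_right hi)

lemma exists_index {v x : V} (h : OnTrack N w v x) (h0 : v ≠ w 0) (hN : v ≠ w N) :
    ∃ i, 0 < i ∧ i < N ∧ w i = v := by
  obtain ⟨i, hi, he⟩ := h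
  have : v ∈ s(w i, w (i + 1)) := he ▸ Sym2.mem_mk_left v x
  rcases Sym2.mem_iff.1 this with rfl | rfl
  · exact ⟨i, Nat.pos_of_ne_zero (by rintro rfl; exact h0 rfl), hi, rfl⟩
  · exact ⟨i + 1, by omega, lt_of_le_of_ne hi (by rintro rfl; exact hN rfl), rfl⟩

lemma reverse (hw : G.IsTrack N w) : G.IsTrack N fun i => w (N - i) := by
  have he : ∀ i < N, s(w (N - i), w (N - (i + 1))) =
      s(w (N - (i + 1)), w (N - (i + 1) + 1)) := by
    intro i hi
    rw [Sym2.eq_swap, show N - (i + 1) + 1 = N - i by omega]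
  refine ⟨fun i hi => ?_, fun i j h0 hij hj => ?_, fun i j hij hj => ?_⟩
  · have := hw.adj (N - (i + 1)) (by omega)
    rw [show N - (i + 1) + 1 = N - i by omega] at this
    exact this.symm
  · exact (hw.inner (N - j) (N - i) (by omega) (by omega) (by omega)).symm
  · rw [he i (by omega), he j hj]
    exact (hw.edge_ne _ _ (by omega) (by omega)).symm

end IsTrack

lemma OnTrack.reverse {N : ℕ} {w : ℕ → V} {a b : V} (h : OnTrack N w a b) :
    OnTrack N (fun i => w (N - i)) a b := by
  obtain ⟨i, hi, he⟩ := h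
  refine ⟨N - (i + 1), by omega, ?_⟩
  change _ = s(w (N - (N - (i + 1))), w (N - (N - (i + 1) + 1)))
  rw [he, Sym2.eq_swap, show N - (N - (i + 1)) = i + 1 by omega,
    show N - (N - (i + 1) + 1) = i by omega]

/-! ### Glued tours -/

/-- A tour of `G` over `I` which visits a vertex at times `m < n` if and only if `P m n`. -/
def GluedTour (G : SimpleGraph V) (I : Set ℝ) (P : ℝ → ℝ → Prop) : Prop :=
  ∃ w : ℤ → V, G.IsTour I w ∧
    ∀ m n : ℤ, (m : ℝ) ∈ I → (n : ℝ) ∈ I → m < n → (w m = w n ↔ P m n)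

/-- The visited vertices are closed under adjacency, so by connectedness they are all the vertices;
every edge then starts at a visited vertex. -/
lemma IsTour.of_closed {I : Set ℝ} {w : ℤ → V} (hG : G.Preconnected)
    (hf : ∀ x ∈ I, (⌊x⌋ : ℝ) ∈ I) (hc : ∀ x ∈ I, (⌈x⌉ : ℝ) ∈ I) (ho : I.OrdConnected)
    (h0 : (0 : ℝ) ∈ I)
    (adj : ∀ n : ℤ, (n : ℝ) ∈ I → (n : ℝ) + 1 ∈ I → G.Adj (w n) (w (n + 1)))
    (inj : ∀ m n : ℤ, (m : ℝ) ∈ I → (m : ℝ) + 1 ∈ I → (n : ℝ) ∈ I → (n : ℝ) + 1 ∈ I →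
      s(w m, w (m + 1)) = s(w n, w (n + 1)) → m = n)
    (closed : ∀ n : ℤ, (n : ℝ) ∈ I → ∀ x, G.Adj (w n) x →
      ∃ m : ℤ, (m : ℝ) ∈ I ∧ (m : ℝ) + 1 ∈ I ∧ s(w n, x) = s(w m, w (m + 1))) :
    G.IsTour I w := by
  have hv : ∀ v, ∃ n : ℤ, (n : ℝ) ∈ I ∧ w n = v := by
    intro v
    obtain ⟨p⟩ := hG v (w 0)
    generalize hb : w 0 = b at p
    induction p with
    | nil => exact ⟨0, by simpa using h0, hb⟩
    | cons hadj p ih =>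
      obtain ⟨n, hn, rfl⟩ := ih hb
      obtain ⟨m, hm, hm1, he⟩ := closed n hn _ hadj.symm
      have hmem : ∀ y, y ∈ s(w m, w (m + 1)) → ∃ n : ℤ, (n : ℝ) ∈ I ∧ w n = y := by
        intro y hy
        rcases Sym2.mem_iff.1 hy with rfl | rfl
        · exact ⟨m, hm, rfl⟩
        · exact ⟨m + 1, by push_cast; exact hm1, rfl⟩
      exact hmem _ (he ▸ Sym2.mem_mk_right _ _)
  refine ⟨hf, hc, ho, adj, fun a b hab => ?_, inj, hv⟩
  obtain ⟨n, hn, rfl⟩ := hv a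
  exact closed n hn b hab

lemma gluedTour_of_seq {I : Set ℝ} (hI : I = Set.Ici 0 ∨ ∃ N : ℕ, I = Set.Icc (0 : ℝ) N)
    (hG : G.Preconnected) {w : ℕ → V}
    (adj : ∀ n : ℕ, ((n + 1 : ℕ) : ℝ) ∈ I → G.Adj (w n) (w (n + 1)))
    (inj : ∀ m n : ℕ, m < n → ((n + 1 : ℕ) : ℝ) ∈ I → s(w m, w (m + 1)) ≠ s(w n, w (n + 1)))
    (closed : ∀ n : ℕ, (n : ℝ) ∈ I → ∀ x, G.Adj (w n) x →
      ∃ m : ℕ, ((m + 1 : ℕ) : ℝ) ∈ I ∧ s(w n, x) = s(w m, w (m + 1)))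
    {P : ℝ → ℝ → Prop} (hP : ∀ m n : ℕ, m < n → (n : ℝ) ∈ I → (w m = w n ↔ P m n)) :
    G.GluedTour I P := by
  have hnonneg : ∀ x ∈ I, 0 ≤ x := by
    rcases hI with rfl | ⟨N, rfl⟩
    · exact fun x hx => hx
    · exact fun x hx => hx.1
  have hdown : ∀ x ∈ I, ∀ y, 0 ≤ y → y ≤ x → y ∈ I := by
    rcases hI with rfl | ⟨N, rfl⟩
    · exact fun x hx y hy _ => hy
    · exact fun x hx y hy h => ⟨hy, h.trans hx.2⟩
  have h0 : (0 : ℝ) ∈ I := by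
    rcases hI with rfl | ⟨N, rfl⟩ <;> simp
  have hc : ∀ x ∈ I, (⌈x⌉ : ℝ) ∈ I := by
    rcases hI with rfl | ⟨N, rfl⟩
    · intro x hx
      exact le_trans hx (Int.le_ceil x)
    · intro x hx
      refine ⟨le_trans hx.1 (Int.le_ceil x), ?_⟩
      have : ⌈x⌉ ≤ (N : ℤ) := Int.ceil_le.2 (by exact_mod_cast hx.2)
      exact_mod_cast this
  have hnat : ∀ n : ℤ, (n : ℝ) ∈ I → ∃ k : ℕ, n = k := fun n hn =>
    Int.eq_ofNat_of_zero_le (by exact_mod_cast hnonneg _ hn)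
  have hmem1 : ∀ k : ℕ, (((k : ℤ) : ℝ) + 1 ∈ I ↔ ((k + 1 : ℕ) : ℝ) ∈ I) := by
    intro k
    push_cast
    rfl
  have hsucc : ∀ k : ℕ, ((k : ℤ) + 1).toNat = k + 1 := fun k => by omega
  -- Negative integers are sent to w 0, which is harmless because I contains no negative number.
  refine ⟨fun n => w n.toNat, IsTour.of_closed hG (fun x hx => hdown x hx _ ?_ (Int.floor_le x)) hc
    ⟨fun x hx y hy z hz => hdown y hy z ((hnonneg x hx).trans hz.1) hz.2⟩ h0 ?_ ?_ ?_, ?_⟩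
  · exact_mod_cast Int.floor_nonneg.2 (hnonneg x hx)
  · intro n hn hn1
    obtain ⟨k, rfl⟩ := hnat n hn
    rw [hmem1] at hn1
    simpa [hsucc] using adj k hn1
  · intro m n hm hm1 hn hn1 h
    obtain ⟨k, rfl⟩ := hnat m hm
    obtain ⟨l, rfl⟩ := hnat n hn
    rw [hmem1] at hm1 hn1
    simp only [hsucc, Int.toNat_natCast] at h
    rcases lt_trichotomy k l with hlt | rfl | hlt
    · exact absurd h (inj k l hlt hn1)
    · rfl
    · exact absurd h.symm (inj l k hlt hm1)
  · intro n hn x hx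
    obtain ⟨k, rfl⟩ := hnat n hn
    obtain ⟨m, hm, he⟩ := closed k hn x (by simpa using hx)
    refine ⟨m, hdown _ hm _ (by positivity) (by push_cast; linarith), (hmem1 m).2 hm, ?_⟩
    simpa [hsucc] using he
  · intro m n hm hn hmn
    obtain ⟨k, rfl⟩ := hnat m hm
    obtain ⟨l, rfl⟩ := hnat n hn
    simpa using hP k l (by exact_mod_cast hmn) (by exact_mod_cast hn)

lemma natCast_mem_Icc {n N : ℕ} : (n : ℝ) ∈ Set.Icc (0 : ℝ) N ↔ n ≤ N := by
  simp

lemma IsTrack.gluedTour {N : ℕ} {w : ℕ → V} (hw : G.IsTrack N w) (hG : G.Preconnected)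
    (closed : ∀ n ≤ N, ∀ x, G.Adj (w n) x → OnTrack N w (w n) x)
    {P : ℝ → ℝ → Prop} (hP : ∀ m n : ℕ, m < n → n ≤ N → (w m = w n ↔ P m n)) :
    G.GluedTour (Set.Icc 0 N) P := by
  refine gluedTour_of_seq (Or.inr ⟨N, rfl⟩) hG (fun n hn => ?_) (fun m n hmn hn => ?_)
    (fun n hn x hx => ?_) (fun m n hmn hn => ?_) (w := w)
  · rw [natCast_mem_Icc] at hn
    exact hw.adj n hn
  · rw [natCast_mem_Icc] at hn
    exact hw.edge_ne m n hmn hn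
  · rw [natCast_mem_Icc] at hn
    obtain ⟨i, hi, he⟩ := closed n hn x hx
    exact ⟨i, natCast_mem_Icc.2 hi, he⟩
  · rw [natCast_mem_Icc] at hn
    exact hP m n hmn hn

/-! ### Graphs with branch vertices -/

open Classical in
/-- The edges from `v` to the elements of `S`. -/
noncomputable def starEdges (v : V) (S : Finset V) : Finset (Sym2 V) := S.image fun x => s(v, x)

lemma mem_starEdges {v x : V} {S : Finset V} (h : x ∈ S) : s(v, x) ∈ starEdges v S := by
  classical
  exact Finset.mem_image_of_mem _ h

lemma card_starEdges (v : V) (S : Finset V) : (starEdges v S).card = S.card := by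
  classical
  exact Finset.card_image_of_injective _ fun x y h => Sym2.congr_right.1 h

lemma starEdges_subset {v : V} {S : Finset V} (h : ∀ x ∈ S, G.Adj v x) :
    ↑(starEdges v S) ⊆ G.edgeSet := by
  classical
  intro e he
  obtain ⟨x, hx, rfl⟩ := Finset.mem_image.1 (Finset.mem_coe.1 he)
  exact h x hx

lemma HasTracks.card_le_four (H : G.HasTracks 7) {v : V} {S : Finset V}
    (hS : ∀ x ∈ S, G.Adj v x) : S.card ≤ 4 := by
  by_contra! h
  obtain ⟨S', hS', hc⟩ := Finset.exists_subset_card_eq (show 5 ≤ S.card from h)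
  obtain ⟨N, w, hw, hcov⟩ := H (starEdges v S')
    (starEdges_subset fun x hx => hS x (hS' hx)) (by rw [card_starEdges]; omega)
    (by rw [card_starEdges]; omega)
  have := hw.card_le_four (v := v) (S := S') fun x hx => hcov _ (mem_starEdges hx)
  omega

/-- A track through two stars and possibly one more edge. -/
lemma HasTracks.two_stars (H : G.HasTracks 7) {u v a b : V} {S T : Finset V}
    (hS : ∀ x ∈ S, G.Adj u x) (hT : ∀ x ∈ T, G.Adj v x) (hab : G.Adj a b)
    (h2 : 2 ≤ S.card) (h7 : S.card + T.card ≤ 6 ∨ (S.card + T.card ≤ 7 ∧ a = v ∧ b ∈ T)) :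
    ∃ N w, G.IsTrack N w ∧ (∀ x ∈ S, OnTrack N w u x) ∧ (∀ x ∈ T, OnTrack N w v x) ∧
      OnTrack N w a b := by
  classical
  have key : ∃ N w, G.IsTrack N w ∧ ∀ e ∈ insert s(a, b) (starEdges u S ∪ starEdges v T),
      ∃ i < N, e = s(w i, w (i + 1)) := by
    refine H _ ?_ ?_ ?_
    · rw [Finset.coe_insert, Finset.coe_union]
      exact Set.insert_subset hab (Set.union_subset (starEdges_subset hS) (starEdges_subset hT))
    · refine le_trans ?_ (Finset.card_le_card
        (Finset.subset_union_left.trans (Finset.subset_insert _ _)))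
      rwa [card_starEdges]
    · have h1 := Finset.card_union_le (starEdges u S) (starEdges v T)
      rw [card_starEdges, card_starEdges] at h1
      -- The extra edge counts as a seventh one, unless it already belongs to the second star.
      rcases h7 with h7 | ⟨h7, rfl, hb⟩
      · have h3 := Finset.card_insert_le s(a, b) (starEdges u S ∪ starEdges v T)
        omega
      · rw [Finset.insert_eq_of_mem (Finset.mem_union_right _ (mem_starEdges hb))]
        omega
  obtain ⟨N, w, hw, hcov⟩ := key
  refine ⟨N, w, hw, fun x hx => hcov _ ?_, fun x hx => hcov _ ?_, hcov _ ?_⟩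
  · exact Finset.mem_insert_of_mem (Finset.mem_union_left _ (mem_starEdges hx))
  · exact Finset.mem_insert_of_mem (Finset.mem_union_right _ (mem_starEdges hx))
  · exact Finset.mem_insert_self _ _

/-- If all edges of a full star lie on a track, then so does any edge at its centre. -/
lemma onTrack_of_star {N : ℕ} {w : ℕ → V} {v x : V} {S : Finset V} {k : ℕ}
    (hmax : ∀ S : Finset V, (∀ x ∈ S, G.Adj v x) → S.card ≤ k) (hS : ∀ x ∈ S, G.Adj v x)
    (hk : S.card = k) (hon : ∀ x ∈ S, OnTrack N w v x) (hx : G.Adj v x) : OnTrack N w v x := by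
  classical
  by_cases h : x ∈ S
  · exact hon x h
  · have := hmax (insert x S) (by
      intro y hy
      rcases Finset.mem_insert.1 hy with rfl | hy
      · exact hx
      · exact hS y hy)
    rw [Finset.card_insert_of_notMem h] at this
    omega

/-- A track through the four edges at v starts at v, ends at v and passes v once in between. If it
missed an edge at another of its vertices, that vertex would be a branch vertex. A track through its
three edges and the four at v, seven in all, would then have both ends at v and also an end at the
other vertex. Hence the track covers everything. -/
lemma exists_figureEight (H : G.HasTracks 7) (hG : G.Preconnected) {v : V} {S : Finset V}
    (hS : ∀ x ∈ S, G.Adj v x) (h4 : S.card = 4) : ∃ i N : ℕ, 0 < i ∧ i < N ∧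
      G.GluedTour (Set.Icc 0 N)
        fun x y => (x = 0 ∧ y = i) ∨ (x = 0 ∧ y = N) ∨ (x = i ∧ y = N) := by
  obtain ⟨a, ha⟩ := Finset.card_pos.1 (show 0 < S.card by omega)
  obtain ⟨N, w, hw, hon, -, -⟩ := H.two_stars (T := ∅) (v := v) hS (by simp) (hS a ha) (by omega)
    (Or.inl (by simp [h4]))
  obtain ⟨⟨m, hm0, hmN, hm⟩, hw0, hwN⟩ := hw.four_le hon h4.ge
  refine ⟨m, N, hm0, hmN, hw.gluedTour hG (fun n hn x hx => ?_) (fun k n hkn hn => ?_)⟩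
  · by_cases hnv : w n = v
    · rw [hnv] at hx ⊢
      exact onTrack_of_star (fun _ => H.card_le_four) hS h4 hon hx
    · have hn0 : 0 < n := Nat.pos_of_ne_zero (by rintro rfl; exact hnv hw0)
      have hnN : n < N := lt_of_le_of_ne hn (by rintro rfl; exact hnv hwN)
      by_contra hoff
      obtain ⟨T, hT, hT3⟩ := hw.isBranch_of_not_onTrack hn0 hnN hx hoff
      obtain ⟨b, hb⟩ := Finset.card_pos.1 (show 0 < T.card by omega)
      obtain ⟨N', w', hw', hon', hon2', -⟩ := H.two_stars hS hT (hT b hb) (by omega)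
        (Or.inr ⟨by omega, rfl, hb⟩)
      obtain ⟨-, h1, h2⟩ := hw'.four_le hon' h4.ge
      rcases (hw'.three_le hon2' hT3.ge).2 with h | h
      · exact hnv (h.symm.trans h1)
      · exact hnv (h.symm.trans h2)
  · have hinner : ∀ j, 0 < j → j < N → (w j = v ↔ j = m) := fun j h0 hN =>
      ⟨fun h => hw.inner_inj h0 hN hm0 hmN (h.trans hm.symm), fun h => h ▸ hm⟩
    have hcast : ((k : ℝ) = 0 ∧ (n : ℝ) = m ∨ (k : ℝ) = 0 ∧ (n : ℝ) = N ∨ (k : ℝ) = m ∧ (n : ℝ) = N)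
        ↔ (k = 0 ∧ n = m ∨ k = 0 ∧ n = N ∨ k = m ∧ n = N) := by
      norm_cast
    rw [hcast]
    rcases Nat.eq_zero_or_pos k with rfl | hk0
    · rw [hw0]
      rcases hn.eq_or_lt with rfl | hnN
      · simp [hwN]
      · rw [eq_comm, hinner n hkn hnN]
        omega
    · rcases hn.eq_or_lt with rfl | hnN
      · rw [hwN, hinner k hk0 hkn]
        omega
      · refine iff_of_false (hw.inner k n hk0 hkn hnN) ?_
        omega

/-- A track through the six edges at u and v has one end at each of them and meets each once more
inside. Its other vertices are not branch vertices, so it covers everything. The order of the two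
inner visits, left open here, decides between dumbbell and theta-curve. -/
lemma exists_theta_or_dumbbell (H : G.HasTracks 7) (hG : G.Preconnected)
    (h3 : ∀ v, ∀ S : Finset V, (∀ x ∈ S, G.Adj v x) → S.card ≤ 3) {u v : V} (huv : u ≠ v)
    (hu : G.IsBranch u) (hv : G.IsBranch v) (hno : ∀ x, G.IsBranch x → x = u ∨ x = v) :
    ∃ i j N : ℕ, 0 < i ∧ i < N ∧ 0 < j ∧ j < N ∧ i ≠ j ∧
      G.GluedTour (Set.Icc 0 N) fun x y => (x = 0 ∧ y = i) ∨ (x = j ∧ y = N) := by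
  obtain ⟨S, hS, hS3⟩ := hu
  obtain ⟨T, hT, hT3⟩ := hv
  obtain ⟨b, hb⟩ := Finset.card_pos.1 (show 0 < T.card by omega)
  obtain ⟨N, w, hw, honS, honT, -⟩ := H.two_stars hS hT (hT b hb) (by omega)
    (Or.inr ⟨by omega, rfl, hb⟩)
  obtain ⟨⟨i, hi0, hiN, hi⟩, hue⟩ := hw.three_le honS hS3.ge
  obtain ⟨⟨j, hj0, hjN, hj⟩, hve⟩ := hw.three_le honT hT3.ge
  have hij : i ≠ j := by
    rintro rfl
    exact huv (hi.symm.trans hj)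
  have hclosed : ∀ n ≤ N, ∀ x, G.Adj (w n) x → OnTrack N w (w n) x := by
    intro n hn x hx
    by_cases hnu : w n = u
    · rw [hnu] at hx ⊢
      exact onTrack_of_star (h3 u) hS hS3 honS hx
    by_cases hnv : w n = v
    · rw [hnv] at hx ⊢
      exact onTrack_of_star (h3 v) hT hT3 honT hx
    by_contra hoff
    have hn0 : 0 < n := by
      refine Nat.pos_of_ne_zero ?_
      rintro rfl
      rcases hue with h | h
      · exact hnu h
      · rcases hve with h' | h'
        · exact hnv h'
        · exact huv (h.symm.trans h')
    have hnN : n < N := by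
      refine lt_of_le_of_ne hn ?_
      rintro rfl
      rcases hue with h | h
      · rcases hve with h' | h'
        · exact huv (h.symm.trans h')
        · exact hnv h'
      · exact hnu h
    rcases hno _ (hw.isBranch_of_not_onTrack hn0 hnN hx hoff) with h | h
    · exact hnu h
    · exact hnv h
  -- Here a is whichever branch vertex lies at the start, so the two possible orientations of the
  -- track share one argument.
  have main : ∀ a b : V, a ≠ b → ∀ i j : ℕ, 0 < i → i < N → 0 < j → j < N → w i = a → w j = b →
      w 0 = a → w N = b →
      G.GluedTour (Set.Icc 0 N) fun x y => (x = 0 ∧ y = i) ∨ (x = j ∧ y = N) := by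
    intro a b hab i j hi0 hiN hj0 hjN hi hj h0 hN
    refine hw.gluedTour hG hclosed (fun k n hkn hn => ?_)
    have hina : ∀ k, 0 < k → k < N → (w k = a ↔ k = i) := fun k h0 hN =>
      ⟨fun h => hw.inner_inj h0 hN hi0 hiN (h.trans hi.symm), fun h => h ▸ hi⟩
    have hinb : ∀ k, 0 < k → k < N → (w k = b ↔ k = j) := fun k h0 hN =>
      ⟨fun h => hw.inner_inj h0 hN hj0 hjN (h.trans hj.symm), fun h => h ▸ hj⟩
    have hcast : ((k : ℝ) = 0 ∧ (n : ℝ) = i ∨ (k : ℝ) = j ∧ (n : ℝ) = N)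
        ↔ (k = 0 ∧ n = i ∨ k = j ∧ n = N) := by
      norm_cast
    rw [hcast]
    rcases Nat.eq_zero_or_pos k with rfl | hk0
    · rw [h0]
      rcases hn.eq_or_lt with rfl | hnN
      · rw [hN]
        exact iff_of_false hab (by omega)
      · rw [eq_comm, hina n hkn hnN]
        omega
    · rcases hn.eq_or_lt with rfl | hnN
      · rw [hN, hinb k hk0 hkn]
        omega
      · refine iff_of_false (hw.inner k n hk0 hkn hnN) ?_
        omega
  rcases hue with h0 | hN <;> rcases hve with h0' | hN'
  · exact absurd (h0.symm.trans h0') huv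
  · exact ⟨i, j, N, hi0, hiN, hj0, hjN, hij, main u v huv i j hi0 hiN hj0 hjN hi hj h0 hN'⟩
  · exact ⟨j, i, N, hj0, hjN, hi0, hiN, hij.symm,
      main v u huv.symm j i hj0 hjN hi0 hiN hj hi h0' hN⟩
  · exact absurd (hN.symm.trans hN') huv

end SimpleGraph

/-! ### Excluding three branch vertices of degree three. -/

namespace SimpleGraph

variable {V : Type*} {G : SimpleGraph V}

/-- A track which enters a path through vertices of degree two follows it to the end. -/
lemma IsTrack.follow {N : ℕ} {w : ℕ → V} (hw : G.IsTrack N w) {m : ℕ} {p : ℕ → V}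
    (hadj : ∀ k < m, G.Adj (p k) (p (k + 1))) (hin : ∀ k, 0 < k → k < m → ¬ G.IsBranch (p k))
    (h0 : G.IsBranch (w 0)) (hN : G.IsBranch (w N)) (hfirst : OnTrack N w (p 0) (p 1)) :
    ∀ k < m, OnTrack N w (p k) (p (k + 1)) := by
  intro k
  induction k with
  | zero => exact fun _ => hfirst
  | succ k ih =>
    intro hk
    have hnb := hin (k + 1) (by omega) hk
    obtain ⟨i, hi0, hiN, hi⟩ := IsTrack.exists_index (ih (by omega)).symm
      (fun h => hnb (h ▸ h0)) (fun h => hnb (h ▸ hN))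
    by_contra hoff
    rw [← hi] at hoff
    have := hw.isBranch_of_not_onTrack hi0 hiN (hi ▸ hadj (k + 1) hk) hoff
    exact hnb (hi ▸ this)

/-- Take the full stars at x₁ and x₃ and one further edge at x₂, seven edges in all. The stars place
the ends of the track at x₁ and x₃. The track must follow both branch-free paths up to x₂, so it
contains three edges at x₂, which would have to be an end as well. -/
lemma HasTracks.not_three_branches_on_paths (H : G.HasTracks 7)
    (h3 : ∀ v, ∀ S : Finset V, (∀ x ∈ S, G.Adj v x) → S.card ≤ 3) {x₁ x₂ x₃ : V}
    (h12 : x₁ ≠ x₂) (h32 : x₃ ≠ x₂) (h13 : x₁ ≠ x₃)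
    (b₁ : G.IsBranch x₁) (b₂ : G.IsBranch x₂) (b₃ : G.IsBranch x₃)
    {m l : ℕ} {p r : ℕ → V} (hm : 0 < m) (hl : 0 < l)
    (p0 : p 0 = x₁) (pm : p m = x₂) (r0 : r 0 = x₃) (rl : r l = x₂)
    (padj : ∀ k < m, G.Adj (p k) (p (k + 1))) (radj : ∀ k < l, G.Adj (r k) (r (k + 1)))
    (pin : ∀ k, 0 < k → k < m → ¬ G.IsBranch (p k))
    (rin : ∀ k, 0 < k → k < l → ¬ G.IsBranch (r k))
    (hne : p (m - 1) ≠ r (l - 1)) : False := by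
  classical
  obtain ⟨S₁, hS₁, c₁⟩ := b₁
  obtain ⟨S₂, hS₂, c₂⟩ := b₂
  obtain ⟨S₃, hS₃, c₃⟩ := b₃
  -- The two paths occupy two neighbours of x₂; c is a third one.
  obtain ⟨c, hc, hcp, hcr⟩ : ∃ c ∈ S₂, c ≠ p (m - 1) ∧ c ≠ r (l - 1) := by
    by_contra! hno
    have : S₂ ⊆ {p (m - 1), r (l - 1)} := by
      intro x hx
      by_cases h : x = p (m - 1)
      · simp [h]
      · simp [hno x hx h]
    have h1 := Finset.card_le_card this
    have h2 : ({p (m - 1), r (l - 1)} : Finset V).card ≤ 2 := Finset.card_le_two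
    omega
  obtain ⟨N, w, hw, on₁, on₃, onc⟩ := H.two_stars hS₁ hS₃ (hS₂ c hc) (by omega)
    (Or.inl (by omega))
  have e₁ := (hw.three_le on₁ c₁.ge).2
  have e₃ := (hw.three_le on₃ c₃.ge).2
  have ends : (w 0 = x₁ ∧ w N = x₃) ∨ (w 0 = x₃ ∧ w N = x₁) := by
    rcases e₁ with h | h <;> rcases e₃ with h' | h'
    · exact absurd (h.symm.trans h') h13
    · exact Or.inl ⟨h, h'⟩
    · exact Or.inr ⟨h', h⟩
    · exact absurd (h.symm.trans h') h13
  have hbr : G.IsBranch (w 0) ∧ G.IsBranch (w N) := by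
    rcases ends with ⟨h, h'⟩ | ⟨h, h'⟩ <;> rw [h, h']
    · exact ⟨⟨S₁, hS₁, c₁⟩, ⟨S₃, hS₃, c₃⟩⟩
    · exact ⟨⟨S₃, hS₃, c₃⟩, ⟨S₁, hS₁, c₁⟩⟩
  have hp := hw.follow padj pin hbr.1 hbr.2
    (p0 ▸ onTrack_of_star (h3 x₁) hS₁ c₁ on₁ (p0 ▸ padj 0 hm)) (m - 1) (by omega)
  have hr := hw.follow radj rin hbr.1 hbr.2
    (r0 ▸ onTrack_of_star (h3 x₃) hS₃ c₃ on₃ (r0 ▸ radj 0 hl)) (l - 1) (by omega)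
  rw [Nat.sub_add_cancel hm, pm] at hp
  rw [Nat.sub_add_cancel hl, rl] at hr
  have e₂ := (hw.three_le (v := x₂) (S := {c, p (m - 1), r (l - 1)}) (by
    intro x hx
    simp only [Finset.mem_insert, Finset.mem_singleton] at hx
    rcases hx with rfl | rfl | rfl
    · exact onc
    · exact hp.symm
    · exact hr.symm)
    (Finset.card_eq_three.2 ⟨_, _, _, hcp, hcr, hne, rfl⟩).ge).2
  rcases ends with ⟨h, h'⟩ | ⟨h, h'⟩ <;> rw [h, h'] at e₂ <;> rcases e₂ with h2 | h2
  · exact h12 h2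
  · exact h32 h2
  · exact h32 h2
  · exact h12 h2

lemma Preconnected.exists_geodesic (hG : G.Preconnected) (a b : V) : ∃ p : ℕ → V,
    p 0 = a ∧ p (G.dist a b) = b ∧ (∀ k < G.dist a b, G.Adj (p k) (p (k + 1))) ∧
    ∀ k ≤ G.dist a b, G.dist a (p k) ≤ k ∧ G.dist (p k) b ≤ G.dist a b - k := by
  obtain ⟨q, hq⟩ := (hG a b).exists_walk_length_eq_dist
  refine ⟨q.getVert, q.getVert_zero, hq ▸ q.getVert_length, fun k hk => ?_, fun k hk => ⟨?_, ?_⟩⟩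
  · exact q.adj_getVert_succ (hq ▸ hk)
  · refine (dist_le (q.take k)).trans ?_
    rw [Walk.take_length]
    exact min_le_left _ _
  · refine (dist_le (q.drop k)).trans ?_
    rw [Walk.drop_length, hq]

/-- Extremal choices give the configuration of the previous argument: a and b are branch vertices at
minimal distance, joined by a geodesic, and c is a third branch vertex nearest to that geodesic.
Minimality keeps branch vertices out of the interiors of both geodesics, and the second one can only
arrive at a or at b. -/
lemma HasTracks.not_three_branches (H : G.HasTracks 7) (hG : G.Preconnected)
    (h3 : ∀ v, ∀ S : Finset V, (∀ x ∈ S, G.Adj v x) → S.card ≤ 3) {x y z : V}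
    (hx : G.IsBranch x) (hy : G.IsBranch y) (hz : G.IsBranch z) (hxy : x ≠ y) (hzx : z ≠ x)
    (hzy : z ≠ y) : False := by
  classical
  have ex₁ : ∃ d a b, G.IsBranch a ∧ G.IsBranch b ∧ a ≠ b ∧ G.dist a b = d :=
    ⟨_, x, y, hx, hy, hxy, rfl⟩
  obtain ⟨a, b, ha, hb, hab, hd⟩ := Nat.find_spec ex₁
  have hmin₁ : ∀ a' b', G.IsBranch a' → G.IsBranch b' → a' ≠ b' → G.dist a b ≤ G.dist a' b' :=
    fun a' b' h1 h2 h3 => hd ▸ Nat.find_min' ex₁ ⟨a', b', h1, h2, h3, rfl⟩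
  obtain ⟨p, p0, pm, padj, pdist⟩ := hG.exists_geodesic a b
  set m := G.dist a b with hm
  have : Nonempty V := ⟨x⟩
  have hconn : G.Connected := ⟨hG⟩
  have hm0 : 0 < m := hconn.pos_dist_of_ne hab
  have pin : ∀ k, 0 < k → k < m → ¬ G.IsBranch (p k) := by
    intro k hk0 hkm hbr
    have hpk := pdist k hkm.le
    have hne : a ≠ p k := by
      intro h
      rw [← h] at hpk
      omega
    have := hmin₁ a (p k) ha hbr hne
    omega
  have pinj : ∀ j k, j < k → k ≤ m → p j ≠ p k := by
    intro j k hjk hkm h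
    have h1 := (pdist j (by omega)).1
    have h2 := (pdist k hkm).2
    have h4 := hconn.dist_triangle (u := a) (v := p j) (w := b)
    rw [h] at h1 h4
    omega
  have pbr : ∀ k ≤ m, G.IsBranch (p k) → p k = a ∨ p k = b := by
    intro k hk hbr
    by_contra! hne
    refine pin k (Nat.pos_of_ne_zero ?_) (lt_of_le_of_ne hk ?_) hbr
    · rintro rfl
      exact hne.1 p0
    · rintro rfl
      exact hne.2 pm
  -- The minimal pair need not consist of two of x, y, z, but one of these three differs from both a
  -- and b.
  obtain ⟨z', hz', hz'a, hz'b⟩ : ∃ z', G.IsBranch z' ∧ z' ≠ a ∧ z' ≠ b := by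
    by_contra! hno
    by_cases h1 : x = a
    · have h2 : y = b := hno y hy (h1 ▸ hxy.symm)
      exact hzy ((hno z hz (h1 ▸ hzx)).trans h2.symm)
    · have h2 : x = b := hno x hx h1
      by_cases h4 : y = a
      · exact hzx ((hno z hz (h4 ▸ hzy)).trans h2.symm)
      · exact hxy (h2.trans (hno y hy h4).symm)
  have ex₂ : ∃ d c k, G.IsBranch c ∧ c ≠ a ∧ c ≠ b ∧ k ≤ m ∧ G.dist c (p k) = d :=
    ⟨_, z', 0, hz', hz'a, hz'b, hm0.le, rfl⟩
  obtain ⟨c, k, hc, hca, hcb, hkm, hd₂⟩ := Nat.find_spec ex₂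
  have hmin₂ : ∀ c' k', G.IsBranch c' → c' ≠ a → c' ≠ b → k' ≤ m →
      G.dist c (p k) ≤ G.dist c' (p k') :=
    fun c' k' h1 h2 h3 h4 => hd₂ ▸ Nat.find_min' ex₂ ⟨c', k', h1, h2, h3, h4, rfl⟩
  obtain ⟨r, r0, rl, radj, rdist⟩ := hG.exists_geodesic c (p k)
  set l := G.dist c (p k) with hl
  have hcp : ∀ j ≤ m, c ≠ p j := by
    rintro j hj rfl
    rcases pbr j hj hc with h | h
    · exact hca h
    · exact hcb h
  have hl0 : 0 < l := hconn.pos_dist_of_ne (hcp k hkm)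
  have hrp : ∀ i < l, ∀ j ≤ m, r i ≠ p j := by
    intro i hi j hj h
    have h1 := (rdist i hi.le).1
    have h2 := hmin₂ c j hc hca hcb hj
    rw [h] at h1
    omega
  have rin : ∀ i, 0 < i → i < l → ¬ G.IsBranch (r i) := by
    intro i hi0 hil hbr
    have h1 := (rdist i hil.le).2
    have h2 := hmin₂ (r i) k hbr (p0 ▸ hrp i hil 0 hm0.le) (pm ▸ hrp i hil m le_rfl) hkm
    omega
  have hlast : G.Adj (p k) (r (l - 1)) := by
    have := radj (l - 1) (by omega)
    rw [Nat.sub_add_cancel hl0, rl] at this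
    exact this.symm
  -- An inner vertex of the first geodesic is not a branch vertex and has both its neighbours on
  -- that geodesic, whereas r (l - 1) is an adjacent vertex off it.
  have hkend : k = 0 ∨ k = m := by
    by_contra! hne
    have hk0 : 0 < k := Nat.pos_of_ne_zero hne.1
    have hkm' : k < m := lt_of_le_of_ne hkm hne.2
    have hl1 := padj (k - 1) (by omega)
    rw [Nat.sub_add_cancel hk0] at hl1
    rcases eq_or_eq_of_not_isBranch (pin k hk0 hkm') hl1.symm (padj k hkm') hlast
      (pinj _ _ (by omega) (by omega)) with h | h
    · exact hrp _ (by omega) _ (by omega) h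
    · exact hrp _ (by omega) _ (by omega) h
  rcases hkend with rfl | rfl
  · refine H.not_three_branches_on_paths h3 (x₁ := b) (x₂ := a) (x₃ := c) hab.symm hca hcb.symm
      hb ha hc hm0 hl0 (p := fun j => p (m - j)) (r := r) (by simpa using pm) (by simpa using p0) r0
      (rl.trans p0) (fun j hj => ?_) radj (fun j h0 hj => pin _ (by omega) (by omega)) rin ?_
    · have := padj (m - (j + 1)) (by omega)
      rw [show m - (j + 1) + 1 = m - j by omega] at this
      exact this.symm
    · exact (hrp _ (by omega) _ (by omega)).symm
  · exact H.not_three_branches_on_paths h3 hab hcb hca.symm ha hb hc hm0 hl0 p0 pm r0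
      (rl.trans pm) padj radj pin rin (hrp _ (by omega) _ (by omega)).symm

/-! ### Paths through vertices of degree two -/

/-- A path which is continued without turning back as long as this is possible. -/
lemma exists_continuation (G : SimpleGraph V) (a b : V) : ∃ f : ℕ → V, f 0 = a ∧ f 1 = b ∧
    ∀ n, (∃ c, G.Adj (f (n + 1)) c ∧ c ≠ f n) →
      G.Adj (f (n + 1)) (f (n + 2)) ∧ f (n + 2) ≠ f n := by
  classical
  set next : V × V → V × V := fun q =>
    -- At a dead end the path stands still; nothing is claimed about such steps.
    if h : ∃ c, G.Adj q.2 c ∧ c ≠ q.1 then (q.2, h.choose) else (q.2, q.2) with hnext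
  set q : ℕ → V × V := fun n => next^[n] (a, b) with hq
  have hsucc : ∀ n, q (n + 1) = next (q n) := fun n => Function.iterate_succ_apply' _ _ _
  have hfst : ∀ n, (q (n + 1)).1 = (q n).2 := by
    intro n
    rw [hsucc, hnext]
    dsimp only
    split_ifs <;> rfl
  refine ⟨fun n => (q n).1, rfl, hfst 0, fun n hn => ?_⟩
  simp only [hfst] at hn ⊢
  have h2 : (q (n + 1)).2 = hn.choose := by
    rw [hsucc, hnext]
    dsimp only
    rw [dif_pos hn]
  rw [h2]
  exact hn.choose_spec

/-- The sequence runs from u around a loop back to u at time i and then along a tail; for i = 0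
there is only the tail. Away from u no vertex is a branch vertex, so a walk without turning back
cannot run into itself. -/
lemma gluedTour_of_tail (hG : G.Preconnected) {I : Set ℝ}
    (hI : I = Set.Ici 0 ∨ ∃ N : ℕ, I = Set.Icc (0 : ℝ) N) {u : V}
    (hnb : ∀ x, x ≠ u → ¬ G.IsBranch x) {i : ℕ} {s : ℕ → V} (hi1 : ((i + 1 : ℕ) : ℝ) ∈ I)
    (h0 : s 0 = u) (hi : s i = u) (hadj : ∀ n : ℕ, ((n + 1 : ℕ) : ℝ) ∈ I → G.Adj (s n) (s (n + 1)))
    (hback : ∀ n : ℕ, ((n + 2 : ℕ) : ℝ) ∈ I → s (n + 2) ≠ s n)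
    (hinj : ∀ a b, 0 < a → a < b → b ≤ i → s a ≠ s b)
    (hu : ∀ x, G.Adj u x → x = s 1 ∨ x = s (i - 1) ∨ x = s (i + 1))
    (hi1' : 0 < i → s (i + 1) ≠ s 1)
    (hend : ∀ n : ℕ, ((n + 1 : ℕ) : ℝ) ∈ I → ((n + 2 : ℕ) : ℝ) ∉ I → ∀ c, G.Adj (s (n + 1)) c →
      c = s n) :
    G.GluedTour I fun x y => x = 0 ∧ y = i := by
  have hdown : ∀ m n : ℕ, m ≤ n → (n : ℝ) ∈ I → (m : ℝ) ∈ I := by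
    intro m n hmn
    have : (m : ℝ) ≤ n := by exact_mod_cast hmn
    rcases hI with rfl | ⟨N, rfl⟩
    · exact fun _ => Set.mem_Ici.2 (Nat.cast_nonneg m)
    · exact fun h => ⟨Nat.cast_nonneg m, this.trans h.2⟩
  -- At a repetition after time i, the vertex just before it is a neighbour of s m, and all
  -- neighbours of s m are already in the sequence. This gives an earlier repetition, or a step
  -- back, or the excluded equality s (i + 1) = s 1.
  have inj : ∀ n : ℕ, (n : ℝ) ∈ I → ∀ m < n, s m = s n → m = 0 ∧ n = i := by
    intro n
    induction n using Nat.strong_induction_on with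
    | _ n ih =>
    intro hn m hmn heq
    have IH : ∀ n' < n, ∀ m' < n', s m' = s n' → m' = 0 ∧ n' = i :=
      fun n' h => ih n' h (hdown n' n h.le hn)
    have hself : ∀ k, k + 1 ≤ n → s k ≠ s (k + 1) := fun k hk =>
      (hadj k (hdown _ _ hk hn)).ne
    have hb : ∀ k, k + 2 ≤ n → s (k + 2) ≠ s k := fun k hk => hback k (hdown _ _ hk hn)
    rcases le_or_gt n i with hni | hni
    · rcases Nat.eq_zero_or_pos m with rfl | hm0
      · rcases hni.eq_or_lt with rfl | hni
        · exact ⟨rfl, rfl⟩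
        · exact absurd (heq.symm.trans (h0.trans hi.symm)) (hinj n i hmn hni le_rfl)
      · exact absurd heq (hinj m n hm0 hmn hni)
    exfalso
    obtain ⟨n, rfl⟩ : ∃ k, n = k + 1 := ⟨n - 1, by omega⟩
    have hstep := hadj n hn
    by_cases hmu : s m = u
    · have hxu : G.Adj u (s n) := by
        rw [← hmu, heq]
        exact hstep.symm
      rcases (show i ≤ n by omega).eq_or_lt with rfl | hin
      · exact hxu.ne hi.symm
      rcases hu _ hxu with h | h | h
      · rcases (show 1 ≤ n by omega).eq_or_lt with rfl | h1
        · obtain rfl : i = 0 := by omega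
          exact hb 0 (by omega) (by rw [← heq, hmu, h0])
        · have := IH n (by omega) 1 h1 h.symm
          omega
      · have := IH n (by omega) (i - 1) (by omega) h.symm
        omega
      · rcases (show i + 1 ≤ n by omega).eq_or_lt with rfl | h1
        · exact hb i (by omega) (by rw [← heq, hmu, hi])
        · have := IH n (by omega) (i + 1) h1 h.symm
          omega
    · have hm0 : 0 < m := Nat.pos_of_ne_zero (by rintro rfl; exact hmu h0)
      have hmn1 : m ≠ n := by
        rintro rfl
        exact hself m le_rfl heq
      have hmn2 : m + 1 ≠ n := by
        rintro rfl
        exact hb m le_rfl heq.symm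
      obtain ⟨m, rfl⟩ : ∃ k, m = k + 1 := ⟨m - 1, by omega⟩
      rcases eq_or_eq_of_not_isBranch (hnb _ hmu) (hadj m (hdown _ _ (by omega) hn)).symm
        (hadj (m + 1) (hdown _ _ (by omega) hn)) (x := s n) (heq ▸ hstep.symm)
        (hb m (by omega)).symm with h | h
      · obtain ⟨rfl, rfl⟩ := IH n (by omega) m (by omega) h.symm
        exact hi1' (by omega) heq.symm
      · have := IH n (by omega) (m + 1 + 1) (by omega) h.symm
        omega
  refine gluedTour_of_seq hI hG hadj (fun m n hmn hn h => ?_) (fun n hn x hx => ?_)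
    (fun m n hmn hn => ⟨fun h => ?_, ?_⟩)
  · have hlast : s (n + 1) ∈ s(s m, s (m + 1)) := h ▸ Sym2.mem_mk_right _ _
    rcases Sym2.mem_iff.1 hlast with h1 | h1
    · obtain ⟨rfl, hni⟩ := inj (n + 1) hn m (by omega) h1.symm
      have h2 : s 1 = s n := by
        rw [h1, Sym2.eq_swap (a := s n)] at h
        exact Sym2.congr_right.1 h
      rcases (show 1 ≤ n by omega).eq_or_lt with rfl | h3
      · exact hback 0 hn h1
      · have := inj n (hdown _ _ (by omega) hn) 1 h3 h2
        omega
    · have := inj (n + 1) hn (m + 1) (by omega) h1.symm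
      omega
  · by_cases hnu : s n = u
    · rw [hnu] at hx ⊢
      rcases hu x hx with rfl | rfl | rfl
      · exact ⟨0, hdown _ _ (by omega) hi1, by rw [h0]⟩
      · have hi0 : 0 < i := Nat.pos_of_ne_zero (by rintro rfl; exact hx.ne h0.symm)
        refine ⟨i - 1, hdown _ _ (by omega) hi1, ?_⟩
        rw [Nat.sub_add_cancel hi0, hi, Sym2.eq_swap]
      · exact ⟨i, hi1, by rw [hi]⟩
    · have hn0 : 0 < n := Nat.pos_of_ne_zero (by rintro rfl; exact hnu h0)
      obtain ⟨n, rfl⟩ : ∃ k, n = k + 1 := ⟨n - 1, by omega⟩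
      have hleft : ∃ m : ℕ, ((m + 1 : ℕ) : ℝ) ∈ I ∧ s(s (n + 1), s n) = s(s m, s (m + 1)) :=
        ⟨n, hn, Sym2.eq_swap⟩
      by_cases hmem : ((n + 2 : ℕ) : ℝ) ∈ I
      · rcases eq_or_eq_of_not_isBranch (hnb _ hnu) (hadj n hn).symm (hadj (n + 1) hmem) hx
          (hback n hmem).symm with rfl | rfl
        · exact hleft
        · exact ⟨n + 1, hmem, rfl⟩
      · rw [hend n hn hmem x hx]
        exact hleft
  · obtain ⟨rfl, rfl⟩ := inj n hn m hmn h
    simp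
  · rintro ⟨h1, h2⟩
    have h1' : m = 0 := by exact_mod_cast h1
    have h2' : n = i := by exact_mod_cast h2
    rw [h1', h2', h0, hi]

end SimpleGraph

/-! ### Tails, cycles, lines and the combinatorial classification. -/

namespace SimpleGraph

variable {V : Type*} {G : SimpleGraph V}

/-- The step from w i to w (i + 1) is prolonged without turning back. The alternatives are a tail
that stops at its first dead end and a tail that never stops. -/
lemma exists_gluedTour_of_tail (hG : G.Preconnected) {u : V}
    (hnb : ∀ x, x ≠ u → ¬ G.IsBranch x) {i : ℕ} {w : ℕ → V}
    (h0 : w 0 = u) (hi : w i = u) (hadj : ∀ n ≤ i, G.Adj (w n) (w (n + 1)))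
    (hback : ∀ n < i, w (n + 2) ≠ w n) (hinj : ∀ a b, 0 < a → a < b → b ≤ i → w a ≠ w b)
    (hu : ∀ x, G.Adj u x → x = w 1 ∨ x = w (i - 1) ∨ x = w (i + 1))
    (hi1 : 0 < i → w (i + 1) ≠ w 1) :
    (∃ N : ℕ, i < N ∧ G.GluedTour (Set.Icc 0 N) fun x y => x = 0 ∧ y = i) ∨
      G.GluedTour (Set.Ici 0) fun x y => x = 0 ∧ y = i := by
  obtain ⟨f, f0, f1, hf⟩ := exists_continuation G (w i) (w (i + 1))
  set s : ℕ → V := fun n => if n ≤ i then w n else f (n - i) with hs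
  have sw : ∀ n ≤ i + 1, s n = w n := by
    intro n hn
    rcases hn.eq_or_lt with rfl | hn
    · simp [hs, f1]
    · simp [hs, show n ≤ i by omega]
  have sf : ∀ k, s (i + k) = f k := by
    intro k
    rcases Nat.eq_zero_or_pos k with rfl | hk
    · simp [hs, f0]
    · simp [hs, show k ≠ 0 by omega]
  have main : ∀ I : Set ℝ, (I = Set.Ici 0 ∨ ∃ N : ℕ, I = Set.Icc (0 : ℝ) N) →
      ((i + 1 : ℕ) : ℝ) ∈ I →
      (∀ k : ℕ, ((i + k + 2 : ℕ) : ℝ) ∈ I → ∃ c, G.Adj (f (k + 1)) c ∧ c ≠ f k) →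
      (∀ k : ℕ, ((i + k + 1 : ℕ) : ℝ) ∈ I → ((i + k + 2 : ℕ) : ℝ) ∉ I →
        ¬ ∃ c, G.Adj (f (k + 1)) c ∧ c ≠ f k) →
      G.GluedTour I fun x y => x = 0 ∧ y = i := by
    intro I hI hiI hgood hbad
    refine gluedTour_of_tail hG hI hnb hiI (s := s) ?_ ?_ (fun n hn => ?_) (fun n hn => ?_)
      (fun a b ha hab hb => ?_) (fun x hx => ?_) (fun h => ?_) (fun n hn hn2 c hc => ?_)
    · rw [sw 0 (by omega), h0]
    · rw [sw i (by omega), hi]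
    · rcases le_or_gt n i with h | h
      · rw [sw n (by omega), sw (n + 1) (by omega)]
        exact hadj n h
      · obtain ⟨k, rfl⟩ : ∃ k, n = i + (k + 1) := ⟨n - i - 1, by omega⟩
        rw [sf, add_assoc, sf]
        exact (hf k (hgood k hn)).1
    · rcases lt_or_ge n i with h | h
      · rw [sw n (by omega), sw (n + 2) (by omega)]
        exact hback n h
      · obtain ⟨k, rfl⟩ : ∃ k, n = i + k := ⟨n - i, by omega⟩
        rw [sf, add_assoc, sf]
        exact (hf k (hgood k hn)).2
    · rw [sw a (by omega), sw b (by omega)]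
      exact hinj a b ha hab hb
    · rw [sw 1 (by omega), sw (i - 1) (by omega), sw (i + 1) le_rfl]
      exact hu x hx
    · rw [sw 1 (by omega), sw (i + 1) le_rfl]
      exact hi1 h
    · have hni : i ≤ n := by
        by_contra! h
        apply hn2
        have : ((n + 2 : ℕ) : ℝ) ≤ ((i + 1 : ℕ) : ℝ) := by exact_mod_cast (by omega)
        rcases hI with rfl | ⟨N, rfl⟩
        · exact Set.mem_Ici.2 (Nat.cast_nonneg _)
        · exact ⟨Nat.cast_nonneg _, this.trans hiI.2⟩
      obtain ⟨k, rfl⟩ : ∃ k, n = i + k := ⟨n - i, by omega⟩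
      have hb := hbad k hn hn2
      rw [add_assoc, sf] at hc
      rw [sf]
      by_contra hne
      exact hb ⟨c, hc, hne⟩
  by_cases hall : ∀ k, ∃ c, G.Adj (f (k + 1)) c ∧ c ≠ f k
  · right
    refine main _ (Or.inl rfl) (Set.mem_Ici.2 (Nat.cast_nonneg _)) (fun k _ => hall k)
      fun k _ h => absurd (Set.mem_Ici.2 (Nat.cast_nonneg _)) h
  · left
    classical
    push Not at hall
    -- For the first k at which f (k + 1) is a dead end, this vertex has index i + k + 1 in s.
    refine ⟨i + Nat.find hall + 1, by omega, main _ (Or.inr ⟨_, rfl⟩) ?_ ?_ ?_⟩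
    · rw [natCast_mem_Icc]
      omega
    · intro k hk
      rw [natCast_mem_Icc] at hk
      have := Nat.find_min hall (m := k) (by omega)
      push Not at this
      exact this
    · intro k hk hk2
      rw [natCast_mem_Icc] at hk hk2
      have := Nat.find_spec hall
      rw [show k = Nat.find hall by omega]
      push Not
      exact this

/-- There are neither branch vertices nor leaves, so an edge extends in both directions to a walk
indexed by ℤ that never turns back. If the walk is injective it is a line; otherwise a shortest
return gives a cycle. -/
lemma exists_gluedTour_of_two_regular (hG : G.Preconnected) (hnb : ∀ x, ¬ G.IsBranch x)
    (hleaf : ∀ a b, G.Adj a b → ∃ c, G.Adj b c ∧ c ≠ a) {a b : V} (hab : G.Adj a b) :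
    (∃ N : ℕ, 0 < N ∧ G.GluedTour (Set.Icc 0 N) fun x y => x = 0 ∧ y = N) ∨
      G.GluedTour Set.univ fun _ _ => False := by
  have hray : ∀ a b, G.Adj a b → ∃ f : ℕ → V, f 0 = a ∧ f 1 = b ∧
      (∀ n, G.Adj (f n) (f (n + 1))) ∧ ∀ n, f (n + 2) ≠ f n := by
    intro a b hab
    obtain ⟨f, f0, f1, hf⟩ := exists_continuation G a b
    have hadj : ∀ n, G.Adj (f n) (f (n + 1)) := by
      intro n
      induction n with
      | zero => rwa [f0, f1]
      | succ n ih => exact (hf n (hleaf _ _ ih)).1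
    exact ⟨f, f0, f1, hadj, fun n => (hf n (hleaf _ _ (hadj n))).2⟩
  obtain ⟨f, f0, f1, fadj, fback⟩ := hray a b hab
  obtain ⟨g, g0, g1, gadj, gback⟩ := hray b a hab.symm
  -- The rays f and g start with the same edge in opposite directions; reversing g as 1 - n makes
  -- them agree at the times 0 and 1.
  set z : ℤ → V := fun n => if 0 ≤ n then f n.toNat else g (1 - n).toNat with hz
  have zf : ∀ k : ℕ, z k = f k := fun k => by simp [hz]
  have zg : ∀ k : ℕ, z (1 - k) = g k := by
    intro k
    rcases lt_or_ge 1 k with h | h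
    · have h1 : ¬ (0 : ℤ) ≤ 1 - k := by omega
      simp only [hz, if_neg h1]
      congr 1
      omega
    · interval_cases k
      · have := zf 1
        simpa [f1, g0] using this
      · have := zf 0
        simpa [f0, g1] using this
  have zadj : ∀ n, G.Adj (z n) (z (n + 1)) := by
    intro n
    rcases le_or_gt 0 n with h | h
    · obtain ⟨k, rfl⟩ := Int.eq_ofNat_of_zero_le h
      have := zf (k + 1)
      push_cast at this
      rw [this, zf]
      exact fadj k
    · obtain ⟨k, hk⟩ := Int.eq_ofNat_of_zero_le (show 0 ≤ -n by omega)
      have h1 : n + 1 = 1 - (k : ℤ) := by omega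
      have h2 : n = 1 - ((k + 1 : ℕ) : ℤ) := by omega
      rw [h1, zg, h2, zg]
      exact (gadj k).symm
  have zback : ∀ n, z (n + 2) ≠ z n := by
    intro n
    rcases le_or_gt 0 n with h | h
    · obtain ⟨k, rfl⟩ := Int.eq_ofNat_of_zero_le h
      have := zf (k + 2)
      push_cast at this
      rw [this, zf]
      exact fback k
    · obtain ⟨k, hk⟩ := Int.eq_ofNat_of_zero_le (show 0 ≤ -n - 1 by omega)
      have h1 : n + 2 = 1 - (k : ℤ) := by omega
      have h2 : n = 1 - ((k + 2 : ℕ) : ℤ) := by omega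
      rw [h1, zg, h2, zg]
      exact (gback k).symm
  have znbr : ∀ n x, G.Adj (z n) x → x = z (n - 1) ∨ x = z (n + 1) := by
    intro n x hx
    have h1 := zadj (n - 1)
    have h2 := zback (n - 1)
    rw [sub_add_cancel] at h1
    rw [show n - 1 + 2 = n + 1 by ring] at h2
    exact eq_or_eq_of_not_isBranch (hnb _) h1.symm (zadj n) hx h2.symm
  by_cases hex : ∃ p : ℕ, 0 < p ∧ ∃ a : ℤ, z a = z (a + p)
  · left
    classical
    obtain ⟨hp0, a, ha⟩ := Nat.find_spec hex
    have hmin : ∀ q : ℕ, 0 < q → ∀ a : ℤ, z a = z (a + q) → Nat.find hex ≤ q :=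
      fun q hq a h => Nat.find_min' hex ⟨hq, a, h⟩
    generalize Nat.find hex = p at hp0 ha hmin
    set w : ℕ → V := fun k => z (a + k) with hw
    have wp : w 0 = w p := by simpa [hw] using ha
    have wadj : ∀ n, G.Adj (w n) (w (n + 1)) := by
      intro n
      have := zadj (a + n)
      simp only [hw]
      push_cast
      rwa [← add_assoc]
    -- A repetition inside one round would be a return shorter than the minimal p.
    have winj : ∀ m n, m < n → n ≤ p → w m = w n → m = 0 ∧ n = p := by
      intro m n hmn hnp h
      have := hmin (n - m) (by omega) (a + m) (by
        simp only [hw] at h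
        rw [h]
        congr 1
        omega)
      omega
    have hp3 : 3 ≤ p := by
      by_contra! h
      interval_cases p
      · exact (wadj 0).ne wp
      · have := zback a
        exact this (by simpa [hw] using wp.symm)
    refine ⟨p, hp0, gluedTour_of_seq (Or.inr ⟨p, rfl⟩) hG (w := w) (fun n _ => wadj n)
      (fun m n hmn hn h => ?_) (fun n hn x hx => ?_) (fun m n hmn hn => ⟨fun h => ?_, ?_⟩)⟩
    · rw [natCast_mem_Icc] at hn
      rcases Sym2.eq_iff.1 h with ⟨h1, h2⟩ | ⟨h1, h2⟩
      · have := winj m n hmn (by omega) h1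
        omega
      · have h4 := winj m (n + 1) (by omega) hn h1
        have h5 := winj (m + 1) n (by omega) (by omega) h2
        omega
    · rw [natCast_mem_Icc] at hn
      have ends : ∀ x, G.Adj (w 0) x → x = w (p - 1) ∨ x = w 1 := by
        intro x hx
        have h1 := wadj (p - 1)
        rw [Nat.sub_add_cancel hp0, ← wp] at h1
        refine eq_or_eq_of_not_isBranch (hnb _) h1.symm (wadj 0) hx fun h => ?_
        have := winj 1 (p - 1) (by omega) (by omega) h.symm
        omega
      have hends : ∀ x, G.Adj (w 0) x →
          ∃ m : ℕ, ((m + 1 : ℕ) : ℝ) ∈ Set.Icc (0 : ℝ) p ∧ s(w 0, x) = s(w m, w (m + 1)) := by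
        intro x hx
        rcases ends x hx with rfl | rfl
        · refine ⟨p - 1, natCast_mem_Icc.2 (by omega), ?_⟩
          rw [Nat.sub_add_cancel hp0, wp, Sym2.eq_swap]
        · exact ⟨0, natCast_mem_Icc.2 (by omega), rfl⟩
      rcases Nat.eq_zero_or_pos n with rfl | hn0
      · exact hends x hx
      rcases hn.eq_or_lt with rfl | hnp
      · rw [← wp] at hx ⊢
        exact hends x hx
      rcases znbr _ x hx with rfl | rfl
      · refine ⟨n - 1, natCast_mem_Icc.2 (by omega), ?_⟩
        have h1 : a + (n : ℤ) - 1 = a + ((n - 1 : ℕ) : ℤ) := by omega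
        rw [Nat.sub_add_cancel hn0, Sym2.eq_swap, h1]
      · refine ⟨n, natCast_mem_Icc.2 hnp, ?_⟩
        simp only [hw]
        push_cast
        rw [add_assoc]
    · rw [natCast_mem_Icc] at hn
      obtain ⟨rfl, rfl⟩ := winj m n hmn hn h
      simp
    · rintro ⟨h1, h2⟩
      have h1' : m = 0 := by exact_mod_cast h1
      have h2' : n = p := by exact_mod_cast h2
      rw [h1', h2', wp]
  · right
    have zinj : ∀ m n, m < n → z m ≠ z n := by
      intro m n hmn h
      exact hex ⟨(n - m).toNat, by omega, m, by rw [h]; congr 1; omega⟩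
    have zinj' : ∀ m n, z m = z n → m = n := by
      intro m n h
      by_contra hne
      rcases lt_or_gt_of_ne hne with hlt | hlt
      · exact zinj m n hlt h
      · exact zinj n m hlt h.symm
    refine ⟨z, IsTour.of_closed hG (fun _ _ => trivial) (fun _ _ => trivial) Set.ordConnected_univ
      trivial (fun n _ _ => zadj n) (fun m n _ _ _ _ h => ?_) (fun n _ x hx => ?_),
      fun m n _ _ hmn => iff_of_false (zinj m n hmn) not_false⟩
    · rcases Sym2.eq_iff.1 h with ⟨h1, h2⟩ | ⟨h1, h2⟩
      · exact zinj' _ _ h1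
      · have := zinj' _ _ h1
        have := zinj' _ _ h2
        omega
    · rcases znbr _ x hx with rfl | rfl
      · exact ⟨n - 1, trivial, trivial, by rw [sub_add_cancel, Sym2.eq_swap]⟩
      · exact ⟨n, trivial, trivial, rfl⟩

lemma GluedTour.congr {I : Set ℝ} {P Q : ℝ → ℝ → Prop} (h : G.GluedTour I P)
    (hPQ : ∀ x y, x < y → (P x y ↔ Q x y)) : G.GluedTour I Q := by
  obtain ⟨w, hw, hP⟩ := h
  exact ⟨w, hw, fun m n hm hn hmn => (hP m n hm hn hmn).trans (hPQ _ _ (by exact_mod_cast hmn))⟩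

/-- The shapes of the graphs in which any two to seven edges lie on a track. -/
theorem HasTracks.classification (H : G.HasTracks 7) (hG : G.Preconnected) {a b : V}
    (hab : G.Adj a b) :
    (∃ N : ℕ, 0 < N ∧ G.GluedTour (Set.Icc 0 N) fun _ _ => False) ∨
    G.GluedTour (Set.Ici 0) (fun _ _ => False) ∨
    G.GluedTour Set.univ (fun _ _ => False) ∨
    (∃ N : ℕ, 0 < N ∧ G.GluedTour (Set.Icc 0 N) fun x y => x = 0 ∧ y = N) ∨
    (∃ i N : ℕ, 0 < i ∧ i < N ∧ G.GluedTour (Set.Icc 0 N) fun x y => x = 0 ∧ y = i) ∨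
    (∃ i : ℕ, 0 < i ∧ G.GluedTour (Set.Ici 0) fun x y => x = 0 ∧ y = i) ∨
    (∃ i N : ℕ, 0 < i ∧ i < N ∧ G.GluedTour (Set.Icc 0 N)
      fun x y => (x = 0 ∧ y = i) ∨ (x = 0 ∧ y = N) ∨ (x = i ∧ y = N)) ∨
    (∃ i j N : ℕ, 0 < i ∧ i < N ∧ 0 < j ∧ j < N ∧ i ≠ j ∧
      G.GluedTour (Set.Icc 0 N) fun x y => (x = 0 ∧ y = i) ∨ (x = j ∧ y = N)) := by
  classical
  by_cases h4 : ∃ v, ∃ S : Finset V, (∀ x ∈ S, G.Adj v x) ∧ S.card = 4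
  · obtain ⟨v, S, hS, hc⟩ := h4
    iterate 6 right
    left
    exact exists_figureEight H hG hS hc
  have h3 : ∀ v, ∀ S : Finset V, (∀ x ∈ S, G.Adj v x) → S.card ≤ 3 := by
    intro v S hS
    by_contra! h
    obtain ⟨S', hS', hc⟩ := Finset.exists_subset_card_eq (show 4 ≤ S.card from h)
    exact h4 ⟨v, S', fun x hx => hS x (hS' hx), hc⟩
  by_cases hu : ∃ u, G.IsBranch u
  · obtain ⟨u, hu⟩ := hu
    by_cases hv : ∃ v, v ≠ u ∧ G.IsBranch v
    · obtain ⟨v, hvu, hv⟩ := hv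
      iterate 7 right
      refine exists_theta_or_dumbbell H hG h3 hvu.symm hu hv fun x hx => ?_
      by_contra! hne
      exact H.not_three_branches hG h3 hu hv hx hvu.symm hne.1 hne.2
    · have hnb : ∀ x, x ≠ u → ¬ G.IsBranch x := fun x hx hb => hv ⟨x, hx, hb⟩
      obtain ⟨S, hS, hS3⟩ := hu
      obtain ⟨c, hc⟩ := Finset.card_pos.1 (show 0 < S.card by omega)
      have key : ∃ N w, G.IsTrack N w ∧ (∀ x ∈ S, OnTrack N w u x) ∧ w 0 = u := by
        obtain ⟨N, w, hw, hon, -, -⟩ := H.two_stars (T := ∅) (v := u) hS (by simp) (hS c hc)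
          (by omega) (Or.inl (by simp [hS3]))
        rcases (hw.three_le hon hS3.ge).2 with h | h
        · exact ⟨N, w, hw, hon, h⟩
        -- Reversing the track, if necessary, makes it start at the branch vertex u, so that its
        -- first part up to the inner visit is the loop.
        · exact ⟨N, _, hw.reverse, fun x hx => (hon x hx).reverse, by simpa using h⟩
      obtain ⟨N, w, hw, hon, h0⟩ := key
      obtain ⟨i, hi0, hiN, hi⟩ := (hw.three_le hon hS3.ge).1
      have a1 : G.Adj u (w 1) := h0 ▸ hw.adj 0 (by omega)
      have a2 : G.Adj u (w (i - 1)) := hi ▸ hw.adj_of_onTrack (IsTrack.onTrack_left hi0 hiN)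
      have a3 : G.Adj u (w (i + 1)) := hi ▸ hw.adj i hiN
      have n23 := hw.left_ne_right hi0 hiN
      have n13 : w 1 ≠ w (i + 1) := by
        intro h
        refine hw.edge_ne 0 i hi0 hiN ?_
        rw [h0, hi, h]
      have n12 : w 1 ≠ w (i - 1) := by
        intro h
        rcases (show 1 ≤ i from hi0).eq_or_lt with rfl | h1
        · exact a1.ne hi.symm
        · refine hw.edge_ne 0 (i - 1) (by omega) (by omega) ?_
          rw [Nat.sub_add_cancel hi0, h0, hi, ← h, Sym2.eq_swap]
      have := exists_gluedTour_of_tail hG hnb h0 hi (fun n hn => hw.adj n (by omega))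
        (fun n hn => (hw.left_ne_right (i := n + 1) (by omega) (by omega)).symm)
        (fun a b ha hab hb => hw.inner a b ha hab (by omega)) (fun x hx => ?_)
        (fun _ => n13.symm)
      · iterate 4 right
        rcases this with ⟨N, hN, h⟩ | h
        · exact Or.inl ⟨i, N, hi0, hN, h⟩
        · exact Or.inr (Or.inl ⟨i, hi0, h⟩)
      · by_contra! hne
        have := h3 u {w 1, w (i - 1), w (i + 1), x} (by simp [a1, a2, a3, hx])
        rw [Finset.card_eq_succ.2 ⟨w 1, {w (i - 1), w (i + 1), x}, by
          simp [n12, n13, hne.1.symm], rfl,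
          Finset.card_eq_three.2 ⟨_, _, _, n23, hne.2.1.symm, hne.2.2.symm, rfl⟩⟩] at this
        omega
  · push Not at hu
    by_cases hleaf : ∀ a b, G.Adj a b → ∃ c, G.Adj b c ∧ c ≠ a
    · rcases exists_gluedTour_of_two_regular hG hu hleaf hab with h | h
      · iterate 3 right
        exact Or.inl h
      · exact Or.inr (Or.inr (Or.inl h))
    · push Not at hleaf
      obtain ⟨a, b, hab, hl⟩ := hleaf
      -- A graph with a leaf b and no branch vertex is a tail starting at b with an empty loop, i =
      -- 0; the identification of 0 with 0 is then void.
      have hP : ∀ x y : ℝ, x < y → ((x = 0 ∧ y = (0 : ℕ)) ↔ False) := by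
        rintro x y hxy
        refine iff_of_false ?_ not_false
        rintro ⟨rfl, rfl⟩
        simp at hxy
      have := exists_gluedTour_of_tail hG (u := b) (fun x _ => hu x) (i := 0)
        (w := fun n => if n = 0 then b else a) rfl rfl
        (fun n hn => by
          obtain rfl : n = 0 := by omega
          exact hab.symm)
        (fun n hn => by omega) (fun a b _ _ _ => by omega) (fun x hx => Or.inl (hl x hx))
        (fun h => by omega)
      rcases this with ⟨N, hN, h⟩ | h
      · exact Or.inl ⟨N, hN, h.congr hP⟩
      · exact Or.inr (Or.inl (h.congr hP))

end SimpleGraph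

/-! ### Intervals with identifications and their arcs. -/

open Topology

/-- `X` is obtained from the set `D` of reals by identifying the points `x < y` with `Q x y`. -/
def IsGlued (D : Set ℝ) (Q : ℝ → ℝ → Prop) (X : Type*) [TopologicalSpace X] : Prop :=
  ∃ f : D → X, IsQuotientMap f ∧ ∀ x y : D, x < y → (f x = f y ↔ Q x y)

namespace IsGlued

variable {D I : Set ℝ} {P Q : ℝ → ℝ → Prop} {X Y : Type*} [TopologicalSpace X] [TopologicalSpace Y]

lemma nonempty_homeomorph (hX : IsGlued I P X) (hY : IsGlued D Q Y) (β : I ≃ₜ D)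
    (hβ : ∀ x y : I, x < y → β x < β y) (hPQ : ∀ x y : I, x < y → (P x y ↔ Q (β x) (β y))) :
    Nonempty (X ≃ₜ Y) := by
  obtain ⟨f, hf, hfP⟩ := hX
  obtain ⟨g, hg, hgQ⟩ := hY
  refine hf.nonempty_homeomorph hg β fun x y => ?_
  rcases lt_trichotomy x y with h | rfl | h
  · rw [hfP x y h, hgQ _ _ (hβ x y h), hPQ x y h]
  · simp
  · rw [eq_comm, hfP y x h, hPQ y x h, ← hgQ _ _ (hβ y x h), eq_comm]

lemma of_homeomorph (hX : IsGlued D Q X) (φ : X ≃ₜ Y) : IsGlued D Q Y := by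
  obtain ⟨f, hf, hfQ⟩ := hX
  refine ⟨φ ∘ f, φ.isQuotientMap.comp hf, fun x y h => ?_⟩
  rw [← hfQ x y h]
  exact φ.injective.eq_iff

lemma homeomorph (hX : IsGlued D Q X) (hY : IsGlued D Q Y) : Nonempty (X ≃ₜ Y) :=
  hX.nonempty_homeomorph hY (Homeomorph.refl D) (fun _ _ h => h) fun _ _ _ => Iff.rfl

lemma reparam (hX : IsGlued I P X) (β : I ≃ₜ D) (hβ : ∀ x y : I, x < y → β x < β y)
    (hPQ : ∀ x y : I, x < y → (P x y ↔ Q (β x) (β y))) : IsGlued D Q X := by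
  obtain ⟨f, hf, hfP⟩ := hX
  refine ⟨f ∘ β.symm, hf.comp β.symm.isQuotientMap, fun x y h => ?_⟩
  have hlt : β.symm x < β.symm y := by
    rcases lt_trichotomy (β.symm x) (β.symm y) with h1 | h1 | h1
    · exact h1
    · exact absurd (β.symm.injective h1) h.ne
    · have := hβ _ _ h1
      simp only [Homeomorph.apply_symm_apply] at this
      exact absurd this h.not_gt
  have := hfP _ _ hlt
  rw [hPQ _ _ hlt] at this
  simpa using this

/-- If some interval contains exactly one point of each class, then `X` is `ω`-ac. -/
lemma isOmegaAC [T2Space X] (hX : IsGlued D Q X) {J : Set ℝ} (hJ : J ⊆ D) (ho : J.OrdConnected)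
    (hne : J.Nontrivial) (hinj : ∀ x ∈ J, ∀ y ∈ J, x < y → ¬ Q x y)
    (hsurj : ∀ x ∈ D, x ∉ J → ∃ y ∈ J, (x < y ∧ Q x y) ∨ (y < x ∧ Q y x)) :
    ArcConnected.IsOmegaAC X := by
  classical
  obtain ⟨f, hf, hfQ⟩ := hX
  intro n S _
  have hpre : ∀ x : X, ∃ t, ∃ ht : t ∈ J, f ⟨t, hJ ht⟩ = x := by
    intro x
    obtain ⟨⟨t, ht⟩, rfl⟩ := hf.surjective x
    by_cases htJ : t ∈ J
    · exact ⟨t, htJ, rfl⟩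
    · obtain ⟨y, hy, ⟨h1, h2⟩ | ⟨h1, h2⟩⟩ := hsurj t ht htJ
      · exact ⟨y, hy, ((hfQ ⟨t, ht⟩ ⟨y, hJ hy⟩ h1).2 h2).symm⟩
      · exact ⟨y, hy, (hfQ ⟨y, hJ hy⟩ ⟨t, ht⟩ h1).2 h2⟩
  choose σ hσJ hσ using hpre
  obtain ⟨p, hp, q, hq, hpq⟩ := hne.exists_lt
  -- The two extra points keep the interval spanned by T nondegenerate, even when S has at most one
  -- point.
  set T : Finset ℝ := insert p (insert q (S.image σ)) with hT
  have hTJ : ∀ t ∈ T, t ∈ J := by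
    intro t ht
    simp only [hT, Finset.mem_insert, Finset.mem_image] at ht
    rcases ht with rfl | rfl | ⟨x, -, rfl⟩
    · exact hp
    · exact hq
    · exact hσJ x
  have hTne : T.Nonempty := ⟨p, by simp [hT]⟩
  set a := T.min' hTne with ha
  set b := T.max' hTne with hb
  have haT : ∀ t ∈ T, t ∈ Set.Icc a b := fun t ht => ⟨T.min'_le t ht, T.le_max' t ht⟩
  have hab : a < b := ((haT p (by simp [hT])).1.trans_lt hpq).trans_le (haT q (by simp [hT])).2
  have hsub : Set.Icc a b ⊆ J := ho.out (hTJ _ (T.min'_mem _)) (hTJ _ (T.max'_mem _))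
  set h : Set.Icc a b → X := fun t => f ⟨t, hJ (hsub t.2)⟩ with hh
  have hc : Continuous h := hf.continuous.comp (by fun_prop)
  have hi : Function.Injective h := by
    intro x y hxy
    rcases lt_trichotomy x y with hlt | rfl | hlt
    · exact absurd ((hfQ ⟨x, hJ (hsub x.2)⟩ ⟨y, hJ (hsub y.2)⟩ hlt).1 hxy)
        (hinj _ (hsub x.2) _ (hsub y.2) hlt)
    · rfl
    · exact absurd ((hfQ ⟨y, hJ (hsub y.2)⟩ ⟨x, hJ (hsub x.2)⟩ hlt).1 hxy.symm)
        (hinj _ (hsub y.2) _ (hsub x.2) hlt)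
  have hemb := (hc.isClosedEmbedding hi).isEmbedding
  refine ⟨Set.range h, ⟨(iccHomeoI a b hab).symm.trans hemb.toHomeomorph⟩, fun x hx => ?_⟩
  refine ⟨⟨σ x, haT _ ?_⟩, hσ x⟩
  simp only [hT, Finset.mem_insert, Finset.mem_image]
  exact Or.inr (Or.inr ⟨x, hx, rfl⟩)

end IsGlued

/-- A glued tour controls P only at integer times, so P must be known to relate integers only. -/
lemma SimpleGraph.GluedTour.isGlued {V : Type*} {G : SimpleGraph V} {I : Set ℝ}
    {P : ℝ → ℝ → Prop} (h : G.GluedTour I P)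
    (hP : ∀ x y, P x y → ∃ m n : ℤ, x = m ∧ y = n) : IsGlued I P G.OneComplex := by
  obtain ⟨w, T, hw⟩ := h
  refine ⟨_, T.isQuotientMap, fun x y hxy => ?_⟩
  rw [T.tracePath_eq_iff x.2 y.2]
  constructor
  · rintro (h | ⟨m, n, hm, hn, h⟩)
    · exact absurd (Subtype.ext h) hxy.ne
    · rw [hm, hn]
      refine (hw m n (hm ▸ x.2) (hn ▸ y.2) ?_).1 h
      have : (x : ℝ) < y := hxy
      rw [hm, hn] at this
      exact_mod_cast this
  · intro h
    obtain ⟨m, n, hm, hn⟩ := hP _ _ h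
    refine Or.inr ⟨m, n, hm, hn, (hw m n (hm ▸ x.2) (hn ▸ y.2) ?_).2 (hm ▸ hn ▸ h)⟩
    have : (x : ℝ) < y := hxy
    rw [hm, hn] at this
    exact_mod_cast this

/-! ### Changes of parameter -/

/-- A piecewise affine change of parameter. -/
lemma exists_reparam_Icc {i j N : ℝ} (hi : 0 < i) (hij : i < j) (hjN : j < N) :
    ∃ β : Set.Icc 0 N ≃ₜ Set.Icc (0 : ℝ) 3, (∀ x y, x < y → β x < β y) ∧
      ∀ x, (x.1 = 0 ↔ (β x).1 = 0) ∧ (x.1 = i ↔ (β x).1 = 1) ∧ (x.1 = j ↔ (β x).1 = 2) ∧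
        (x.1 = N ↔ (β x).1 = 3) := by
  have hj : 0 < j - i := by linarith
  have hN : 0 < N - j := by linarith
  -- The three summands each grow by 1, over [0, i], [i, j] and [j, N] respectively. The outer two
  -- are not clamped on their outer sides, so f is strictly increasing on all of ℝ.
  set f : ℝ → ℝ := fun x =>
    min x i / i + min (max (x - i) 0) (j - i) / (j - i) + max (x - j) 0 / (N - j) with hf
  have hc : Continuous f := by
    simp only [hf]
    fun_prop
  have hmono : StrictMono f := by
    intro x y hxy
    have m1 : min x i / i ≤ min y i / i := by gcongr
    have m2 : min (max (x - i) 0) (j - i) / (j - i) ≤ min (max (y - i) 0) (j - i) / (j - i) := by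
      gcongr
    have m3 : max (x - j) 0 / (N - j) ≤ max (y - j) 0 / (N - j) := by gcongr
    simp only [hf]
    rcases lt_or_ge x i with h1 | h1
    · have : min x i / i < min y i / i := by
        rw [min_eq_left h1.le]
        gcongr
        exact lt_min hxy h1
      linarith
    rcases lt_or_ge x j with h2 | h2
    · have : min (max (x - i) 0) (j - i) / (j - i) < min (max (y - i) 0) (j - i) / (j - i) := by
        rw [max_eq_left (by linarith), min_eq_left (by linarith), max_eq_left (by linarith)]
        gcongr
        exact lt_min (by linarith) (by linarith)
      linarith
    · have : max (x - j) 0 / (N - j) < max (y - j) 0 / (N - j) := by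
        rw [max_eq_left (by linarith), max_eq_left (by linarith)]
        gcongr
      linarith
  have f0 : f 0 = 0 := by
    simp only [hf]
    rw [min_eq_left hi.le, max_eq_right (by linarith : (0 : ℝ) - i ≤ 0), min_eq_left hj.le,
      max_eq_right (by linarith : (0 : ℝ) - j ≤ 0)]
    simp
  have fi : f i = 1 := by
    simp only [hf]
    rw [min_self, sub_self, max_self, min_eq_left hj.le, max_eq_right (by linarith : i - j ≤ 0),
      div_self hi.ne']
    simp
  have fj : f j = 2 := by
    simp only [hf]
    rw [min_eq_right hij.le, max_eq_left hj.le, min_self, sub_self, max_self, div_self hi.ne',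
      div_self hj.ne']
    norm_num
  have fN : f N = 3 := by
    simp only [hf]
    rw [min_eq_right (by linarith), max_eq_left (by linarith : 0 ≤ N - i),
      min_eq_right (by linarith), max_eq_left hN.le, div_self hi.ne', div_self hj.ne',
      div_self hN.ne']
    norm_num
  have hmaps : ∀ x : Set.Icc 0 N, f x ∈ Set.Icc (0 : ℝ) 3 := fun x =>
    ⟨f0.symm.le.trans (hmono.monotone x.2.1), (hmono.monotone x.2.2).trans fN.le⟩
  have hbij : Function.Bijective fun x : Set.Icc 0 N => (⟨f x, hmaps x⟩ : Set.Icc (0 : ℝ) 3) := by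
    constructor
    · intro x y hxy
      exact Subtype.ext (hmono.injective (congrArg Subtype.val hxy))
    · intro y
      have h0N : (0 : ℝ) ≤ N := by linarith
      have := intermediate_value_Icc h0N hc.continuousOn
      rw [f0, fN] at this
      obtain ⟨x, hx, hxy⟩ := this y.2
      exact ⟨⟨x, hx⟩, Subtype.ext hxy⟩
  refine ⟨Continuous.homeoOfEquivCompactToT2 (f := Equiv.ofBijective _ hbij)
    (Continuous.subtype_mk (hc.comp continuous_subtype_val) _), fun x y hxy => hmono hxy,
    fun x => ?_⟩
  change (x.1 = 0 ↔ f x = 0) ∧ (x.1 = i ↔ f x = 1) ∧ (x.1 = j ↔ f x = 2) ∧ (x.1 = N ↔ f x = 3)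
  have hiff : ∀ a c, f a = c → (x.1 = a ↔ f x = c) := fun a c h => by
    rw [← h, hmono.injective.eq_iff]
  exact ⟨hiff _ _ f0, hiff _ _ fi, hiff _ _ fj, hiff _ _ fN⟩

/-- The Möbius map 3x / (x + 2i) sends 0, i and ∞ to 0, 1 and 3. -/
lemma exists_reparam_Ici {i : ℝ} (hi : 0 < i) :
    ∃ β : Set.Ici (0 : ℝ) ≃ₜ Set.Ico (0 : ℝ) 3, (∀ x y, x < y → β x < β y) ∧
      ∀ x, (x.1 = 0 ↔ (β x).1 = 0) ∧ (x.1 = i ↔ (β x).1 = 1) := by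
  have hpos : ∀ x : Set.Ici (0 : ℝ), 0 < x.1 + 2 * i := fun x => by
    have : 0 ≤ x.1 := x.2
    linarith
  have hpos' : ∀ y : Set.Ico (0 : ℝ) 3, 0 < 3 - y.1 := fun y => by linarith [y.2.2]
  refine ⟨⟨⟨fun x => ⟨3 * x.1 / (x.1 + 2 * i), ?_⟩, fun y => ⟨2 * i * y.1 / (3 - y.1), ?_⟩, ?_, ?_⟩,
    ?_, ?_⟩, ?_, ?_⟩
  · have h0 : 0 ≤ x.1 := x.2
    refine ⟨div_nonneg (by linarith) (hpos x).le, ?_⟩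
    rw [div_lt_iff₀ (hpos x)]
    linarith
  · exact div_nonneg (mul_nonneg (by linarith) y.2.1) (hpos' y).le
  · intro x
    apply Subtype.ext
    have := (hpos x).ne'
    have h2 : 3 - 3 * x.1 / (x.1 + 2 * i) = 6 * i / (x.1 + 2 * i) := by
      field_simp
      ring
    simp only [h2]
    field_simp
    ring
  · intro y
    apply Subtype.ext
    have := (hpos' y).ne'
    have h2 : 2 * i * y.1 / (3 - y.1) + 2 * i = 6 * i / (3 - y.1) := by
      field_simp
      ring
    simp only [h2]
    field_simp
    ring
  · refine Continuous.subtype_mk (Continuous.div (by fun_prop) (by fun_prop)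
      fun x => (hpos x).ne') _
  · refine Continuous.subtype_mk (Continuous.div (by fun_prop) (by fun_prop)
      fun x => (hpos' x).ne') _
  · intro x y hxy
    change 3 * x.1 / (x.1 + 2 * i) < 3 * y.1 / (y.1 + 2 * i)
    rw [div_lt_div_iff₀ (hpos x) (hpos y)]
    have : x.1 < y.1 := hxy
    nlinarith [mul_pos hi (sub_pos.2 this)]
  · intro x
    change (x.1 = 0 ↔ 3 * x.1 / (x.1 + 2 * i) = 0) ∧ (x.1 = i ↔ 3 * x.1 / (x.1 + 2 * i) = 1)
    constructor
    · rw [div_eq_zero_iff]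
      simp [(hpos x).ne']
    · rw [div_eq_one_iff_eq (hpos x).ne']
      constructor <;> intro h <;> linarith

lemma exists_reparam_univ :
    ∃ β : (Set.univ : Set ℝ) ≃ₜ Set.Ioo (0 : ℝ) 3, ∀ x y, x < y → β x < β y := by
  have hor : ∀ y : Set.Ioo (-1 : ℝ) 1, (y.1 + 1) * (3 / 2) ∈ Set.Ioo (0 : ℝ) 3 := fun y =>
    ⟨by linarith [y.2.1], by linarith [y.2.2]⟩
  have hor' : ∀ y : Set.Ioo (0 : ℝ) 3, y.1 * (2 / 3) - 1 ∈ Set.Ioo (-1 : ℝ) 1 := fun y =>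
    ⟨by linarith [y.2.1], by linarith [y.2.2]⟩
  let γ : Set.Ioo (-1 : ℝ) 1 ≃ₜ Set.Ioo (0 : ℝ) 3 :=
    { toFun := fun y => ⟨_, hor y⟩
      invFun := fun y => ⟨_, hor' y⟩
      left_inv := fun y => Subtype.ext (by change (y.1 + 1) * (3 / 2) * (2 / 3) - 1 = y.1; ring)
      right_inv := fun y => Subtype.ext (by change (y.1 * (2 / 3) - 1 + 1) * (3 / 2) = y.1; ring)
      continuous_toFun := by fun_prop
      continuous_invFun := by fun_prop }
  refine ⟨((Homeomorph.Set.univ ℝ).trans (orderIsoIooNegOneOne ℝ).toHomeomorph).trans γ,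
    fun x y hxy => ?_⟩
  have h1 : orderIsoIooNegOneOne ℝ x.1 < orderIsoIooNegOneOne ℝ y.1 :=
    (orderIsoIooNegOneOne ℝ).strictMono hxy
  have h2 : (orderIsoIooNegOneOne ℝ x.1).1 < (orderIsoIooNegOneOne ℝ y.1).1 := h1
  change ((orderIsoIooNegOneOne ℝ x.1).1 + 1) * (3 / 2) <
    ((orderIsoIooNegOneOne ℝ y.1).1 + 1) * (3 / 2)
  linarith

open Topology

namespace ArcConnected

/-! ### The unit circle -/

/-- The point of the unit circle at angle `2πt`. -/
noncomputable def circ (t : ℝ) : ℂ := Complex.exp ((2 * Real.pi * t : ℝ) * Complex.I)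

lemma continuous_circ : Continuous circ := by
  unfold circ
  fun_prop

lemma norm_circ (t : ℝ) : ‖circ t‖ = 1 := Complex.norm_exp_ofReal_mul_I _

lemma circ_re (t : ℝ) : (circ t).re = Real.cos (2 * Real.pi * t) := Complex.exp_ofReal_mul_I_re _

lemma circ_zero : circ 0 = 1 := by simp [circ]

lemma circ_one : circ 1 = 1 := by
  simp only [circ, mul_one]
  push_cast
  exact Complex.exp_two_pi_mul_I

lemma circ_half : circ (1 / 2) = -1 := by
  have : (2 * Real.pi * (1 / 2) : ℝ) = Real.pi := by ring
  rw [circ, this, Complex.exp_pi_mul_I]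

lemma circ_eq_iff {s t : ℝ} : circ s = circ t ↔ ∃ n : ℤ, s = t + n := by
  rw [circ, circ, Complex.exp_eq_exp_iff_exists_int]
  refine exists_congr fun n => ?_
  have h1 : ((2 * Real.pi * t : ℝ) : ℂ) * Complex.I + n * (2 * Real.pi * Complex.I) =
      ((2 * Real.pi * (t + n) : ℝ) : ℂ) * Complex.I := by
    push_cast
    ring
  rw [h1, mul_left_inj' Complex.I_ne_zero, Complex.ofReal_inj,
    mul_right_inj' (by positivity : 2 * Real.pi ≠ 0)]

lemma eq_of_circ_eq {s t : ℝ} (hst : s < t) (ht : t ≤ s + 1) (h : circ s = circ t) :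
    t = s + 1 := by
  obtain ⟨n, hn⟩ := circ_eq_iff.1 h
  have h1 : (n : ℝ) < 0 := by linarith
  have h2 : (-1 : ℝ) ≤ n := by linarith
  have h1' : n < 0 := by exact_mod_cast h1
  have h2' : -1 ≤ n := by exact_mod_cast h2
  obtain rfl : n = -1 := by omega
  push_cast at hn
  linarith

lemma circ_inj_Icc {s t : ℝ} (hs : 0 ≤ s) (hst : s < t) (ht : t ≤ 1) :
    circ s = circ t ↔ s = 0 ∧ t = 1 := by
  constructor
  · intro h
    have := eq_of_circ_eq hst (by linarith) h
    constructor <;> linarith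
  · rintro ⟨rfl, rfl⟩
    rw [circ_zero, circ_one]

lemma circ_eq_one {t : ℝ} (h0 : 0 ≤ t) (h1 : t ≤ 1) : circ t = 1 ↔ t = 0 ∨ t = 1 := by
  constructor
  · intro h
    rcases h0.eq_or_lt with rfl | h0
    · exact Or.inl rfl
    · exact Or.inr ((circ_inj_Icc le_rfl h0 h1).1 (circ_zero.trans h.symm)).2
  · rintro (rfl | rfl)
    · exact circ_zero
    · exact circ_one

lemma circ_eq_neg_one {t : ℝ} (h0 : 0 ≤ t) (h1 : t ≤ 1) : circ t = -1 ↔ t = 1 / 2 := by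
  constructor
  · intro h
    rcases lt_trichotomy t (1 / 2) with h2 | h2 | h2
    · have := eq_of_circ_eq h2 (by linarith) (h.trans circ_half.symm)
      linarith
    · exact h2
    · have := eq_of_circ_eq h2 (by linarith) (circ_half.trans h.symm)
      linarith
  · rintro rfl
    exact circ_half

lemma circ_re_le (t : ℝ) : (circ t).re ≤ 1 := by
  rw [circ_re]
  exact Real.cos_le_one _

lemma circ_re_sq_add (t : ℝ) : (circ t).re * (circ t).re + (circ t).im * (circ t).im = 1 := by
  rw [← Complex.normSq_apply, Complex.normSq_eq_norm_sq, norm_circ, one_pow]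

lemma circ_eq_one_of_re {t : ℝ} (h : 1 ≤ (circ t).re) : circ t = 1 := by
  have h1 := circ_re_sq_add t
  have h2 : (circ t).re = 1 := le_antisymm (circ_re_le t) h
  have h3 : (circ t).im = 0 := by
    rw [h2] at h1
    nlinarith
  exact Complex.ext h2 h3

lemma circ_of_im {t : ℝ} (h : (circ t).im = 0) : circ t = 1 ∨ circ t = -1 := by
  have h1 := circ_re_sq_add t
  rw [h, mul_zero, add_zero, mul_self_eq_one_iff] at h1
  rcases h1 with h1 | h1
  · exact Or.inl (Complex.ext h1 h)
  · exact Or.inr (Complex.ext h1 (by simpa using h))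

/-- The upper and lower halves are kept apart because the theta-curve runs through them separately.
Negative arguments are shifted by a full turn. -/
lemma exists_circ_eq {z : ℂ} (hz : ‖z‖ = 1) :
    (∃ t, 0 ≤ t ∧ t ≤ 1 / 2 ∧ circ t = z) ∨ ∃ t, 1 / 2 ≤ t ∧ t ≤ 1 ∧ circ t = z := by
  have hpi := Real.pi_pos
  have harg : Complex.exp (z.arg * Complex.I) = z := by
    have := Complex.norm_mul_exp_arg_mul_I z
    rwa [hz, Complex.ofReal_one, one_mul] at this
  have h1 := Complex.neg_pi_lt_arg z
  have h2 := Complex.arg_le_pi z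
  have hc : circ (z.arg / (2 * Real.pi)) = z := by
    rw [circ, mul_div_cancel₀ _ (by positivity), harg]
  rcases le_or_gt 0 z.arg with h | h
  · left
    refine ⟨z.arg / (2 * Real.pi), by positivity, ?_, hc⟩
    rw [div_le_iff₀ (by positivity)]
    linarith
  · right
    refine ⟨z.arg / (2 * Real.pi) + 1, ?_, ?_, ?_⟩
    · have : -(1 / 2) ≤ z.arg / (2 * Real.pi) := by
        rw [le_div_iff₀ (by positivity)]
        linarith
      linarith
    · have : z.arg / (2 * Real.pi) ≤ 0 := div_nonpos_of_nonpos_of_nonneg h.le (by positivity)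
      linarith
    · exact (circ_eq_iff.2 ⟨1, by push_cast; ring⟩).trans hc

lemma exists_circ_eq' {z : ℂ} (hz : ‖z‖ = 1) : ∃ t, 0 ≤ t ∧ t ≤ 1 ∧ circ t = z := by
  rcases exists_circ_eq hz with ⟨t, h1, h2, h3⟩ | ⟨t, h1, h2, h3⟩
  · exact ⟨t, h1, by linarith, h3⟩
  · exact ⟨t, by linarith, h2, h3⟩

lemma mem_segment_ofReal {a b : ℝ} (hab : a ≤ b) {z : ℂ} :
    z ∈ segment ℝ (a : ℂ) b ↔ ∃ r : ℝ, a ≤ r ∧ r ≤ b ∧ z = r := by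
  have h : segment ℝ (a : ℂ) b = Complex.ofRealCLM '' segment ℝ a b := by
    have := image_segment ℝ (Complex.ofRealCLM.toLinearMap.toAffineMap) a b
    exact this.symm
  rw [h, segment_eq_Icc hab]
  constructor
  · rintro ⟨r, hr, rfl⟩
    exact ⟨r, hr.1, hr.2, rfl⟩
  · rintro ⟨r, h1, h2, rfl⟩
    exact ⟨r, ⟨h1, h2⟩, rfl⟩

lemma mem_sphere_ofReal {c : ℝ} {z : ℂ} : z ∈ Metric.sphere (c : ℂ) 1 ↔ ‖z - c‖ = 1 := by
  rw [mem_sphere_iff_norm]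

/-! ### Parametrizations of the models -/

/-- On the compact interval [0, 3] a continuous map into the plane is closed. It stays closed on D,
which is the full preimage of the complement of S, and a continuous closed surjection is a quotient
map. -/
lemma isGlued_of_param {g : ℝ → ℂ} {C S Y : Set ℂ} {D : Set ℝ} {Q : ℝ → ℝ → Prop}
    (hc : Continuous g) (him : g '' Set.Icc 0 3 = C)
    (hQ : ∀ x y, 0 ≤ x → x < y → y ≤ 3 → (g x = g y ↔ Q x y)) (hY : Y = C \ S)
    (hD : ∀ x, x ∈ D ↔ x ∈ Set.Icc 0 3 ∧ g x ∉ S) : IsGlued D Q Y := by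
  subst hY him
  have hmaps : ∀ x : D, g x ∈ g '' Set.Icc 0 3 \ S := fun x =>
    ⟨⟨x, ((hD x).1 x.2).1, rfl⟩, ((hD x).1 x.2).2⟩
  set f : D → (g '' Set.Icc 0 3 \ S : Set ℂ) := fun x => ⟨g x, hmaps x⟩ with hf
  have hfc : Continuous f := Continuous.subtype_mk (hc.comp continuous_subtype_val) _
  refine ⟨f, IsClosedMap.isQuotientMap ?_ hfc ?_, fun x y hxy => ?_⟩
  · intro K hK
    obtain ⟨K', hK', rfl⟩ := isClosed_induced_iff.1 hK
    have hcl : IsClosed (g '' (K' ∩ Set.Icc 0 3)) :=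
      ((isCompact_Icc.inter_left hK').image hc).isClosed
    refine isClosed_induced_iff.2 ⟨_, hcl, ?_⟩
    ext ⟨z, hz⟩
    constructor
    · rintro ⟨x, ⟨hx, hx3⟩, rfl⟩
      exact ⟨⟨x, (hD x).2 ⟨hx3, hz.2⟩⟩, hx, rfl⟩
    · rintro ⟨x, hx, hxz⟩
      exact ⟨x, ⟨hx, ((hD x).1 x.2).1⟩, congrArg Subtype.val hxz⟩
  · rintro ⟨z, ⟨x, hx, rfl⟩, hz⟩
    exact ⟨⟨x, (hD x).2 ⟨hx, hz⟩⟩, rfl⟩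
  · rw [← hQ x y ((hD x).1 x.2).1.1 hxy ((hD y).1 y.2).1.2]
    exact Subtype.ext_iff

lemma image_arc (g : ℝ → ℂ) (hg : (∀ t, g t = (t / 3 : ℝ)) ∨ ∀ t, g t = (1 - t / 3 : ℝ)) :
    g '' Set.Icc 0 3 = FiniteModel.arc.carrier := by
  ext z
  have hm := mem_segment_ofReal (zero_le_one (α := ℝ)) (z := z)
  rw [Complex.ofReal_zero, Complex.ofReal_one] at hm
  change z ∈ g '' Set.Icc 0 3 ↔ z ∈ segment ℝ 0 1
  rw [hm]
  rcases hg with hg | hg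
  · constructor
    · rintro ⟨t, ⟨h0, h1⟩, rfl⟩
      exact ⟨t / 3, by linarith, by linarith, hg t⟩
    · rintro ⟨r, h0, h1, rfl⟩
      exact ⟨3 * r, ⟨by linarith, by linarith⟩, by rw [hg]; congr 1; ring⟩
  · constructor
    · rintro ⟨t, ⟨h0, h1⟩, rfl⟩
      exact ⟨1 - t / 3, by linarith, by linarith, hg t⟩
    · rintro ⟨r, h0, h1, rfl⟩
      exact ⟨3 * (1 - r), ⟨by linarith, by linarith⟩, by rw [hg]; congr 1; ring⟩

lemma isGlued_arc {S Y : Set ℂ} {D : Set ℝ} (hY : Y = FiniteModel.arc.carrier \ S)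
    (hD : ∀ x : ℝ, x ∈ D ↔ x ∈ Set.Icc (0 : ℝ) 3 ∧ ((x / 3 : ℝ) : ℂ) ∉ S) :
    IsGlued D (fun _ _ => False) Y := by
  refine isGlued_of_param (g := fun t => ((t / 3 : ℝ) : ℂ)) (by fun_prop)
    (image_arc _ (Or.inl fun _ => rfl)) (fun x y _ hxy _ => iff_of_false (fun h => ?_) not_false)
    hY hD
  have : x / 3 = y / 3 := Complex.ofReal_injective h
  linarith

/-- Running through the segment backwards makes the removal of 0, too, lead to the half-open
interval [0, 3). -/
lemma isGlued_arc' {S Y : Set ℂ} {D : Set ℝ} (hY : Y = FiniteModel.arc.carrier \ S)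
    (hD : ∀ x : ℝ, x ∈ D ↔ x ∈ Set.Icc (0 : ℝ) 3 ∧ ((1 - x / 3 : ℝ) : ℂ) ∉ S) :
    IsGlued D (fun _ _ => False) Y := by
  refine isGlued_of_param (g := fun t => ((1 - t / 3 : ℝ) : ℂ)) (by fun_prop)
    (image_arc _ (Or.inr fun _ => rfl)) (fun x y _ hxy _ => iff_of_false (fun h => ?_) not_false)
    hY hD
  have : 1 - x / 3 = 1 - y / 3 := Complex.ofReal_injective h
  linarith

lemma isGlued_circle {Y : Set ℂ} (hY : Y = FiniteModel.circle.carrier) :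
    IsGlued (Set.Icc 0 3) (fun x y => x = 0 ∧ y = 3) Y := by
  refine isGlued_of_param (g := fun t => circ (t / 3)) (C := FiniteModel.circle.carrier) (S := ∅)
    (continuous_circ.comp (by fun_prop)) ?_ (fun x y h0 hxy h3 => ?_) (by simpa using hY) (by simp)
  · ext z
    have hm := mem_sphere_ofReal (c := 0) (z := z)
    rw [Complex.ofReal_zero, sub_zero] at hm
    change z ∈ _ ↔ z ∈ Metric.sphere 0 1
    rw [hm]
    constructor
    · rintro ⟨t, -, rfl⟩
      exact norm_circ _
    · intro hz
      obtain ⟨t, h0, h1, rfl⟩ := exists_circ_eq' hz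
      exact ⟨3 * t, ⟨by linarith, by linarith⟩, by dsimp only; congr 1; ring⟩
  · rw [circ_inj_Icc (by linarith) (by linarith) (by linarith)]
    constructor <;> rintro ⟨h1, h2⟩ <;> constructor <;> linarith

/-- The circle followed by the segment. -/
noncomputable def lollipopPath (t : ℝ) : ℂ := if t ≤ 1 then circ t else (1 + (t - 1) / 2 : ℝ)

lemma lollipopPath_eq_two {t : ℝ} : lollipopPath t = 2 ↔ t = 3 := by
  unfold lollipopPath
  split_ifs with h
  · constructor
    · intro h2
      have := norm_circ t
      rw [h2] at this
      norm_num at this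
    · intro h2
      linarith
  · rw [show (2 : ℂ) = ((2 : ℝ) : ℂ) by norm_num, Complex.ofReal_inj]
    constructor <;> intro h <;> linarith

lemma isGlued_lollipop {S Y : Set ℂ} {D : Set ℝ} (hY : Y = FiniteModel.lollipop.carrier \ S)
    (hD : ∀ x, x ∈ D ↔ x ∈ Set.Icc (0 : ℝ) 3 ∧ lollipopPath x ∉ S) :
    IsGlued D (fun x y => x = 0 ∧ y = 1) Y := by
  refine isGlued_of_param (C := FiniteModel.lollipop.carrier) ?_ ?_ (fun x y h0 hxy h3 => ?_) hY hD
  · refine continuous_circ.if_le (by fun_prop) continuous_id continuous_const ?_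
    rintro x rfl
    simp [circ_one]
  · ext z
    have hm := mem_sphere_ofReal (c := 0) (z := z)
    rw [Complex.ofReal_zero, sub_zero] at hm
    have hm2 := mem_segment_ofReal (one_le_two (α := ℝ)) (z := z)
    rw [Complex.ofReal_one, Complex.ofReal_ofNat] at hm2
    change z ∈ _ ↔ z ∈ Metric.sphere 0 1 ∨ z ∈ segment ℝ 1 2
    rw [hm, hm2]
    constructor
    · rintro ⟨t, ht, rfl⟩
      unfold lollipopPath
      split_ifs with h
      · exact Or.inl (norm_circ t)
      · exact Or.inr ⟨_, by linarith, by linarith [ht.2], rfl⟩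
    · rintro (h | ⟨r, h1, h2, rfl⟩)
      · obtain ⟨t, h0, h1, rfl⟩ := exists_circ_eq' h
        exact ⟨t, ⟨h0, by linarith⟩, if_pos h1⟩
      · rcases h1.eq_or_lt with rfl | h1
        · exact ⟨1, by norm_num, by simp [lollipopPath, circ_one]⟩
        · refine ⟨2 * r - 1, ⟨by linarith, by linarith⟩, ?_⟩
          rw [lollipopPath, if_neg (by linarith)]
          congr 1
          ring
  · unfold lollipopPath
    rcases le_or_gt y 1 with hy | hy
    · rw [if_pos (hxy.le.trans hy), if_pos hy, circ_inj_Icc h0 hxy hy]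
    · rw [if_neg hy.not_ge]
      refine iff_of_false ?_ (by rintro ⟨-, h⟩; linarith)
      split_ifs with h
      · intro he
        have := norm_circ x
        rw [he, Complex.norm_real, Real.norm_eq_abs, abs_of_nonneg (by linarith)] at this
        linarith
      · rw [Complex.ofReal_inj]
        intro he
        linarith

lemma isGlued_figureEight {Y : Set ℂ} (hY : Y = FiniteModel.figureEight.carrier) :
    IsGlued (Set.Icc 0 3)
      (fun x y => (x = 0 ∧ y = 1) ∨ (x = 0 ∧ y = 3) ∨ (x = 1 ∧ y = 3)) Y := by
  refine isGlued_of_param (C := FiniteModel.figureEight.carrier) (S := ∅)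
    -- Both loops start and end at the origin, where the two circles touch.
    (g := fun t => if t ≤ 1 then -1 + circ t else 1 - circ ((t - 1) / 2)) ?_ ?_
    (fun x y h0 hxy h3 => ?_) (by simpa using hY) (by simp)
  · refine (continuous_const.add continuous_circ).if_le
      (continuous_const.sub (continuous_circ.comp (by fun_prop))) continuous_id continuous_const ?_
    rintro x rfl
    simp [circ_one, circ_zero]
  · ext z
    have hm := mem_sphere_ofReal (c := -1) (z := z)
    have hm2 := mem_sphere_ofReal (c := 1) (z := z)
    push_cast at hm hm2
    change z ∈ _ ↔ z ∈ Metric.sphere (-1) 1 ∨ z ∈ Metric.sphere 1 1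
    rw [hm, hm2]
    constructor
    · rintro ⟨t, ht, rfl⟩
      dsimp only
      split_ifs with h
      · left
        rw [sub_neg_eq_add, neg_add_cancel_comm, norm_circ]
      · right
        rw [sub_sub_cancel_left, norm_neg, norm_circ]
    · rintro (h | h)
      · obtain ⟨t, h0, h1, ht⟩ := exists_circ_eq' h
        refine ⟨t, ⟨h0, by linarith⟩, ?_⟩
        dsimp only
        rw [if_pos h1, ht]
        ring
      · rw [← norm_neg] at h
        obtain ⟨t, h0, h1, ht⟩ := exists_circ_eq' h
        rcases h0.eq_or_lt with rfl | h0
        · refine ⟨1, by norm_num, ?_⟩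
          dsimp only
          rw [circ_zero] at ht
          rw [if_pos le_rfl, circ_one, ht]
          linear_combination -ht
        · refine ⟨2 * t + 1, ⟨by linarith, by linarith⟩, ?_⟩
          dsimp only
          rw [if_neg (by linarith), show (2 * t + 1 - 1) / 2 = t by ring, ht]
          ring
  · rcases le_or_gt y 1 with hy | hy
    · rw [if_pos (hxy.le.trans hy), if_pos hy, add_right_inj, circ_inj_Icc h0 hxy hy]
      constructor
      · exact Or.inl
      · rintro (h | h | h)
        · exact h
        all_goals linarith [h.2]
    · rw [if_neg hy.not_ge]
      split_ifs with h
      · have hx1 := circ_eq_one h0 h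
        have hy1 := circ_eq_one (t := (y - 1) / 2) (by linarith) (by linarith)
        constructor
        -- The left circle has real parts at most 0 and the right one at least 0, so a common value
        -- forces `circ` to be 1 on both sides.
        · intro he
          have hre := congrArg Complex.re he
          simp only [Complex.add_re, Complex.neg_re, Complex.one_re, Complex.sub_re] at hre
          have a := circ_re_le x
          have b := circ_re_le ((y - 1) / 2)
          have c := hx1.1 (circ_eq_one_of_re (by linarith))
          have d := hy1.1 (circ_eq_one_of_re (by linarith))
          rcases d with d | d
          · linarith
          · have : y = 3 := by linarith
            rcases c with c | c
            · exact Or.inr (Or.inl ⟨c, this⟩)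
            · exact Or.inr (Or.inr ⟨c, this⟩)
        · rintro (⟨h1, h2⟩ | ⟨h1, h2⟩ | ⟨h1, h2⟩)
          · linarith
          · rw [hx1.2 (Or.inl h1), hy1.2 (Or.inr (by linarith))]
            ring
          · rw [hx1.2 (Or.inr h1), hy1.2 (Or.inr (by linarith))]
            ring
      · rw [sub_right_inj, circ_inj_Icc (by linarith) (by linarith) (by linarith)]
        constructor
        · rintro ⟨h1, h2⟩
          linarith
        · rintro (⟨h1, h2⟩ | ⟨h1, h2⟩ | ⟨h1, h2⟩) <;> linarith

lemma isGlued_dumbbell {Y : Set ℂ} (hY : Y = FiniteModel.dumbbell.carrier) :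
    IsGlued (Set.Icc 0 3) (fun x y => (x = 0 ∧ y = 1) ∨ (x = 2 ∧ y = 3)) Y := by
  refine isGlued_of_param (C := FiniteModel.dumbbell.carrier) (S := ∅)
    -- The path runs around the left circle from -1, along the segment to 1, and around the right
    -- circle.
    (g := fun t => if t ≤ 1 then -2 + circ t else
      if t ≤ 2 then ((2 * t - 3 : ℝ) : ℂ) else 2 - circ (t - 2)) ?_ ?_
    (fun x y h0 hxy h3 => ?_) (by simpa using hY) (by simp)
  · refine (continuous_const.add continuous_circ).if_le (Continuous.if_le (by fun_prop)
      (continuous_const.sub (continuous_circ.comp (by fun_prop))) continuous_id continuous_const ?_)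
      continuous_id continuous_const ?_
    · rintro x rfl
      rw [sub_self, circ_zero]
      norm_num
    · rintro x rfl
      rw [if_pos (by norm_num)]
      change -2 + circ 1 = _
      rw [circ_one]
      norm_num
  · ext z
    have hm := mem_sphere_ofReal (c := -2) (z := z)
    have hm2 := mem_sphere_ofReal (c := 2) (z := z)
    have hm3 := mem_segment_ofReal (show (-1 : ℝ) ≤ 1 by norm_num) (z := z)
    push_cast at hm hm2 hm3
    change z ∈ _ ↔ (z ∈ Metric.sphere (-2) 1 ∨ z ∈ segment ℝ (-1) 1) ∨ z ∈ Metric.sphere 2 1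
    rw [hm, hm2, hm3]
    constructor
    · rintro ⟨t, ht, rfl⟩
      dsimp only
      split_ifs with h h2
      · left
        left
        rw [sub_neg_eq_add, neg_add_cancel_comm, norm_circ]
      · left
        right
        exact ⟨_, by linarith, by linarith, rfl⟩
      · right
        rw [sub_sub_cancel_left, norm_neg, norm_circ]
    · rintro ((h | ⟨r, h1, h2, rfl⟩) | h)
      · obtain ⟨t, h0, h1, ht⟩ := exists_circ_eq' h
        refine ⟨t, ⟨h0, by linarith⟩, ?_⟩
        dsimp only
        rw [if_pos h1, ht]
        ring
      · rcases h1.eq_or_lt with rfl | h1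
        · refine ⟨1, by norm_num, ?_⟩
          dsimp only
          rw [if_pos le_rfl, circ_one]
          norm_num
        · refine ⟨(r + 3) / 2, ⟨by linarith, by linarith⟩, ?_⟩
          dsimp only
          rw [if_neg (by linarith), if_pos (by linarith)]
          congr 1
          ring
      · rw [← norm_neg] at h
        obtain ⟨t, h0, h1, ht⟩ := exists_circ_eq' h
        rcases h0.eq_or_lt with rfl | h0
        · refine ⟨2, by norm_num, ?_⟩
          dsimp only
          rw [circ_zero] at ht
          rw [if_neg (by norm_num), if_pos le_rfl]
          push_cast
          linear_combination -ht
        · refine ⟨t + 2, ⟨by linarith, by linarith⟩, ?_⟩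
          dsimp only
          rw [if_neg (by linarith), if_neg (by linarith), add_sub_cancel_right, ht]
          ring
  · have re1 := circ_re_le x
    have re2 := circ_re_le (y - 2)
    rcases le_or_gt y 1 with hy | hy
    · rw [if_pos (hxy.le.trans hy), if_pos hy, add_right_inj, circ_inj_Icc h0 hxy hy]
      constructor
      · exact Or.inl
      · rintro (h | h)
        · exact h
        · linarith [h.2]
    rw [if_neg hy.not_ge]
    rcases le_or_gt y 2 with hy2 | hy2
    · rw [if_pos hy2]
      refine iff_of_false (fun he => ?_) (by rintro (⟨h1, h2⟩ | ⟨h1, h2⟩) <;> linarith)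
      have hre := congrArg Complex.re he
      split_ifs at hre with h h2
      · simp at hre
        linarith
      · simp at hre
        linarith
      · linarith
    rw [if_neg hy2.not_ge]
    split_ifs with h h2
    · refine iff_of_false (fun he => ?_) (by rintro (⟨h1, h2⟩ | ⟨h1, h2⟩) <;> linarith)
      have hre := congrArg Complex.re he
      simp at hre
      linarith
    · constructor
      · intro he
        have hre := congrArg Complex.re he
        simp only [Complex.ofReal_re, Complex.sub_re, Complex.re_ofNat] at hre
        rcases (circ_eq_one (by linarith) (by linarith)).1 (circ_eq_one_of_re (t := y - 2)
          (by linarith)) with h4 | h4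
        · linarith
        · refine Or.inr ⟨?_, by linarith⟩
          rw [h4, circ_one, Complex.one_re] at hre
          linarith
      · rintro (⟨h4, h5⟩ | ⟨rfl, rfl⟩)
        · linarith
        · rw [show (3 : ℝ) - 2 = 1 by norm_num, circ_one]
          norm_num
    · rw [sub_right_inj, circ_inj_Icc (by linarith) (by linarith) (by linarith)]
      constructor
      · rintro ⟨h4, h5⟩
        linarith
      · rintro (⟨h4, h5⟩ | ⟨h4, h5⟩) <;> linarith

lemma isGlued_theta {Y : Set ℂ} (hY : Y = FiniteModel.theta.carrier) :
    IsGlued (Set.Icc 0 3) (fun x y => (x = 0 ∧ y = 2) ∨ (x = 1 ∧ y = 3)) Y := by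
  refine isGlued_of_param (C := FiniteModel.theta.carrier) (S := ∅)
    -- The upper half circle from -1 to 1, the diameter back to -1, and the lower half circle to 1:
    -- the times 0 and 2 meet at -1, the times 1 and 3 at 1.
    (g := fun t => if t ≤ 1 then circ ((1 - t) / 2) else
      if t ≤ 2 then ((3 - 2 * t : ℝ) : ℂ) else circ ((t - 1) / 2)) ?_ ?_
    (fun x y h0 hxy h3 => ?_) (by simpa using hY) (by simp)
  · refine Continuous.if_le (continuous_circ.comp (by fun_prop)) (Continuous.if_le (by fun_prop)
      (continuous_circ.comp (by fun_prop)) continuous_id continuous_const ?_)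
      continuous_id continuous_const ?_
    · rintro x rfl
      rw [show ((2 : ℝ) - 1) / 2 = 1 / 2 by norm_num, circ_half]
      norm_num
    · rintro x rfl
      rw [if_pos (by norm_num), show ((1 : ℝ) - 1) / 2 = 0 by norm_num, circ_zero]
      norm_num
  · ext z
    have hm := mem_sphere_ofReal (c := 0) (z := z)
    rw [Complex.ofReal_zero, sub_zero] at hm
    have hm3 := mem_segment_ofReal (show (-1 : ℝ) ≤ 1 by norm_num) (z := z)
    push_cast at hm3
    change z ∈ _ ↔ z ∈ Metric.sphere 0 1 ∨ z ∈ segment ℝ (-1) 1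
    rw [hm, hm3]
    constructor
    · rintro ⟨t, ht, rfl⟩
      dsimp only
      split_ifs with h h2
      · exact Or.inl (norm_circ _)
      · exact Or.inr ⟨_, by linarith, by linarith, rfl⟩
      · exact Or.inl (norm_circ _)
    · rintro (h | ⟨r, h1, h2, rfl⟩)
      · rcases exists_circ_eq h with ⟨t, h1, h2, rfl⟩ | ⟨t, h1, h2, rfl⟩
        · refine ⟨1 - 2 * t, ⟨by linarith, by linarith⟩, ?_⟩
          dsimp only
          rw [if_pos (by linarith)]
          congr 1
          ring
        · rcases h1.eq_or_lt with rfl | h1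
          · refine ⟨0, by norm_num, ?_⟩
            dsimp only
            rw [if_pos (by norm_num)]
            congr 1
            ring
          · refine ⟨2 * t + 1, ⟨by linarith, by linarith⟩, ?_⟩
            dsimp only
            rw [if_neg (by linarith), if_neg (by linarith)]
            congr 1
            ring
      · rcases h2.eq_or_lt with rfl | h2
        · refine ⟨1, by norm_num, ?_⟩
          dsimp only
          rw [if_pos le_rfl, show ((1 : ℝ) - 1) / 2 = 0 by norm_num, circ_zero]
          norm_num
        · refine ⟨(3 - r) / 2, ⟨by linarith, by linarith⟩, ?_⟩
          dsimp only
          rw [if_neg (by linarith), if_pos (by linarith)]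
          congr 1
          ring
  -- The circle meets the diameter only at its ends 1 and -1.
  · have real_eq : ∀ t r : ℝ, 0 ≤ t → t ≤ 1 → circ t = (r : ℂ) →
        (r = 1 ∧ (t = 0 ∨ t = 1)) ∨ (r = -1 ∧ t = 1 / 2) := by
      intro t r ht0 ht1 h
      rcases circ_of_im (t := t) (by rw [h, Complex.ofReal_im]) with h1 | h1
      · left
        refine ⟨?_, (circ_eq_one ht0 ht1).1 h1⟩
        rw [h1] at h
        exact_mod_cast h.symm
      · right
        refine ⟨?_, (circ_eq_neg_one ht0 ht1).1 h1⟩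
        rw [h1] at h
        exact_mod_cast h.symm
    rcases le_or_gt y 1 with hy | hy
    · rw [if_pos (hxy.le.trans hy), if_pos hy, eq_comm,
        circ_inj_Icc (by linarith) (by linarith) (by linarith)]
      constructor
      · rintro ⟨h4, h5⟩
        linarith
      · rintro (⟨h4, h5⟩ | ⟨h4, h5⟩) <;> linarith
    rw [if_neg hy.not_ge]
    rcases le_or_gt y 2 with hy2 | hy2
    · rw [if_pos hy2]
      split_ifs with h h2
      · constructor
        · intro he
          rcases real_eq _ _ (by linarith) (by linarith) he with ⟨h4, h5⟩ | ⟨h4, h5⟩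
          · linarith
          · exact Or.inl ⟨by linarith, by linarith⟩
        · rintro (⟨rfl, rfl⟩ | ⟨h4, h5⟩)
          · rw [sub_zero, circ_half]
            norm_num
          · linarith
      · rw [Complex.ofReal_inj]
        refine iff_of_false (fun he => ?_) ?_
        · linarith
        · rintro (⟨h1, h2⟩ | ⟨h1, h2⟩) <;> linarith
      · linarith
    rw [if_neg hy2.not_ge]
    split_ifs with h h2
    · constructor
      · intro he
        have := eq_of_circ_eq (by linarith) (by linarith) he
        exact Or.inr ⟨by linarith, by linarith⟩
      · rintro (⟨h4, h5⟩ | ⟨rfl, rfl⟩)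
        · linarith
        · rw [show ((1 : ℝ) - 1) / 2 = 0 by norm_num, show ((3 : ℝ) - 1) / 2 = 1 by norm_num,
            circ_zero, circ_one]
    · refine iff_of_false (fun he => ?_) (by rintro (⟨h1, h2⟩ | ⟨h1, h2⟩) <;> linarith)
      rcases real_eq _ _ (by linarith) (by linarith) he.symm with ⟨h4, h5⟩ | ⟨h4, h5⟩
      · linarith
      · linarith
    · rw [circ_inj_Icc (by linarith) (by linarith) (by linarith)]
      constructor
      · rintro ⟨h4, h5⟩
        linarith
      · rintro (⟨h4, h5⟩ | ⟨h4, h5⟩) <;> linarith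

end ArcConnected

open Topology

namespace ArcConnected

/-! ### The nine shapes -/

/-- The nine spaces: the six finite graphs, the arc without one end, the arc without both ends, and
the lollipop without its end. -/
noncomputable def shapeModel : Fin 9 → Set ℂ :=
  ![FiniteModel.arc.carrier, FiniteModel.circle.carrier, FiniteModel.lollipop.carrier,
    FiniteModel.theta.carrier, FiniteModel.figureEight.carrier, FiniteModel.dumbbell.carrier,
    FiniteModel.arc.carrier \ {1}, FiniteModel.arc.carrier \ {0, 1},
    FiniteModel.lollipop.carrier \ {2}]

/-- The intervals from which the nine spaces are obtained. -/
noncomputable def shapeDomain : Fin 9 → Set ℝ :=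
  ![Set.Icc 0 3, Set.Icc 0 3, Set.Icc 0 3, Set.Icc 0 3, Set.Icc 0 3, Set.Icc 0 3,
    Set.Ico 0 3, Set.Ioo 0 3, Set.Ico 0 3]

/-- The identifications by which the nine spaces are obtained. -/
def shapeRel : Fin 9 → ℝ → ℝ → Prop :=
  ![fun _ _ => False, fun x y => x = 0 ∧ y = 3, fun x y => x = 0 ∧ y = 1,
    fun x y => (x = 0 ∧ y = 2) ∨ (x = 1 ∧ y = 3),
    fun x y => (x = 0 ∧ y = 1) ∨ (x = 0 ∧ y = 3) ∨ (x = 1 ∧ y = 3),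
    fun x y => (x = 0 ∧ y = 1) ∨ (x = 2 ∧ y = 3),
    fun _ _ => False, fun _ _ => False, fun x y => x = 0 ∧ y = 1]

/-- `X` has the `k`-th shape. -/
def HasShape (k : Fin 9) (X : Type*) [TopologicalSpace X] : Prop :=
  IsGlued (shapeDomain k) (shapeRel k) X

lemma isModelSpace_shapeModel (k : Fin 9) : IsModelSpace (shapeModel k) := by
  have h0 : ∀ M : FiniteModel, IsModelSpace M.carrier := fun M =>
    ⟨M, ∅, Set.empty_subset _, by simp⟩
  match k with
  | 0 => exact h0 .arc
  | 1 => exact h0 .circle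
  | 2 => exact h0 .lollipop
  | 3 => exact h0 .theta
  | 4 => exact h0 .figureEight
  | 5 => exact h0 .dumbbell
  | 6 => exact ⟨.arc, {1}, by simp [FiniteModel.endpoints], rfl⟩
  | 7 => exact ⟨.arc, {0, 1}, by simp [FiniteModel.endpoints], rfl⟩
  | 8 => exact ⟨.lollipop, {2}, by simp [FiniteModel.endpoints], rfl⟩

lemma ofReal_eq_zero_iff_div {x : ℝ} : ((x / 3 : ℝ) : ℂ) = 0 ↔ x = 0 := by
  rw [Complex.ofReal_eq_zero]
  constructor <;> intro h <;> linarith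

lemma ofReal_eq_one_iff_div {x : ℝ} : ((x / 3 : ℝ) : ℂ) = 1 ↔ x = 3 := by
  rw [Complex.ofReal_eq_one]
  constructor <;> intro h <;> linarith

lemma ofReal_eq_zero_iff_sub {x : ℝ} : ((1 - x / 3 : ℝ) : ℂ) = 0 ↔ x = 3 := by
  rw [Complex.ofReal_eq_zero]
  constructor <;> intro h <;> linarith

lemma hasShape_shapeModel (k : Fin 9) : HasShape k (shapeModel k) := by
  match k with
  | 0 => exact isGlued_arc (S := ∅) (Set.sdiff_empty.symm) (by simp [shapeDomain])
  | 1 => exact isGlued_circle rfl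
  | 2 => exact isGlued_lollipop (S := ∅) (Set.sdiff_empty.symm) (by simp [shapeDomain])
  | 3 => exact isGlued_theta rfl
  | 4 => exact isGlued_figureEight rfl
  | 5 => exact isGlued_dumbbell rfl
  | 6 =>
    refine isGlued_arc (S := {1}) rfl fun x => ?_
    change x ∈ Set.Ico (0 : ℝ) 3 ↔ _
    rw [Set.mem_singleton_iff, ofReal_eq_one_iff_div, Set.mem_Ico, Set.mem_Icc, and_assoc,
      lt_iff_le_and_ne]
  | 7 =>
    refine isGlued_arc (S := {0, 1}) rfl fun x => ?_
    change x ∈ Set.Ioo (0 : ℝ) 3 ↔ _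
    rw [Set.mem_insert_iff, Set.mem_singleton_iff, ofReal_eq_one_iff_div, ofReal_eq_zero_iff_div,
      Set.mem_Ioo, Set.mem_Icc, lt_iff_le_and_ne, lt_iff_le_and_ne]
    tauto
  | 8 =>
    refine isGlued_lollipop (S := {2}) rfl fun x => ?_
    change x ∈ Set.Ico (0 : ℝ) 3 ↔ _
    rw [Set.mem_singleton_iff, lollipopPath_eq_two, Set.mem_Ico, Set.mem_Icc, and_assoc,
      lt_iff_le_and_ne]

lemma IsModelSpace.exists_hasShape {Y : Set ℂ} (hY : IsModelSpace Y) : ∃ k, HasShape k Y := by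
  obtain ⟨M, S, hS, rfl⟩ := hY
  have hempty : ∀ M : FiniteModel, ∀ k, M.carrier = shapeModel k → S ⊆ ∅ →
      ∃ k, HasShape k (M.carrier \ S : Set ℂ) := by
    intro M k hk h
    rw [Set.subset_empty_iff.1 h, Set.sdiff_empty, hk]
    exact ⟨k, hasShape_shapeModel k⟩
  cases M with
  | arc =>
    change S ⊆ {0, 1} at hS
    rcases Set.subset_pair_iff_eq.1 hS with rfl | rfl | rfl | rfl
    · exact hempty .arc 0 rfl subset_rfl
    · refine ⟨6, isGlued_arc' (S := {0}) rfl fun x => ?_⟩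
      change x ∈ Set.Ico (0 : ℝ) 3 ↔ _
      rw [Set.mem_singleton_iff, ofReal_eq_zero_iff_sub, Set.mem_Ico, Set.mem_Icc, and_assoc,
        lt_iff_le_and_ne]
    · exact ⟨6, hasShape_shapeModel 6⟩
    · exact ⟨7, hasShape_shapeModel 7⟩
  | circle => exact hempty .circle 1 rfl hS
  | lollipop =>
    change S ⊆ {2} at hS
    rcases Set.subset_singleton_iff_eq.1 hS with rfl | rfl
    · exact hempty .lollipop 2 rfl subset_rfl
    · exact ⟨8, hasShape_shapeModel 8⟩
  | theta => exact hempty .theta 3 rfl hS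
  | figureEight => exact hempty .figureEight 4 rfl hS
  | dumbbell => exact hempty .dumbbell 5 rfl hS

/-- In each case J is the domain without those of the ends 0 and 3 that are glued to a point still
kept. In the figure-eight, where 0, 1 and 3 are one point, the representative kept is 1. -/
lemma HasShape.isOmegaAC {k : Fin 9} {X : Type*} [TopologicalSpace X] [T2Space X]
    (h : HasShape k X) : IsOmegaAC X := by
  have nt : ∀ J : Set ℝ, (1 : ℝ) ∈ J → (2 : ℝ) ∈ J → J.Nontrivial := fun J h1 h2 =>
    ⟨1, h1, 2, h2, by norm_num⟩
  match k, h with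
  | 0, h => exact IsGlued.isOmegaAC (J := Set.Icc 0 3) h subset_rfl Set.ordConnected_Icc (nt _ (by norm_num)
      (by norm_num)) (fun _ _ _ _ _ h => h) fun x h1 h2 => absurd h1 h2
  | 6, h => exact IsGlued.isOmegaAC (J := Set.Ico 0 3) h subset_rfl Set.ordConnected_Ico (nt _ (by norm_num)
      (by norm_num)) (fun _ _ _ _ _ h => h) fun x h1 h2 => absurd h1 h2
  | 7, h => exact IsGlued.isOmegaAC (J := Set.Ioo 0 3) h subset_rfl Set.ordConnected_Ioo (nt _ (by norm_num)
      (by norm_num)) (fun _ _ _ _ _ h => h) fun x h1 h2 => absurd h1 h2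
  | 1, h =>
    refine IsGlued.isOmegaAC h Set.Ico_subset_Icc_self Set.ordConnected_Ico (nt _ (by norm_num)
      (by norm_num)) ?_ ?_
    · rintro x hx y hy - ⟨-, rfl⟩
      exact absurd hy.2 (lt_irrefl _)
    · rintro x ⟨h1, h2⟩ hn
      obtain rfl : x = 3 := le_antisymm h2 (not_lt.1 fun h => hn ⟨h1, h⟩)
      exact ⟨0, by norm_num, Or.inr ⟨by norm_num, rfl, rfl⟩⟩
  | 2, h =>
    refine IsGlued.isOmegaAC h Set.Ioc_subset_Icc_self Set.ordConnected_Ioc (nt _ (by norm_num)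
      (by norm_num)) ?_ ?_
    · rintro x hx y hy - ⟨rfl, -⟩
      exact absurd hx.1 (lt_irrefl _)
    · rintro x ⟨h1, h2⟩ hn
      obtain rfl : x = 0 := le_antisymm (not_lt.1 fun h => hn ⟨h, h2⟩) h1
      exact ⟨1, by norm_num, Or.inl ⟨by norm_num, rfl, rfl⟩⟩
  | 8, h =>
    refine IsGlued.isOmegaAC h Set.Ioo_subset_Ico_self Set.ordConnected_Ioo (nt _ (by norm_num)
      (by norm_num)) ?_ ?_
    · rintro x hx y hy - ⟨rfl, -⟩
      exact absurd hx.1 (lt_irrefl _)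
    · rintro x ⟨h1, h2⟩ hn
      obtain rfl : x = 0 := le_antisymm (not_lt.1 fun h => hn ⟨h, h2⟩) h1
      exact ⟨1, by norm_num, Or.inl ⟨by norm_num, rfl, rfl⟩⟩
  | 3, h =>
    refine IsGlued.isOmegaAC h Set.Ioo_subset_Icc_self Set.ordConnected_Ioo (nt _ (by norm_num)
      (by norm_num)) ?_ ?_
    · rintro x hx y hy - (⟨rfl, -⟩ | ⟨-, rfl⟩)
      · exact absurd hx.1 (lt_irrefl _)
      · exact absurd hy.2 (lt_irrefl _)
    · rintro x ⟨h1, h2⟩ hn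
      rcases h1.eq_or_lt with rfl | h1
      · exact ⟨2, by norm_num, Or.inl ⟨by norm_num, Or.inl ⟨rfl, rfl⟩⟩⟩
      · obtain rfl : x = 3 := le_antisymm h2 (not_lt.1 fun h => hn ⟨h1, h⟩)
        exact ⟨1, by norm_num, Or.inr ⟨by norm_num, Or.inr ⟨rfl, rfl⟩⟩⟩
  | 4, h =>
    refine IsGlued.isOmegaAC h Set.Ioo_subset_Icc_self Set.ordConnected_Ioo (nt _ (by norm_num)
      (by norm_num)) ?_ ?_
    · rintro x hx y hy - (⟨rfl, -⟩ | ⟨rfl, -⟩ | ⟨-, rfl⟩)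
      · exact absurd hx.1 (lt_irrefl _)
      · exact absurd hx.1 (lt_irrefl _)
      · exact absurd hy.2 (lt_irrefl _)
    · rintro x ⟨h1, h2⟩ hn
      rcases h1.eq_or_lt with rfl | h1
      · exact ⟨1, by norm_num, Or.inl ⟨by norm_num, Or.inl ⟨rfl, rfl⟩⟩⟩
      · obtain rfl : x = 3 := le_antisymm h2 (not_lt.1 fun h => hn ⟨h1, h⟩)
        exact ⟨1, by norm_num, Or.inr ⟨by norm_num, Or.inr (Or.inr ⟨rfl, rfl⟩)⟩⟩
  | 5, h =>
    refine IsGlued.isOmegaAC h Set.Ioo_subset_Icc_self Set.ordConnected_Ioo (nt _ (by norm_num)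
      (by norm_num)) ?_ ?_
    · rintro x hx y hy - (⟨rfl, -⟩ | ⟨-, rfl⟩)
      · exact absurd hx.1 (lt_irrefl _)
      · exact absurd hy.2 (lt_irrefl _)
    · rintro x ⟨h1, h2⟩ hn
      rcases h1.eq_or_lt with rfl | h1
      · exact ⟨1, by norm_num, Or.inl ⟨by norm_num, Or.inl ⟨rfl, rfl⟩⟩⟩
      · obtain rfl : x = 3 := le_antisymm h2 (not_lt.1 fun h => hn ⟨h1, h⟩)
        exact ⟨2, by norm_num, Or.inr ⟨by norm_num, Or.inr ⟨rfl, rfl⟩⟩⟩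

end ArcConnected

/-! ### From glued tours to the nine shapes. -/

namespace SimpleGraph

open ArcConnected

variable {V : Type*} {G : SimpleGraph V}

/-- All identifications take place among 0, two inner marks and N, which the change of parameter
moves to 0, 1, 2 and 3. A shape with fewer inner marks may choose the remaining ones freely. -/
lemma hasShape_of_Icc {N : ℕ} {k : Fin 9} {P : ℝ → ℝ → Prop} (hk : shapeDomain k = Set.Icc 0 3)
    (h : G.GluedTour (Set.Icc 0 N) P) {i' j' : ℝ} (hi : 0 < i') (hij : i' < j') (hjN : j' < N)
    (hint : ∀ x y, P x y → ∃ m n : ℤ, x = m ∧ y = n)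
    (hP : ∀ x y a b : ℝ, (x = 0 ↔ a = 0) ∧ (x = i' ↔ a = 1) ∧ (x = j' ↔ a = 2) ∧ (x = N ↔ a = 3) →
      (y = 0 ↔ b = 0) ∧ (y = i' ↔ b = 1) ∧ (y = j' ↔ b = 2) ∧ (y = N ↔ b = 3) →
      (P x y ↔ shapeRel k a b)) : HasShape k G.OneComplex := by
  obtain ⟨β, hβ, hβ'⟩ := exists_reparam_Icc hi hij hjN
  have := (h.isGlued hint).reparam (Q := shapeRel k) β hβ
    fun x y _ => hP _ _ _ _ (hβ' x) (hβ' y)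
  rw [HasShape, hk]
  exact this

lemma GluedTour.circle {N : ℕ} (hN : 0 < N)
    (h : G.GluedTour (Set.Icc 0 N) fun x y => x = 0 ∧ y = N) : HasShape 1 G.OneComplex := by
  have hN' : (0 : ℝ) < N := by exact_mod_cast hN
  refine hasShape_of_Icc rfl h (i' := N / 3) (j' := 2 * N / 3) (by linarith)
    (by linarith) (by linarith) (fun x y hxy => ⟨0, N, by simpa using hxy⟩) ?_
  rintro x y a b ⟨h1, h2, h3, h4⟩ ⟨k1, k2, k3, k4⟩
  exact and_congr h1 k4

lemma GluedTour.arc {N : ℕ} (hN : 0 < N) (h : G.GluedTour (Set.Icc 0 N) fun _ _ => False) :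
    HasShape 0 G.OneComplex := by
  have hN' : (0 : ℝ) < N := by exact_mod_cast hN
  exact hasShape_of_Icc rfl h (i' := N / 3) (j' := 2 * N / 3) (by linarith)
    (by linarith) (by linarith) (fun x y hxy => hxy.elim) fun x y a b _ _ => Iff.rfl

lemma GluedTour.lollipop {i N : ℕ} (hi : 0 < i) (hiN : i < N)
    (h : G.GluedTour (Set.Icc 0 N) fun x y => x = 0 ∧ y = i) : HasShape 2 G.OneComplex := by
  have hi' : (0 : ℝ) < i := by exact_mod_cast hi
  have hN' : (i : ℝ) < N := by exact_mod_cast hiN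
  refine hasShape_of_Icc rfl h (i' := i) (j' := (i + N) / 2) hi'
    (by linarith) (by linarith) (fun x y hxy => ⟨0, i, by simpa using hxy⟩) ?_
  rintro x y a b ⟨h1, h2, h3, h4⟩ ⟨k1, k2, k3, k4⟩
  exact and_congr h1 k2

lemma GluedTour.figureEight {i N : ℕ} (hi : 0 < i) (hiN : i < N)
    (h : G.GluedTour (Set.Icc 0 N)
      fun x y => (x = 0 ∧ y = i) ∨ (x = 0 ∧ y = N) ∨ (x = i ∧ y = N)) :
    HasShape 4 G.OneComplex := by
  have hi' : (0 : ℝ) < i := by exact_mod_cast hi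
  have hN' : (i : ℝ) < N := by exact_mod_cast hiN
  refine hasShape_of_Icc rfl h (i' := i) (j' := (i + N) / 2) hi'
    (by linarith) (by linarith) ?_ ?_
  · rintro x y (h | h | h)
    · exact ⟨0, i, by simpa using h⟩
    · exact ⟨0, N, by simpa using h⟩
    · exact ⟨i, N, by simpa using h⟩
  · rintro x y a b ⟨h1, h2, h3, h4⟩ ⟨k1, k2, k3, k4⟩
    exact or_congr (and_congr h1 k2) (or_congr (and_congr h1 k4) (and_congr h2 k4))

lemma GluedTour.dumbbell {i j N : ℕ} (hi : 0 < i) (hij : i < j) (hjN : j < N)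
    (h : G.GluedTour (Set.Icc 0 N) fun x y => (x = 0 ∧ y = i) ∨ (x = j ∧ y = N)) :
    HasShape 5 G.OneComplex := by
  refine hasShape_of_Icc rfl h (i' := i) (j' := j) (by exact_mod_cast hi)
    (by exact_mod_cast hij) (by exact_mod_cast hjN) ?_ ?_
  · rintro x y (h | h)
    · exact ⟨0, i, by simpa using h⟩
    · exact ⟨j, N, by simpa using h⟩
  · rintro x y a b ⟨h1, h2, h3, h4⟩ ⟨k1, k2, k3, k4⟩
    exact or_congr (and_congr h1 k2) (and_congr h3 k4)

lemma GluedTour.theta {i j N : ℕ} (hj : 0 < j) (hji : j < i) (hiN : i < N)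
    (h : G.GluedTour (Set.Icc 0 N) fun x y => (x = 0 ∧ y = i) ∨ (x = j ∧ y = N)) :
    HasShape 3 G.OneComplex := by
  -- Since j < i, the start is glued to the second mark and the first mark to the end, which is the
  -- pattern of the theta-curve.
  refine hasShape_of_Icc rfl h (i' := j) (j' := i) (by exact_mod_cast hj)
    (by exact_mod_cast hji) (by exact_mod_cast hiN) ?_ ?_
  · rintro x y (h | h)
    · exact ⟨0, i, by simpa using h⟩
    · exact ⟨j, N, by simpa using h⟩
  · rintro x y a b ⟨h1, h2, h3, h4⟩ ⟨k1, k2, k3, k4⟩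
    exact or_congr (and_congr h1 k3) (and_congr h2 k4)

lemma GluedTour.ray (h : G.GluedTour (Set.Ici 0) fun _ _ => False) :
    HasShape 6 G.OneComplex := by
  obtain ⟨β, hβ, -⟩ := exists_reparam_Ici one_pos
  exact (h.isGlued fun _ _ h => h.elim).reparam β hβ fun _ _ _ => Iff.rfl

lemma GluedTour.line (h : G.GluedTour Set.univ fun _ _ => False) :
    HasShape 7 G.OneComplex := by
  obtain ⟨β, hβ⟩ := exists_reparam_univ
  exact (h.isGlued fun _ _ h => h.elim).reparam β hβ fun _ _ _ => Iff.rfl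

lemma GluedTour.openLollipop {i : ℕ} (hi : 0 < i)
    (h : G.GluedTour (Set.Ici 0) fun x y => x = 0 ∧ y = i) : HasShape 8 G.OneComplex := by
  obtain ⟨β, hβ, hβ'⟩ := exists_reparam_Ici (i := i) (by exact_mod_cast hi)
  exact (h.isGlued fun x y hxy => ⟨0, i, by simpa using hxy⟩).reparam β hβ
    fun x y _ => and_congr (hβ' x).1 (hβ' y).2

/-- A non-degenerate `7`-ac graph has one of the nine shapes. -/
theorem exists_hasShape_of_isNAC [Nontrivial G.OneComplex] (h : IsNAC 7 G.OneComplex) :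
    ∃ k, HasShape k G.OneComplex := by
  have : PreconnectedSpace G.OneComplex :=
    OneComplex.preconnectedSpace_of_isNAC fun S hS => h S (hS.trans (by norm_num))
  have hT : G.HasTracks 7 := fun F hF h2 h7 => OneComplex.exists_track_of_isNAC h F hF h2 h7
  obtain ⟨a, b, hab⟩ := OneComplex.exists_adj (G := G)
  rcases hT.classification OneComplex.preconnected_of_preconnectedSpace hab with
    ⟨N, hN, h⟩ | h | h | ⟨N, hN, h⟩ | ⟨i, N, hi, hN, h⟩ | ⟨i, hi, h⟩ | ⟨i, N, hi, hN, h⟩ |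
    ⟨i, j, N, hi, hiN, hj, hjN, hij, h⟩
  · exact ⟨_, h.arc hN⟩
  · exact ⟨_, h.ray⟩
  · exact ⟨_, h.line⟩
  · exact ⟨_, h.circle hN⟩
  · exact ⟨_, h.lollipop hi hN⟩
  · exact ⟨_, h.openLollipop hi⟩
  · exact ⟨_, h.figureEight hi hN⟩
  · rcases lt_or_gt_of_ne hij with hlt | hlt
    · exact ⟨_, h.dumbbell hi hlt hjN⟩
    · exact ⟨_, h.theta hj hlt hiN⟩

end SimpleGraph

open Topology

namespace ArcConnected

/-! ### Topological invariants of the nine shapes -/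

/-- The points whose removal disconnects the space. -/
def cutSet (X : Type*) [TopologicalSpace X] : Set X := {x | ¬ IsPreconnected ({x}ᶜ : Set X)}

/-- Some two points do not disconnect the space. -/
def HasNonseparatingPair (X : Type*) [TopologicalSpace X] : Prop :=
  ∃ x y : X, x ≠ y ∧ IsPreconnected ({x, y}ᶜ : Set X)

/-- A topological property that distinguishes the nine shapes. -/
def ShapeProperty (k : Fin 9) (X : Type*) [TopologicalSpace X] : Prop :=
  match k with
  | 0 => CompactSpace X ∧ ¬ (cutSet X).Subsingleton ∧ (cutSet X)ᶜ.Finite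
  | 1 => CompactSpace X ∧ cutSet X = ∅ ∧ ¬ HasNonseparatingPair X
  | 2 => CompactSpace X ∧ ¬ (cutSet X).Subsingleton ∧ ¬ (cutSet X)ᶜ.Finite ∧ ¬ IsClosed (cutSet X)
  | 3 => CompactSpace X ∧ cutSet X = ∅ ∧ HasNonseparatingPair X
  | 4 => CompactSpace X ∧ cutSet X ≠ ∅ ∧ (cutSet X).Subsingleton
  | 5 => CompactSpace X ∧ ¬ (cutSet X).Subsingleton ∧ ¬ (cutSet X)ᶜ.Finite ∧ IsClosed (cutSet X)
  | 6 => ¬ CompactSpace X ∧ (cutSet X)ᶜ ≠ ∅ ∧ (cutSet X)ᶜ.Subsingleton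
  | 7 => ¬ CompactSpace X ∧ (cutSet X)ᶜ = ∅
  | 8 => ¬ CompactSpace X ∧ ¬ (cutSet X)ᶜ.Subsingleton

/-- Compactness separates 0–5 from 6–8. The size of the set of cut points separates 1 and 3, then 4,
from 0, 2 and 5. The finiteness of its complement isolates 0, its closedness separates 2 from 5, and
a nonseparating pair separates 3 from 1. The complement of the cut set has one, no, or several
points for 6, 7 and 8. -/
lemma ShapeProperty.unique {k l : Fin 9} {X : Type*} [TopologicalSpace X]
    (hk : ShapeProperty k X) (hl : ShapeProperty l X) : k = l := by
  have h1 : cutSet X = ∅ → (cutSet X).Subsingleton := fun h => h ▸ Set.subsingleton_empty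
  have h2 : (cutSet X)ᶜ = ∅ → (cutSet X)ᶜ.Subsingleton := fun h => h ▸ Set.subsingleton_empty
  fin_cases k <;> fin_cases l <;> first
    | rfl
    | (exfalso
       simp only [ShapeProperty] at hk hl
       tauto)

variable {X Y : Type*} [TopologicalSpace X] [TopologicalSpace Y]

lemma image_cutSet (φ : X ≃ₜ Y) : φ '' cutSet X = cutSet Y := by
  have key : ∀ x, φ x ∈ cutSet Y ↔ x ∈ cutSet X := by
    intro x
    have : φ '' {x}ᶜ = {φ x}ᶜ := by rw [Set.image_compl_eq φ.bijective, Set.image_singleton]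
    rw [cutSet, cutSet, Set.mem_ofPred_eq, Set.mem_ofPred_eq, ← this, φ.isPreconnected_image]
  ext y
  constructor
  · rintro ⟨x, hx, rfl⟩
    exact (key x).2 hx
  · intro hy
    exact ⟨φ.symm y, (key _).1 (by simpa using hy), by simp⟩

lemma HasNonseparatingPair.of_homeomorph (φ : X ≃ₜ Y) (h : HasNonseparatingPair X) :
    HasNonseparatingPair Y := by
  obtain ⟨x, y, hxy, h⟩ := h
  refine ⟨φ x, φ y, φ.injective.ne hxy, ?_⟩
  rw [← Set.image_pair, ← Set.image_compl_eq φ.bijective, φ.isPreconnected_image]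
  exact h

lemma ShapeProperty.of_homeomorph {k : Fin 9} (φ : X ≃ₜ Y) (h : ShapeProperty k X) :
    ShapeProperty k Y := by
  have c0 : CompactSpace X ↔ CompactSpace Y :=
    ⟨fun _ => φ.compactSpace, fun _ => φ.symm.compactSpace⟩
  have c1 : HasNonseparatingPair X ↔ HasNonseparatingPair Y :=
    ⟨.of_homeomorph φ, .of_homeomorph φ.symm⟩
  have sub : ∀ s : Set X, (φ '' s).Subsingleton ↔ s.Subsingleton := fun s =>
    ⟨fun h x hx y hy => φ.injective (h ⟨x, hx, rfl⟩ ⟨y, hy, rfl⟩), fun h => h.image φ⟩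
  have fin : ∀ s : Set X, (φ '' s).Finite ↔ s.Finite := fun s =>
    Set.finite_image_iff φ.injective.injOn
  have comp : (cutSet Y)ᶜ = φ '' (cutSet X)ᶜ := by
    rw [Set.image_compl_eq φ.bijective, image_cutSet]
  match k, h with
  | 0, h | 1, h | 2, h | 3, h | 4, h | 5, h | 6, h | 7, h | 8, h =>
    simp only [ShapeProperty, comp] at h ⊢
    rw [← image_cutSet φ] at *
    simpa only [sub, fin, c0, c1, φ.isClosed_image, Set.image_eq_empty, ne_eq] using h

lemma mem_cutSet_subtype {Y : Set ℂ} (z : Y) : z ∈ cutSet Y ↔ ¬ IsPreconnected (Y \ {z.1}) := by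
  have : Subtype.val '' ({z}ᶜ : Set Y) = Y \ {z.1} := by
    ext x
    simp
  rw [cutSet, Set.mem_ofPred_eq, ← this, IsInducing.subtypeVal.isPreconnected_image]

lemma hasNonseparatingPair_subtype {Y : Set ℂ} : HasNonseparatingPair Y ↔
    ∃ x ∈ Y, ∃ y ∈ Y, x ≠ y ∧ IsPreconnected (Y \ {x, y}) := by
  have key : ∀ x y : Y, IsPreconnected ({x, y}ᶜ : Set Y) ↔ IsPreconnected (Y \ {x.1, y.1}) := by
    intro x y
    have : Subtype.val '' ({x, y}ᶜ : Set Y) = Y \ {x.1, y.1} := by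
      ext z
      simp [Subtype.ext_iff]
      tauto
    rw [← this, IsInducing.subtypeVal.isPreconnected_image]
  constructor
  · rintro ⟨x, y, hxy, h⟩
    exact ⟨x, x.2, y, y.2, fun h => hxy (Subtype.ext h), (key x y).1 h⟩
  · rintro ⟨x, hx, y, hy, hxy, h⟩
    exact ⟨⟨x, hx⟩, ⟨y, hy⟩, fun h => hxy (congrArg Subtype.val h), (key _ _).2 h⟩

lemma not_isPreconnected_of_separated {f : ℂ → ℝ} (hf : Continuous f) {S : Set ℂ} {a b : ℂ} {c : ℝ}
    (ha : a ∈ S) (hb : b ∈ S) (hac : f a < c) (hcb : c < f b) (hc : ∀ z ∈ S, f z ≠ c) :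
    ¬ IsPreconnected S := by
  intro h
  obtain ⟨z, hz, hz'⟩ := (h.image f hf.continuousOn).ordConnected.out ⟨a, ha, rfl⟩ ⟨b, hb, rfl⟩
    ⟨hac.le, hcb.le⟩
  exact hc z hz hz'

/-- A point alone on a vertical line between two points of the set is a cut point. -/
lemma not_isPreconnected_diff_singleton {S : Set ℂ} {p a b : ℂ} (ha : a ∈ S) (hb : b ∈ S)
    (hap : a.re < p.re) (hpb : p.re < b.re) (hp : ∀ z ∈ S, z.re = p.re → z = p) :
    ¬ IsPreconnected (S \ {p}) := by
  refine not_isPreconnected_of_separated Complex.continuous_re (a := a) (b := b) (c := p.re)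
    ⟨ha, ?_⟩ ⟨hb, ?_⟩ hap hpb fun z hz h => hz.2 (hp z hz.1 h)
  · rintro rfl
    exact lt_irrefl _ hap
  · rintro rfl
    exact lt_irrefl _ hpb

lemma not_compactSpace_of_re {S : Set ℂ} (hne : S.Nonempty) (h : ∀ z ∈ S, ∃ y ∈ S, z.re < y.re) :
    ¬ CompactSpace S := by
  rw [← isCompact_iff_compactSpace]
  intro hS
  obtain ⟨z, hz, hmax⟩ := hS.exists_isMaxOn hne Complex.continuous_re.continuousOn
  obtain ⟨y, hy, hlt⟩ := h z hz
  exact absurd (hmax hy) (not_le.2 hlt)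

/-! ### Connectedness of punctured circles and intervals in the plane. -/

/-- The circle of radius one around a real number. -/
def sph (c : ℝ) : Set ℂ := Metric.sphere (c : ℂ) 1

/-- The set of real numbers `I` in the complex plane. -/
def line (I : Set ℝ) : Set ℂ := Complex.ofReal '' I

lemma sph_eq_range (c : ℝ) : sph c = Set.range fun t => (c : ℂ) + circ t := by
  ext z
  rw [sph, mem_sphere_ofReal]
  constructor
  · intro hz
    obtain ⟨t, -, -, ht⟩ := exists_circ_eq' hz
    exact ⟨t, by simp [ht]⟩
  · rintro ⟨t, rfl⟩
    simp [norm_circ]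

/-- A circle without its point at parameter t₀ is the image of the open interval from t₀ to t₀ + 1.
-/
lemma isPreconnected_sph_diff (c : ℝ) (p : ℂ) : IsPreconnected (sph c \ {p}) := by
  have hcont : Continuous fun t => (c : ℂ) + circ t := continuous_const.add continuous_circ
  by_cases hp : p ∈ sph c
  · rw [sph_eq_range] at hp
    obtain ⟨t₀, rfl⟩ := hp
    have : sph c \ {(c : ℂ) + circ t₀} = (fun t => (c : ℂ) + circ t) '' Set.Ioo t₀ (t₀ + 1) := by
      rw [sph_eq_range]
      ext z
      constructor
      · rintro ⟨⟨t, rfl⟩, hne⟩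
        have heq : circ t = circ (t₀ + Int.fract (t - t₀)) :=
          circ_eq_iff.2 ⟨⌊t - t₀⌋, by rw [add_assoc, Int.fract_add_floor]; ring⟩
        refine ⟨t₀ + Int.fract (t - t₀), ⟨?_, ?_⟩, congrArg (fun w => (c : ℂ) + w) heq.symm⟩
        · refine lt_of_le_of_ne (by linarith [Int.fract_nonneg (t - t₀)]) fun h => hne ?_
          rw [← h] at heq
          simp [heq]
        · linarith [Int.fract_lt_one (t - t₀)]
      · rintro ⟨t, ⟨h1, h2⟩, rfl⟩
        refine ⟨⟨t, rfl⟩, fun h => ?_⟩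
        have := eq_of_circ_eq h1 h2.le (add_left_cancel h).symm
        linarith
    rw [this]
    exact isPreconnected_Ioo.image _ hcont.continuousOn
  · rw [Set.sdiff_singleton_eq_self hp, sph_eq_range]
    exact isPreconnected_range hcont

lemma isPreconnected_line {I : Set ℝ} (hI : I.OrdConnected) : IsPreconnected (line I) :=
  hI.isPreconnected.image _ Complex.continuous_ofReal.continuousOn

lemma line_diff_singleton (I : Set ℝ) (r : ℝ) : line I \ {(r : ℂ)} = line (I \ {r}) := by
  ext z
  constructor
  · rintro ⟨⟨x, hx, rfl⟩, hne⟩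
    exact ⟨x, ⟨hx, fun h => hne (congrArg _ h)⟩, rfl⟩
  · rintro ⟨x, ⟨hx, hne⟩, rfl⟩
    exact ⟨⟨x, hx, rfl⟩, fun h => hne (Complex.ofReal_injective h)⟩

lemma isPreconnected_line_Icc_diff {a b : ℝ} {p : ℂ} (hp : p ∉ line (Set.Ioo a b)) :
    IsPreconnected (line (Set.Icc a b) \ {p}) := by
  by_cases h : p ∈ line (Set.Icc a b)
  · obtain ⟨r, hr, rfl⟩ := h
    rw [line_diff_singleton]
    refine isPreconnected_line ⟨fun x hx y hy z hz =>
      ⟨⟨hx.1.1.trans hz.1, hz.2.trans hy.1.2⟩, fun hzr => ?_⟩⟩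
    have hzr : z = r := hzr
    subst hzr
    refine hp ⟨z, ⟨lt_of_le_of_ne hr.1 ?_, lt_of_le_of_ne hr.2 ?_⟩, rfl⟩
    · rintro rfl
      exact hx.2 (le_antisymm hz.1 hx.1.1)
    · rintro rfl
      exact hy.2 (le_antisymm hy.1.2 hz.2)
  · rw [Set.sdiff_singleton_eq_self h]
    exact isPreconnected_line Set.ordConnected_Icc

lemma isPreconnected_union_diff {A B : Set ℂ} {p x : ℂ} (hA : IsPreconnected (A \ {p}))
    (hB : IsPreconnected (B \ {p})) (hxA : x ∈ A) (hxB : x ∈ B) (hxp : x ≠ p) :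
    IsPreconnected ((A ∪ B) \ {p}) := by
  rw [Set.union_sdiff_distrib]
  exact hA.union x ⟨hxA, hxp⟩ ⟨hxB, hxp⟩ hB

lemma mem_sph {c : ℝ} {z : ℂ} : z ∈ sph c ↔ (z.re - c) ^ 2 + z.im ^ 2 = 1 := by
  rw [sph, mem_sphere_ofReal, ← pow_eq_one_iff_of_nonneg (norm_nonneg _) two_ne_zero,
    ← Complex.normSq_eq_norm_sq, Complex.normSq_apply]
  simp [sq]

lemma re_le_of_mem_sph {c : ℝ} {z : ℂ} (hz : z ∈ sph c) : z.re ≤ c + 1 := by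
  rw [mem_sph] at hz
  nlinarith [sq_nonneg z.im]

lemma le_re_of_mem_sph {c : ℝ} {z : ℂ} (hz : z ∈ sph c) : c - 1 ≤ z.re := by
  rw [mem_sph] at hz
  nlinarith [sq_nonneg z.im]

lemma eq_of_mem_sph_of_re {c r : ℝ} {z : ℂ} (hz : z ∈ sph c) (hr : (r - c) ^ 2 = 1)
    (h : z.re = r) : z = r := by
  rw [mem_sph, h, hr] at hz
  refine Complex.ext h ?_
  rw [Complex.ofReal_im]
  exact pow_eq_zero_iff (two_ne_zero) |>.1 (by linarith)

lemma eq_of_mem_line {I : Set ℝ} {z : ℂ} (hz : z ∈ line I) : z = z.re ∧ z.re ∈ I := by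
  obtain ⟨r, hr, rfl⟩ := hz
  exact ⟨rfl, hr⟩

lemma ofReal_mem_line {I : Set ℝ} {r : ℝ} : (r : ℂ) ∈ line I ↔ r ∈ I :=
  Complex.ofReal_injective.mem_set_image

lemma segment_eq_line {a b : ℝ} (hab : a ≤ b) : segment ℝ (a : ℂ) b = line (Set.Icc a b) := by
  ext z
  rw [mem_segment_ofReal hab]
  constructor
  · rintro ⟨r, h1, h2, rfl⟩
    exact ⟨r, ⟨h1, h2⟩, rfl⟩
  · rintro ⟨r, ⟨h1, h2⟩, rfl⟩
    exact ⟨r, h1, h2, rfl⟩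

lemma ofReal_mem_sph {c r : ℝ} (h : (r - c) ^ 2 = 1) : (r : ℂ) ∈ sph c := by
  rw [mem_sph]
  simpa using h

lemma infinite_sph_diff (c : ℝ) (p : ℂ) : (sph c \ {p}).Infinite := by
  have : (sph c).Infinite := by
    rw [sph_eq_range]
    intro hfin
    have hinj : Set.InjOn (fun t => (c : ℂ) + circ t) (Set.Ico 0 1) := by
      intro s hs t ht hst
      have hst : circ s = circ t := add_left_cancel hst
      rcases lt_trichotomy s t with h | h | h
      · have := ((circ_inj_Icc hs.1 h ht.2.le).1 hst).2
        linarith [ht.2]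
      · exact h
      · have := ((circ_inj_Icc ht.1 h hs.2.le).1 hst.symm).2
        linarith [hs.2]
    exact (Set.Ico_infinite zero_lt_one).image hinj (hfin.subset (by rintro _ ⟨t, -, rfl⟩; exact ⟨t, rfl⟩))
  exact this.sdiff (Set.finite_singleton p)

end ArcConnected

open Topology

/-! ### The invariants of the nine models. -/

namespace ArcConnected

lemma shapeModel_zero : shapeModel 0 = line (Set.Icc 0 1) := by
  have := segment_eq_line (zero_le_one (α := ℝ))
  rw [Complex.ofReal_zero, Complex.ofReal_one] at this
  exact this

lemma shapeModel_one : shapeModel 1 = sph 0 := by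
  change Metric.sphere (0 : ℂ) 1 = _
  rw [sph, Complex.ofReal_zero]

lemma shapeModel_two : shapeModel 2 = sph 0 ∪ line (Set.Icc 1 2) := by
  have := segment_eq_line (one_le_two (α := ℝ))
  rw [Complex.ofReal_one, Complex.ofReal_ofNat] at this
  change Metric.sphere (0 : ℂ) 1 ∪ segment ℝ 1 2 = _
  rw [sph, Complex.ofReal_zero, this]

lemma shapeModel_three : shapeModel 3 = sph 0 ∪ line (Set.Icc (-1) 1) := by
  have := segment_eq_line (show (-1 : ℝ) ≤ 1 by norm_num)
  push_cast at this
  change Metric.sphere (0 : ℂ) 1 ∪ segment ℝ (-1) 1 = _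
  rw [sph, Complex.ofReal_zero, this]

lemma shapeModel_four : shapeModel 4 = sph (-1) ∪ sph 1 := by
  change Metric.sphere (-1 : ℂ) 1 ∪ Metric.sphere 1 1 = _
  rw [sph, sph]
  push_cast
  rfl

lemma shapeModel_five : shapeModel 5 = sph (-2) ∪ line (Set.Icc (-1) 1) ∪ sph 2 := by
  have := segment_eq_line (show (-1 : ℝ) ≤ 1 by norm_num)
  push_cast at this
  change Metric.sphere (-2 : ℂ) 1 ∪ segment ℝ (-1) 1 ∪ Metric.sphere 2 1 = _
  rw [sph, sph, this]
  push_cast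
  rfl

lemma shapeModel_six : shapeModel 6 = line (Set.Ico 0 1) := by
  change shapeModel 0 \ {1} = _
  rw [shapeModel_zero, ← Complex.ofReal_one, line_diff_singleton, Set.Icc_sdiff_right]

lemma shapeModel_seven : shapeModel 7 = line (Set.Ioo 0 1) := by
  change shapeModel 0 \ {0, 1} = _
  rw [shapeModel_zero, ← Set.union_singleton, ← Set.sdiff_sdiff, ← Complex.ofReal_one,
    line_diff_singleton, ← Complex.ofReal_zero, line_diff_singleton, Set.Icc_sdiff_right,
    Set.Ico_sdiff_left]

lemma shapeModel_eight : shapeModel 8 = sph 0 ∪ line (Set.Ico 1 2) := by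
  change shapeModel 2 \ {2} = _
  rw [shapeModel_two, Set.union_sdiff_distrib, ← Complex.ofReal_ofNat, line_diff_singleton,
    Set.Icc_sdiff_right, Set.sdiff_singleton_eq_self]
  intro h
  have := re_le_of_mem_sph h
  norm_num at this

lemma compactSpace_shapeModel {k : Fin 9} (hk : shapeDomain k = Set.Icc 0 3) :
    CompactSpace (shapeModel k) := by
  have h := hasShape_shapeModel k
  rw [HasShape, hk] at h
  obtain ⟨f, hf, -⟩ := h
  exact hf.surjective.compactSpace hf.continuous

lemma mem_cutSet_line {I : Set ℝ} {z : line I} {a b : ℝ} (ha : a ∈ I) (hb : b ∈ I)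
    (haz : a < z.1.re) (hzb : z.1.re < b) : z ∈ cutSet (line I) := by
  rw [mem_cutSet_subtype]
  refine not_isPreconnected_diff_singleton (ofReal_mem_line.2 ha) (ofReal_mem_line.2 hb)
    (by simpa using haz) (by simpa using hzb) fun y hy h => ?_
  rw [(eq_of_mem_line hy).1, h]
  exact (eq_of_mem_line z.2).1.symm

lemma shapeProperty_zero : ShapeProperty 0 (shapeModel 0) := by
  refine ⟨compactSpace_shapeModel rfl, ?_, ?_⟩ <;> rw [shapeModel_zero]
  · intro h
    have := h (mem_cutSet_line (z := ⟨((1 / 2 : ℝ) : ℂ), ofReal_mem_line.2 (by norm_num)⟩)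
      (a := 0) (b := 1) (by norm_num) (by norm_num) (by norm_num) (by norm_num))
      (mem_cutSet_line (z := ⟨((1 / 4 : ℝ) : ℂ), ofReal_mem_line.2 (by norm_num)⟩)
      (a := 0) (b := 1) (by norm_num) (by norm_num) (by norm_num) (by norm_num))
    have := Complex.ofReal_injective (congrArg Subtype.val this)
    norm_num at this
  · refine Set.Finite.subset ((Set.toFinite {((0 : ℝ) : ℂ), ((1 : ℝ) : ℂ)}).preimage
      Subtype.val_injective.injOn) fun z hz => ?_
    obtain ⟨h1, h2⟩ := eq_of_mem_line z.2
    by_contra hne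
    simp only [Set.mem_preimage, Set.mem_insert_iff, Set.mem_singleton_iff, not_or] at hne
    refine hz (mem_cutSet_line (a := 0) (b := 1) (by norm_num) (by norm_num)
      (lt_of_le_of_ne h2.1 fun h => hne.1 ?_) (lt_of_le_of_ne h2.2 fun h => hne.2 ?_))
    · rw [h1, ← h]
    · rw [h1, h]

lemma shapeProperty_six : ShapeProperty 6 (shapeModel 6) := by
  rw [shapeModel_six]
  refine ⟨not_compactSpace_of_re ⟨_, ofReal_mem_line.2 (show (0 : ℝ) ∈ Set.Ico 0 1 by norm_num)⟩
    ?_, ?_, ?_⟩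
  · rintro z hz
    have h2 := (eq_of_mem_line hz).2
    refine ⟨((z.re + 1) / 2 : ℝ), ofReal_mem_line.2 ⟨by linarith [h2.1], by linarith [h2.2]⟩, ?_⟩
    rw [Complex.ofReal_re]
    linarith [h2.2]
  · refine Set.Nonempty.ne_empty ⟨⟨_, ofReal_mem_line.2 (show (0 : ℝ) ∈ Set.Ico 0 1 by norm_num)⟩,
      ?_⟩
    rw [Set.mem_compl_iff, mem_cutSet_subtype, not_not, line_diff_singleton, Set.Ico_sdiff_left]
    exact isPreconnected_line Set.ordConnected_Ioo
  · have key : ∀ z ∈ (cutSet (line (Set.Ico 0 1)))ᶜ, z.1 = (0 : ℝ) := by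
      intro z hz
      obtain ⟨h1, h2⟩ := eq_of_mem_line z.2
      by_contra hne
      refine hz (mem_cutSet_line (a := 0) (b := (z.1.re + 1) / 2) (by norm_num)
        ⟨by linarith [h2.1], by linarith [h2.2]⟩
        (lt_of_le_of_ne h2.1 fun h => hne ?_) (by linarith [h2.2]))
      rw [h1, ← h]
    intro x hx y hy
    exact Subtype.ext ((key x hx).trans (key y hy).symm)

lemma shapeProperty_seven : ShapeProperty 7 (shapeModel 7) := by
  rw [shapeModel_seven]
  refine ⟨not_compactSpace_of_re ⟨_, ofReal_mem_line.2
    (show (1 / 2 : ℝ) ∈ Set.Ioo 0 1 by norm_num)⟩ ?_, ?_⟩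
  · rintro z hz
    have h2 := (eq_of_mem_line hz).2
    refine ⟨((z.re + 1) / 2 : ℝ), ofReal_mem_line.2 ⟨by linarith [h2.1], by linarith [h2.2]⟩, ?_⟩
    rw [Complex.ofReal_re]
    linarith [h2.2]
  · rw [Set.compl_empty_iff, Set.eq_univ_iff_forall]
    intro z
    have h2 := (eq_of_mem_line z.2).2
    exact mem_cutSet_line (a := z.1.re / 2) (b := (z.1.re + 1) / 2)
      ⟨by linarith [h2.1], by linarith [h2.2]⟩ ⟨by linarith [h2.1], by linarith [h2.2]⟩
      (by linarith [h2.1]) (by linarith [h2.2])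

/-- For the last clause, the line through two points x and y of the circle meets it nowhere else and
has points of the circle on both sides. The function f below is the signed area whose zero set is
that line. -/
lemma shapeProperty_one : ShapeProperty 1 (shapeModel 1) := by
  refine ⟨compactSpace_shapeModel rfl, ?_, ?_⟩ <;> rw [shapeModel_one]
  · rw [Set.eq_empty_iff_forall_notMem]
    intro z
    rw [mem_cutSet_subtype, not_not]
    exact isPreconnected_sph_diff 0 z
  · rw [hasNonseparatingPair_subtype]
    rintro ⟨x, hx, y, hy, hxy, h⟩
    have hx1 := mem_sph.1 hx
    have hy1 := mem_sph.1 hy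
    rw [sub_zero] at hx1 hy1
    set d₁ := y.re - x.re with hd1
    set d₂ := y.im - x.im with hd2
    have hd : 0 < d₁ ^ 2 + d₂ ^ 2 := by
      by_contra! hle
      have h1 : d₁ = 0 := pow_eq_zero_iff two_ne_zero |>.1
        (by nlinarith [sq_nonneg d₁, sq_nonneg d₂])
      have h2 : d₂ = 0 := pow_eq_zero_iff two_ne_zero |>.1
        (by nlinarith [sq_nonneg d₁, sq_nonneg d₂])
      exact hxy (Complex.ext (by linarith) (by linarith))
    -- This expresses that x and x + d both have norm 1. It makes the inner product of x and d
    -- nonzero, so K, the value of f at the centre, satisfies |K| < l.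
    have hdot : 2 * (x.re * d₁ + x.im * d₂) = -(d₁ ^ 2 + d₂ ^ 2) := by
      rw [hd1, hd2]
      linear_combination hy1 - hx1
    set l := √(d₁ ^ 2 + d₂ ^ 2) with hl
    have hl0 : 0 < l := Real.sqrt_pos.2 hd
    have hl2 : l ^ 2 = d₁ ^ 2 + d₂ ^ 2 := Real.sq_sqrt hd.le
    set K := x.re * d₂ - x.im * d₁ with hK
    have hK2 : K ^ 2 + (x.re * d₁ + x.im * d₂) ^ 2 = l ^ 2 := by
      rw [hl2, hK]
      linear_combination (d₁ ^ 2 + d₂ ^ 2) * hx1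
    have hKl : |K| < l := by
      refine abs_lt_of_sq_lt_sq ?_ hl0.le
      have : 0 < (x.re * d₁ + x.im * d₂) ^ 2 := by
        have : x.re * d₁ + x.im * d₂ < 0 := by linarith
        exact sq_pos_of_ne_zero this.ne
      linarith
    obtain ⟨hK1, hK3⟩ := abs_lt.1 hKl
    set f : ℂ → ℝ := fun z => (z.im - x.im) * d₁ - (z.re - x.re) * d₂ with hf
    have hfc : Continuous f := by
      simp only [hf]
      fun_prop
    have hfx : f x = 0 := by simp [hf]
    have hfy : f y = 0 := by
      simp only [hf, ← hd1, ← hd2]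
      ring
    -- The two unit normals of the chord; f takes the values l + K and -l + K there, of opposite
    -- signs.
    have hmem : ∀ ε : ℝ, ε ^ 2 = 1 →
        (⟨-(ε * d₂ / l), ε * d₁ / l⟩ : ℂ) ∈ sph 0 ∧ f ⟨-(ε * d₂ / l), ε * d₁ / l⟩ = ε * l + K := by
      intro ε hε
      constructor
      · rw [mem_sph]
        simp only [sub_zero]
        field_simp
        rw [hε, hl2]
        ring
      · simp only [hf, hK]
        field_simp
        linear_combination -ε * hl2
    obtain ⟨ha, hfa⟩ := hmem (-1) (by norm_num)
    obtain ⟨hb, hfb⟩ := hmem 1 (by norm_num)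
    have hne : ∀ z, f z ≠ 0 → z ∉ ({x, y} : Set ℂ) := by
      rintro z hz (rfl | rfl)
      · exact hz hfx
      · exact hz hfy
    refine not_isPreconnected_of_separated hfc (c := 0) (S := sph 0 \ {x, y})
      ⟨ha, hne _ ?_⟩ ⟨hb, hne _ ?_⟩ ?_ ?_ ?_ h
    · rw [hfa]
      intro h
      linarith
    · rw [hfb]
      intro h
      linarith
    · rw [hfa]
      linarith
    · rw [hfb]
      linarith
    · rintro z ⟨hz, hzn⟩ hfz
      apply hzn
      have hz1 := mem_sph.1 hz
      rw [sub_zero] at hz1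
      simp only [hf] at hfz
      -- A zero of f has the form x + t d, and norm 1 leaves only t = 0 and t = 1, that is, x and y.
      set t := ((z.re - x.re) * d₁ + (z.im - x.im) * d₂) / (d₁ ^ 2 + d₂ ^ 2) with ht
      have hre : z.re = x.re + t * d₁ := by
        rw [ht]
        field_simp
        linear_combination -d₂ * hfz
      have him : z.im = x.im + t * d₂ := by
        rw [ht]
        field_simp
        linear_combination d₁ * hfz
      have hquad : (t * (t - 1)) * (d₁ ^ 2 + d₂ ^ 2) = 0 := by
        rw [hre, him] at hz1
        linear_combination hz1 - hx1 - t * hdot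
      rcases mul_eq_zero.1 ((mul_eq_zero.1 hquad).resolve_right hd.ne') with h1 | h1
      · left
        rw [h1] at hre him
        exact Complex.ext (by linarith) (by linarith)
      · right
        rw [sub_eq_zero.1 h1] at hre him
        exact Complex.ext (by linarith) (by linarith)

/-- Each of the two pieces of the broken segment still hangs on A by its outer end. -/
lemma isPreconnected_union_broken_line {A : Set ℂ} (hA : IsPreconnected A) {a b r : ℝ}
    (ha : (a : ℂ) ∈ A) (hb : (b : ℂ) ∈ A) (har : a < r) (hrb : r < b) :
    IsPreconnected (A ∪ line (Set.Icc a b) \ {(r : ℂ)}) := by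
  have : Set.Icc a b \ {r} = Set.Ico a r ∪ Set.Ioc r b := by
    ext x
    simp only [Set.mem_sdiff, Set.mem_Icc, Set.mem_singleton_iff, Set.mem_union, Set.mem_Ico,
      Set.mem_Ioc]
    constructor
    · rintro ⟨⟨h1, h2⟩, h3⟩
      rcases lt_or_gt_of_ne h3 with h | h
      · exact Or.inl ⟨h1, h⟩
      · exact Or.inr ⟨h, h2⟩
    · rintro (⟨h1, h2⟩ | ⟨h1, h2⟩)
      · exact ⟨⟨h1, by linarith⟩, h2.ne⟩
      · exact ⟨⟨by linarith, h2⟩, h1.ne'⟩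
  rw [line_diff_singleton, this, line, Set.image_union, ← Set.union_assoc]
  refine IsPreconnected.union (b : ℂ) (Or.inl hb) (ofReal_mem_line.2 ⟨hrb, le_rfl⟩) ?_
    (isPreconnected_line Set.ordConnected_Ioc)
  exact IsPreconnected.union (a : ℂ) ha (ofReal_mem_line.2 ⟨le_rfl, har⟩) hA
    (isPreconnected_line Set.ordConnected_Ico)

lemma shapeProperty_three : ShapeProperty 3 (shapeModel 3) := by
  refine ⟨compactSpace_shapeModel rfl, ?_, ?_⟩ <;> rw [shapeModel_three]
  · rw [Set.eq_empty_iff_forall_notMem]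
    intro z
    rw [mem_cutSet_subtype, not_not]
    by_cases hz : z.1 ∈ line (Set.Ioo (-1) 1)
    · obtain ⟨r, hr, hrz⟩ := hz
      rw [← hrz, Set.union_sdiff_distrib]
      refine isPreconnected_union_broken_line (isPreconnected_sph_diff _ _)
        ⟨ofReal_mem_sph (by norm_num), fun h => ?_⟩ ⟨ofReal_mem_sph (by norm_num), fun h => ?_⟩
        hr.1 hr.2
      · exact hr.1.ne (Complex.ofReal_injective h)
      · exact hr.2.ne' (Complex.ofReal_injective h)
    -- The circle and the diameter share both 1 and -1; one that is not removed holds the two pieces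
    -- together.
    · by_cases h1 : ((1 : ℝ) : ℂ) = z.1
      · refine isPreconnected_union_diff (isPreconnected_sph_diff _ _)
          (isPreconnected_line_Icc_diff hz) (x := ((-1 : ℝ) : ℂ)) (ofReal_mem_sph (by norm_num))
          (ofReal_mem_line.2 (by norm_num)) fun h => ?_
        have := Complex.ofReal_injective (h1.trans h.symm)
        norm_num at this
      · exact isPreconnected_union_diff (isPreconnected_sph_diff _ _)
          (isPreconnected_line_Icc_diff hz) (x := ((1 : ℝ) : ℂ)) (ofReal_mem_sph (by norm_num))
          (ofReal_mem_line.2 (by norm_num)) h1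
  · rw [hasNonseparatingPair_subtype]
    have hI : Complex.I ∈ sph 0 := by simp [mem_sph]
    -- The midpoint of the diameter and a point of the circle: the punctured circle stays connected
    -- and carries both halves of the diameter.
    refine ⟨((0 : ℝ) : ℂ), Or.inr (ofReal_mem_line.2 (by norm_num)), Complex.I, Or.inl hI,
      by simpa using Complex.I_ne_zero.symm, ?_⟩
    have : (sph 0 ∪ line (Set.Icc (-1) 1)) \ {((0 : ℝ) : ℂ), Complex.I} =
        sph 0 \ {Complex.I} ∪ line (Set.Icc (-1) 1) \ {((0 : ℝ) : ℂ)} := by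
      ext z
      constructor
      · rintro ⟨h1 | h1, h2⟩
        · exact Or.inl ⟨h1, fun h => h2 (Or.inr h)⟩
        · exact Or.inr ⟨h1, fun h => h2 (Or.inl h)⟩
      · rintro (⟨h1, h2⟩ | ⟨h1, h2⟩)
        · refine ⟨Or.inl h1, ?_⟩
          rintro (rfl | h)
          · rw [mem_sph] at h1
            norm_num at h1
          · exact h2 h
        · refine ⟨Or.inr h1, ?_⟩
          rintro (h | rfl)
          · exact h2 h
          · have := congrArg Complex.im (eq_of_mem_line h1).1
            norm_num at this
    rw [this]
    refine isPreconnected_union_broken_line (isPreconnected_sph_diff _ _)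
      ⟨ofReal_mem_sph (by norm_num), fun h => ?_⟩ ⟨ofReal_mem_sph (by norm_num), fun h => ?_⟩
      (by norm_num) (by norm_num)
    · have := congrArg Complex.im h
      norm_num at this
    · have := congrArg Complex.im h
      norm_num at this

lemma shapeProperty_four : ShapeProperty 4 (shapeModel 4) := by
  have h0 : ((0 : ℝ) : ℂ) ∈ sph (-1) ∪ sph 1 := Or.inl (ofReal_mem_sph (by norm_num))
  refine ⟨compactSpace_shapeModel rfl, ?_, ?_⟩ <;> rw [shapeModel_four]
  · refine Set.Nonempty.ne_empty ⟨⟨_, h0⟩, ?_⟩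
    rw [mem_cutSet_subtype]
    refine not_isPreconnected_diff_singleton (a := ((-2 : ℝ) : ℂ)) (b := ((2 : ℝ) : ℂ))
      (Or.inl (ofReal_mem_sph (by norm_num))) (Or.inr (ofReal_mem_sph (by norm_num)))
      (by norm_num) (by norm_num) ?_
    rintro z (hz | hz) h
    · exact eq_of_mem_sph_of_re hz (by norm_num) h
    · exact eq_of_mem_sph_of_re hz (by norm_num) h
  · have key : ∀ z ∈ cutSet (sph (-1) ∪ sph 1 : Set ℂ), ((0 : ℝ) : ℂ) = z.1 := by
      intro z hz
      rw [mem_cutSet_subtype] at hz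
      by_contra hne
      exact hz (isPreconnected_union_diff (isPreconnected_sph_diff _ _)
        (isPreconnected_sph_diff _ _) (ofReal_mem_sph (by norm_num))
        (ofReal_mem_sph (by norm_num)) hne)
    intro x hx y hy
    exact Subtype.ext ((key x hx).symm.trans (key y hy))

/-- The vertical line through a point of the stick, including the junction and excluding the free
end, meets the lollipop only there. Any other removed point leaves the circle and the stick
connected and joined at 1. -/
lemma mem_cutSet_two (z : (sph 0 ∪ line (Set.Icc 1 2) : Set ℂ)) :
    z ∈ cutSet (sph 0 ∪ line (Set.Icc 1 2) : Set ℂ) ↔ z.1 ∈ line (Set.Ico 1 2) := by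
  rw [mem_cutSet_subtype]
  constructor
  · intro hz
    by_contra hn
    refine hz (isPreconnected_union_diff (isPreconnected_sph_diff _ _)
        (isPreconnected_line_Icc_diff fun h => hn ?_) (x := ((1 : ℝ) : ℂ))
        (ofReal_mem_sph (by norm_num)) (ofReal_mem_line.2 (by norm_num)) fun h => hn ?_)
    · exact Set.image_mono Set.Ioo_subset_Ico_self h
    · rw [← h]
      exact ofReal_mem_line.2 (by norm_num)
  · rintro ⟨r, hr, hrz⟩
    rw [← hrz]
    refine not_isPreconnected_diff_singleton (a := ((-1 : ℝ) : ℂ)) (b := ((2 : ℝ) : ℂ))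
      (Or.inl (ofReal_mem_sph (by norm_num))) (Or.inr (ofReal_mem_line.2 (by norm_num))) ?_ ?_ ?_
    · rw [Complex.ofReal_re, Complex.ofReal_re]
      linarith [hr.1]
    · rw [Complex.ofReal_re, Complex.ofReal_re]
      exact hr.2
    · rintro y (hy | hy) h
      · have := re_le_of_mem_sph hy
        rw [h, Complex.ofReal_re, zero_add] at this
        have hr1 : r = 1 := le_antisymm this hr.1
        exact eq_of_mem_sph_of_re hy (by rw [hr1]; norm_num) h
      · rw [(eq_of_mem_line hy).1, h]
        rfl

lemma infinite_compl_cutSet {Y : Set ℂ} {c : ℝ} {p : ℂ} (hY : sph c ⊆ Y)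
    (h : ∀ z : Y, z.1 ∈ sph c → z.1 ≠ p → z ∉ cutSet Y) : ¬ (cutSet Y)ᶜ.Finite := by
  intro hfin
  refine infinite_sph_diff c p ((hfin.image Subtype.val).subset ?_)
  rintro z ⟨hz, hne⟩
  exact ⟨⟨z, hY hz⟩, h ⟨z, hY hz⟩ hz hne, rfl⟩

lemma shapeProperty_two : ShapeProperty 2 (shapeModel 2) := by
  refine ⟨compactSpace_shapeModel rfl, ?_, ?_, ?_⟩ <;> rw [shapeModel_two]
  · intro h
    have := h ((mem_cutSet_two ⟨((1 : ℝ) : ℂ), Or.inr (ofReal_mem_line.2 (by norm_num))⟩).2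
      (ofReal_mem_line.2 (by norm_num)))
      ((mem_cutSet_two ⟨((3 / 2 : ℝ) : ℂ), Or.inr (ofReal_mem_line.2 (by norm_num))⟩).2
      (ofReal_mem_line.2 (by norm_num)))
    have := Complex.ofReal_injective (congrArg Subtype.val this)
    norm_num at this
  · refine infinite_compl_cutSet (c := 0) (p := ((1 : ℝ) : ℂ)) Set.subset_union_left
      fun z hz hne h => hne ?_
    rw [mem_cutSet_two] at h
    obtain ⟨h1, h2⟩ := eq_of_mem_line h
    have := re_le_of_mem_sph hz
    rw [h1, le_antisymm (by linarith) h2.1]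
  · intro hcl
    have hmem : ∀ t : Set.Icc (1 : ℝ) 2, ((t : ℝ) : ℂ) ∈ (sph 0 ∪ line (Set.Icc 1 2) : Set ℂ) :=
      fun t => Or.inr (ofReal_mem_line.2 t.2)
    set γ : ℝ → (sph 0 ∪ line (Set.Icc 1 2) : Set ℂ) := fun t =>
      ⟨_, hmem (Set.projIcc 1 2 one_le_two t)⟩ with hγ
    have hγc : Continuous γ := Continuous.subtype_mk
      (Complex.continuous_ofReal.comp (continuous_subtype_val.comp continuous_projIcc)) _
    -- The free end is a limit of cut points but not one itself: along the stick, prolonged by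
    -- constants, a closed cut set would make the half-line t < 2 clopen in ℝ.
    have hpre : γ ⁻¹' cutSet (sph 0 ∪ line (Set.Icc 1 2) : Set ℂ) = Set.Iio 2 := by
      ext t
      rw [Set.mem_preimage, mem_cutSet_two]
      simp only [hγ, ofReal_mem_line, Set.coe_projIcc]
      simp
    have hclopen : IsClopen (Set.Iio (2 : ℝ)) := ⟨hpre ▸ hcl.preimage hγc, isOpen_Iio⟩
    rcases isClopen_iff.1 hclopen with h | h
    · exact (Set.nonempty_Iio (a := (2 : ℝ))).ne_empty h
    · have : (2 : ℝ) ∈ Set.Iio 2 := h ▸ Set.mem_univ _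
      exact lt_irrefl (2 : ℝ) (Set.mem_Iio.1 this)

/-- Here both ends of the segment lie on circles and are cut points, so, unlike for the lollipop,
the cut set is closed. -/
lemma mem_cutSet_five (z : (sph (-2) ∪ line (Set.Icc (-1) 1) ∪ sph 2 : Set ℂ)) :
    z ∈ cutSet (sph (-2) ∪ line (Set.Icc (-1) 1) ∪ sph 2 : Set ℂ) ↔
      z.1 ∈ line (Set.Icc (-1) 1) := by
  rw [mem_cutSet_subtype]
  constructor
  · intro hz
    by_contra hn
    have hm : ((-1 : ℝ) : ℂ) ≠ z.1 := fun h => hn (h ▸ ofReal_mem_line.2 (by norm_num))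
    have hp : ((1 : ℝ) : ℂ) ≠ z.1 := fun h => hn (h ▸ ofReal_mem_line.2 (by norm_num))
    refine hz (isPreconnected_union_diff (isPreconnected_union_diff (isPreconnected_sph_diff _ _)
      (isPreconnected_line_Icc_diff fun h => hn (Set.image_mono Set.Ioo_subset_Icc_self h))
      (ofReal_mem_sph (by norm_num)) (ofReal_mem_line.2 (by norm_num)) hm)
      (isPreconnected_sph_diff _ _)
      (Or.inr (ofReal_mem_line.2 (by norm_num))) (ofReal_mem_sph (by norm_num)) hp)
  · rintro ⟨r, hr, hrz⟩
    rw [← hrz]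
    refine not_isPreconnected_diff_singleton (a := ((-3 : ℝ) : ℂ)) (b := ((3 : ℝ) : ℂ))
      (Or.inl (Or.inl (ofReal_mem_sph (by norm_num)))) (Or.inr (ofReal_mem_sph (by norm_num)))
      ?_ ?_ ?_
    · rw [Complex.ofReal_re, Complex.ofReal_re]
      linarith [hr.1]
    · rw [Complex.ofReal_re, Complex.ofReal_re]
      linarith [hr.2]
    · rintro y ((hy | hy) | hy) h
      · have := re_le_of_mem_sph hy
        rw [h, Complex.ofReal_re] at this
        have hr1 : r = -1 := le_antisymm (by linarith) hr.1
        exact eq_of_mem_sph_of_re hy (by rw [hr1]; norm_num) h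
      · rw [(eq_of_mem_line hy).1, h]
        rfl
      · have := le_re_of_mem_sph hy
        rw [h, Complex.ofReal_re] at this
        have hr1 : r = 1 := le_antisymm hr.2 (by linarith)
        exact eq_of_mem_sph_of_re hy (by rw [hr1]; norm_num) h

lemma shapeProperty_five : ShapeProperty 5 (shapeModel 5) := by
  refine ⟨compactSpace_shapeModel rfl, ?_, ?_, ?_⟩ <;> rw [shapeModel_five]
  · intro h
    have := h ((mem_cutSet_five
      ⟨((1 : ℝ) : ℂ), Or.inl (Or.inr (ofReal_mem_line.2 (by norm_num)))⟩).2
      (ofReal_mem_line.2 (by norm_num)))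
      ((mem_cutSet_five ⟨((0 : ℝ) : ℂ), Or.inl (Or.inr (ofReal_mem_line.2 (by norm_num)))⟩).2
      (ofReal_mem_line.2 (by norm_num)))
    have := Complex.ofReal_injective (congrArg Subtype.val this)
    norm_num at this
  · refine infinite_compl_cutSet (c := -2) (p := ((-1 : ℝ) : ℂ))
      (Set.subset_union_left.trans Set.subset_union_left) fun z hz hne h => hne ?_
    rw [mem_cutSet_five] at h
    obtain ⟨h1, h2⟩ := eq_of_mem_line h
    have := re_le_of_mem_sph hz
    rw [h1, le_antisymm (by linarith) h2.1]
  · have : cutSet (sph (-2) ∪ line (Set.Icc (-1) 1) ∪ sph 2 : Set ℂ) =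
        Subtype.val ⁻¹' line (Set.Icc (-1) 1) := by
      ext z
      exact mem_cutSet_five z
    rw [this]
    exact ((isCompact_Icc.image Complex.continuous_ofReal).isClosed).preimage continuous_subtype_val

lemma shapeProperty_eight : ShapeProperty 8 (shapeModel 8) := by
  rw [shapeModel_eight]
  have h1 : ((1 : ℝ) : ℂ) ∈ line (Set.Ico 1 2) := ofReal_mem_line.2 (by norm_num)
  refine ⟨not_compactSpace_of_re ⟨_, Or.inr h1⟩ ?_, ?_⟩
  · intro z hz
    rcases lt_or_ge z.re 1 with h | h
    · exact ⟨_, Or.inr h1, by simpa using h⟩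
    · have h2 : z.re < 2 := by
        rcases hz with hz | hz
        · have := re_le_of_mem_sph hz
          linarith
        · exact (eq_of_mem_line hz).2.2
      refine ⟨((z.re + 2) / 2 : ℝ), Or.inr (ofReal_mem_line.2 ⟨by linarith, by linarith⟩), ?_⟩
      rw [Complex.ofReal_re]
      linarith
  · intro hs
    refine infinite_compl_cutSet (Y := sph 0 ∪ line (Set.Ico 1 2)) (c := 0) (p := ((1 : ℝ) : ℂ))
      Set.subset_union_left (fun z hz hne => ?_) hs.finite
    rw [mem_cutSet_subtype, not_not]
    refine isPreconnected_union_diff (isPreconnected_sph_diff _ _) ?_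
      (ofReal_mem_sph (by norm_num)) h1 hne.symm
    rw [Set.sdiff_singleton_eq_self]
    · exact isPreconnected_line Set.ordConnected_Ico
    · intro h
      obtain ⟨h2, h3⟩ := eq_of_mem_line h
      have := re_le_of_mem_sph hz
      exact hne (by rw [h2, le_antisymm (by linarith) h3.1])

lemma shapeProperty_shapeModel (k : Fin 9) : ShapeProperty k (shapeModel k) :=
  match k with
  | 0 => shapeProperty_zero
  | 1 => shapeProperty_one
  | 2 => shapeProperty_two
  | 3 => shapeProperty_three
  | 4 => shapeProperty_four
  | 5 => shapeProperty_five
  | 6 => shapeProperty_six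
  | 7 => shapeProperty_seven
  | 8 => shapeProperty_eight

/-- A model space is homeomorphic to exactly one of the nine. -/
theorem IsModelSpace.existsUnique_shapeModel {Y : Set ℂ} (hY : IsModelSpace Y) :
    ∃! k, Nonempty (Y ≃ₜ shapeModel k) := by
  obtain ⟨k, hk⟩ := hY.exists_hasShape
  obtain ⟨φ⟩ := IsGlued.homeomorph hk (hasShape_shapeModel k)
  refine ⟨k, ⟨φ⟩, fun l ⟨ψ⟩ => ?_⟩
  exact ((shapeProperty_shapeModel l).of_homeomorph (ψ.symm.trans φ)).unique
    (shapeProperty_shapeModel k)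

end ArcConnected

/-! ### Graphs realizing the nine shapes. -/

namespace SimpleGraph

open ArcConnected

/-- The graph on `W` whose edges join consecutive terms of the sequence `w`, up to the end of
`I`. -/
def seqGraph {W : Type*} (I : Set ℝ) (w : ℕ → W) : SimpleGraph W where
  Adj a b := a ≠ b ∧ ∃ n : ℕ, ((n + 1 : ℕ) : ℝ) ∈ I ∧ s(a, b) = s(w n, w (n + 1))
  symm := ⟨fun _ _ h => ⟨h.1.symm, by simpa only [Sym2.eq_swap] using h.2⟩⟩
  loopless := ⟨fun _ h => h.1 rfl⟩

variable {W : Type*} {w : ℕ → W}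

lemma seqGraph_gluedTour {I : Set ℝ} (hI : I = Set.Ici 0 ∨ ∃ N : ℕ, I = Set.Icc (0 : ℝ) N)
    (surj : ∀ v, ∃ n : ℕ, (n : ℝ) ∈ I ∧ w n = v)
    (ne : ∀ n : ℕ, ((n + 1 : ℕ) : ℝ) ∈ I → w n ≠ w (n + 1))
    (inj : ∀ m n : ℕ, m < n → ((n + 1 : ℕ) : ℝ) ∈ I → s(w m, w (m + 1)) ≠ s(w n, w (n + 1)))
    {P : ℝ → ℝ → Prop} (hP : ∀ m n : ℕ, m < n → (n : ℝ) ∈ I → (w m = w n ↔ P m n)) :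
    (seqGraph I w).GluedTour I P := by
  have adj : ∀ n : ℕ, ((n + 1 : ℕ) : ℝ) ∈ I → (seqGraph I w).Adj (w n) (w (n + 1)) :=
    fun n hn => ⟨ne n hn, n, hn, rfl⟩
  have hdown : ∀ n : ℕ, ((n + 1 : ℕ) : ℝ) ∈ I → (n : ℝ) ∈ I := by
    rcases hI with rfl | ⟨N, rfl⟩
    · exact fun n _ => Set.mem_Ici.2 n.cast_nonneg
    · intro n hn
      rw [natCast_mem_Icc] at hn ⊢
      omega
  have hreach : ∀ n : ℕ, (n : ℝ) ∈ I → (seqGraph I w).Reachable (w 0) (w n) := by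
    intro n
    induction n with
    | zero => exact fun _ => Reachable.refl _
    | succ n ih => exact fun hn => (ih (hdown n hn)).trans (adj n hn).reachable
  refine gluedTour_of_seq hI (fun a b => ?_) adj inj (fun n _ x hx => hx.2) hP
  obtain ⟨m, hm, rfl⟩ := surj a
  obtain ⟨n, hn, rfl⟩ := surj b
  exact (hreach m hm).symm.trans (hreach n hn)

/-- The conditions are bounded statements about natural numbers, so that `decide` settles them for
explicit lists; Q is the version of P for real times. -/
lemma seqGraph_gluedTour_Icc {N : ℕ} (surj : ∀ v, ∃ n < N + 1, w n = v)
    (ne : ∀ n < N, w n ≠ w (n + 1))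
    (inj : ∀ n < N, ∀ m < n, s(w m, w (m + 1)) ≠ s(w n, w (n + 1)))
    {P : ℕ → ℕ → Prop} (hP : ∀ n < N + 1, ∀ m < n, (w m = w n ↔ P m n))
    {Q : ℝ → ℝ → Prop} (hQ : ∀ m n : ℕ, P m n ↔ Q m n) :
    (seqGraph (Set.Icc 0 N) w).GluedTour (Set.Icc 0 N) Q := by
  refine seqGraph_gluedTour (Or.inr ⟨N, rfl⟩) (fun v => ?_) (fun n hn => ?_)
    (fun m n hmn hn => ?_) fun m n hmn hn => ?_
  · obtain ⟨n, hn, h⟩ := surj v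
    exact ⟨n, natCast_mem_Icc.2 (by omega), h⟩
  · rw [natCast_mem_Icc] at hn
    exact ne n hn
  · rw [natCast_mem_Icc] at hn
    exact inj n hn m hmn
  · rw [natCast_mem_Icc] at hn
    exact (hP n (by omega) m hmn).trans (hQ m n)

lemma seqGraph_gluedTour_Ici (surj : ∀ v, ∃ n, w n = v) (ne : ∀ n, w n ≠ w (n + 1))
    (inj : ∀ m n, m < n → s(w m, w (m + 1)) ≠ s(w n, w (n + 1)))
    {P : ℕ → ℕ → Prop} (hP : ∀ m n, m < n → (w m = w n ↔ P m n))
    {Q : ℝ → ℝ → Prop} (hQ : ∀ m n : ℕ, P m n ↔ Q m n) :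
    (seqGraph (Set.Ici 0) w).GluedTour (Set.Ici 0) Q := by
  refine seqGraph_gluedTour (Or.inl rfl) (fun v => ?_) (fun n _ => ne n)
    (fun m n hmn _ => inj m n hmn) fun m n hmn _ => (hP m n hmn).trans (hQ m n)
  obtain ⟨n, h⟩ := surj v
  exact ⟨n, Set.mem_Ici.2 n.cast_nonneg, h⟩

lemma exists_hasShape_zero : ∃ (W : Type) (H : SimpleGraph W), HasShape 0 H.OneComplex :=
  ⟨Fin 2, _, (seqGraph_gluedTour_Icc (N := 1) (w := fun n => [0, 1].getD n 0)
    (P := fun _ _ => False) (by decide) (by decide) (by decide) (by decide)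
    fun _ _ => Iff.rfl).arc one_pos⟩

lemma exists_hasShape_one : ∃ (W : Type) (H : SimpleGraph W), HasShape 1 H.OneComplex :=
  ⟨Fin 3, _, (seqGraph_gluedTour_Icc (N := 3) (w := fun n => [0, 1, 2, 0].getD n 0)
    (P := fun m n => m = 0 ∧ n = 3) (by decide) (by decide) (by decide) (by decide)
    fun m n => by norm_cast).circle three_pos⟩

lemma exists_hasShape_two : ∃ (W : Type) (H : SimpleGraph W), HasShape 2 H.OneComplex :=
  ⟨Fin 4, _, (seqGraph_gluedTour_Icc (N := 4) (w := fun n => [0, 1, 2, 0, 3].getD n 0)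
    (P := fun m n => m = 0 ∧ n = 3) (by decide) (by decide) (by decide) (by decide)
    fun m n => by norm_cast).lollipop (i := 3) (by norm_num) (by norm_num)⟩

lemma exists_hasShape_three : ∃ (W : Type) (H : SimpleGraph W), HasShape 3 H.OneComplex :=
  -- A 4-cycle followed by its chord from 0 to 2.
  ⟨Fin 4, _, (seqGraph_gluedTour_Icc (N := 5) (w := fun n => [0, 1, 2, 3, 0, 2].getD n 0)
    (P := fun m n => (m = 0 ∧ n = 4) ∨ (m = 2 ∧ n = 5)) (by decide) (by decide) (by decide)
    (by decide) fun m n => by norm_cast).theta (i := 4) (j := 2) (by norm_num) (by norm_num)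
    (by norm_num)⟩

lemma exists_hasShape_four : ∃ (W : Type) (H : SimpleGraph W), HasShape 4 H.OneComplex :=
  ⟨Fin 5, _, (seqGraph_gluedTour_Icc (N := 6) (w := fun n => [0, 1, 2, 0, 3, 4, 0].getD n 0)
    (P := fun m n => (m = 0 ∧ n = 3) ∨ (m = 0 ∧ n = 6) ∨ (m = 3 ∧ n = 6)) (by decide)
    (by decide) (by decide) (by decide) fun m n => by norm_cast).figureEight (i := 3)
    (by norm_num) (by norm_num)⟩

lemma exists_hasShape_five : ∃ (W : Type) (H : SimpleGraph W), HasShape 5 H.OneComplex :=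
  ⟨Fin 6, _, (seqGraph_gluedTour_Icc (N := 7) (w := fun n => [0, 1, 2, 0, 3, 4, 5, 3].getD n 0)
    (P := fun m n => (m = 0 ∧ n = 3) ∨ (m = 4 ∧ n = 7)) (by decide) (by decide) (by decide)
    (by decide) fun m n => by norm_cast).dumbbell (i := 3) (j := 4) (by norm_num) (by norm_num)
    (by norm_num)⟩

lemma exists_hasShape_six : ∃ (W : Type) (H : SimpleGraph W), HasShape 6 H.OneComplex := by
  refine ⟨ℕ, _, (seqGraph_gluedTour_Ici (w := id) (P := fun _ _ => False) (fun v => ⟨v, rfl⟩)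
    (fun n => n.lt_succ_self.ne) (fun m n hmn h => ?_) (fun m n hmn => iff_of_false hmn.ne id)
    fun _ _ => Iff.rfl).ray⟩
  rcases Sym2.eq_iff.1 h with ⟨h1, h2⟩ | ⟨h1, h2⟩ <;> simp only [id] at h1 h2 <;> omega

lemma exists_hasShape_seven : ∃ (W : Type) (H : SimpleGraph W), HasShape 7 H.OneComplex := by
  refine ⟨ℤ, fromRel fun a b => b = a + 1, GluedTour.line ⟨id, ⟨fun _ _ => trivial,
    fun _ _ => trivial, Set.ordConnected_univ, fun n _ _ => ?_, fun a b h => ?_,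
    fun m n _ _ _ _ h => ?_, fun v => ⟨v, trivial, rfl⟩⟩,
    fun m n _ _ hmn => iff_of_false hmn.ne id⟩⟩
  · exact (fromRel_adj _ _ _).2 ⟨(Int.lt_succ n).ne, Or.inl rfl⟩
  · rcases ((fromRel_adj _ _ _).1 h).2 with rfl | rfl
    · exact ⟨a, trivial, trivial, rfl⟩
    · exact ⟨b, trivial, trivial, Sym2.eq_swap⟩
  · rcases Sym2.eq_iff.1 h with ⟨h1, h2⟩ | ⟨h1, h2⟩ <;> simp only [id] at h1 h2 <;> omega

lemma exists_hasShape_eight : ∃ (W : Type) (H : SimpleGraph W), HasShape 8 H.OneComplex := by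
  -- The sequence 0, 1, 2, 0, 3, 4, 5, …: a triangle with a ray attached at 0.
  set w : ℕ → ℕ := fun n => if n < 3 then n else if n = 3 then 0 else n - 1 with hw
  refine ⟨ℕ, _, (seqGraph_gluedTour_Ici (w := w) (P := fun m n => m = 0 ∧ n = 3) (fun v => ?_)
    (fun n => ?_) (fun m n hmn h => ?_) (fun m n hmn => ?_)
    fun m n => by norm_cast).openLollipop (i := 3) (by norm_num)⟩
  · by_cases h : v < 3
    · exact ⟨v, if_pos h⟩
    · exact ⟨v + 1, by simp only [hw]; split_ifs <;> omega⟩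
  · simp only [hw]
    split_ifs <;> omega
  · rcases Sym2.eq_iff.1 h with ⟨h1, h2⟩ | ⟨h1, h2⟩ <;> simp only [hw] at h1 h2 <;>
      split_ifs at h1 h2 <;> omega
  · simp only [hw]
    split_ifs <;> omega

lemma exists_hasShape (k : Fin 9) :
    ∃ (W : Type) (H : SimpleGraph W), HasShape k H.OneComplex :=
  match k with
  | 0 => exists_hasShape_zero
  | 1 => exists_hasShape_one
  | 2 => exists_hasShape_two
  | 3 => exists_hasShape_three
  | 4 => exists_hasShape_four
  | 5 => exists_hasShape_five
  | 6 => exists_hasShape_six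
  | 7 => exists_hasShape_seven
  | 8 => exists_hasShape_eight

end SimpleGraph

theorem mainTheorem2 :
    -- the three conditions are equivalent for every non-degenerate graph
    (∀ (V : Type*) (G : SimpleGraph V), Nontrivial G.OneComplex →
      List.TFAE
        [ArcConnected.IsNAC 7 G.OneComplex,
         ArcConnected.IsOmegaAC G.OneComplex,
         ∃ Y : Set ℂ, ArcConnected.IsModelSpace Y ∧ Nonempty (G.OneComplex ≃ₜ Y)]) ∧
    -- every space in the third condition is a graph
    (∀ Y : Set ℂ, ArcConnected.IsModelSpace Y →
      ∃ (W : Type) (H : SimpleGraph W), Nonempty (H.OneComplex ≃ₜ Y)) ∧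
    -- up to homeomorphism there are exactly nine such spaces
    (∃ X : Fin 9 → Set ℂ, (∀ k, ArcConnected.IsModelSpace (X k)) ∧
      ∀ Y : Set ℂ, ArcConnected.IsModelSpace Y → ∃! k, Nonempty (Y ≃ₜ X k)) := by
  -- Uniqueness of k, applied with Y equal to one of the nine spaces, shows that they are pairwise
  -- non-homeomorphic.
  refine ⟨fun V G _ => ?_, fun Y hY => ?_, ArcConnected.shapeModel, ArcConnected.isModelSpace_shapeModel,
    fun Y hY => hY.existsUnique_shapeModel⟩
  · tfae_have 1 → 3 := fun h => by
      obtain ⟨k, hk⟩ := SimpleGraph.exists_hasShape_of_isNAC h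
      exact ⟨ArcConnected.shapeModel k, ArcConnected.isModelSpace_shapeModel k,
        IsGlued.homeomorph hk (ArcConnected.hasShape_shapeModel k)⟩
    tfae_have 3 → 2 := fun ⟨Y, hY, ⟨φ⟩⟩ => by
      obtain ⟨k, hk⟩ := hY.exists_hasShape
      exact ArcConnected.HasShape.isOmegaAC (IsGlued.of_homeomorph hk φ.symm)
    tfae_have 2 → 1 := fun h => h 7
    tfae_finish
  · obtain ⟨k, hk⟩ := hY.exists_hasShape
    obtain ⟨W, H, hH⟩ := SimpleGraph.exists_hasShape k
    exact ⟨W, H, IsGlued.homeomorph hH hk⟩
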